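/- Let $n_2,n_3\ge 1$ and $n=1+n_2+n_3$. Let $\phi:M^n\to\mathbb R^{n+1}$ be a smooth immersed hypersurface with affine (Blaschke) normal $\xi$, affine metric $h$ and induced connection $\nabla$, so that $D_XY=\nabla_XY+h(X,Y)\xi$ for the flat connection $D$ of $\mathbb R^{n+1}$. Let $\widehat\nabla$ be the Levi-Civita connection of $h$ and $K(X,Y)=\nabla_XY-\widehat\nabla_XY$ the difference tensor. Assume that $\phi$ is a positive definite hyperbolic affine hypersphere with mean curvature $\lambda<0$, i.e. $h$ is positive definite and $D_X\xi=-\lambda X$ for all tangent vectors $X$. Assume that there are mutually $h$-orthogonal smooth distributions $\mathcal D_1$, $\mathcal D_2$, $\mathcal D_3$ on $M$, where $\mathcal D_1$ is spanned by a smooth vector field $T$ with $h(T,T)=1$, $\dim\mathcal D_2=n_2$ and $\dim\mathcal D_3=n_3$, and real numbers $\lambda_1,\lambda_2,\lambda_3$ with $\lambda_1=\lambda_2+\lambda_3$ and $\lambda_2\lambda_3=\lambda$, such that $$K(T,T)=\lambda_1T,\quad K(T,V)=\lambda_2V,\quad K(T,W)=\lambda_3W,\quad K(V,W)=0$$ for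 all $V\in\mathcal D_2$, $W\in\mathcal D_3$. Then $\phi$ is locally the Calabi product of two hyperbolic affine hyperspheres of dimensions $n_2$ and $n_3$: for every point $x\in M$ there are positive definite hyperbolic affine hyperspheres $\psi_1:M_1^{n_2}\to\mathbb R^{n_2+1}$ and $\psi_2:M_2^{n_3}\to\mathbb R^{n_3+1}$ with mean curvature $-1$, centred at the origin (their affine normals are $\psi_1$ and $\psi_2$), with $M_i$ diffeomorphic to $\mathbb R^{n_{i+1}}$, an open interval $I$, constants $c_1,c_2>0$, and a diffeomorphism of $I\times M_1\times M_2$ onto an open neighbourhood of $x$ through which $\phi$ becomes, up to an equiaffine transformation $y\mapsto Ay+b$, $\det A=1$, of $\mathbb R^{n+1}$, $$(t,p,q)\mapsto\Bigl(c_1e^{\frac{\sqrt{n_3+1}}{\sqrt{n_2+1}}t}\,\psi_1(p),\ c_2e^{-\frac{\sqrt{n_2+1}}{\sqrt{n_3+1}}t}\,\psi_2(q)\Bigr)\in\mathbb R^{n_2+1}\times\mathbb R^{n_3+1}=\mathbb R^{n+1}.$$ -/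

import Mathlib

open scoped Manifold ContDiff

noncomputable section

/-- Euclidean space `ℝᵏ`, with its standard flat connection `D`. -/
abbrev Euc (k : ℕ) : Type := EuclideanSpace ℝ (Fin k)

section Hypersurface

variable {n : ℕ} {M : Type*} [TopologicalSpace M] [ChartedSpace (Euc n) M]

/-- `φ : Mⁿ → ℝⁿ⁺¹` is a smooth immersion: it is `C^∞` with everywhere injective differential. -/
structure IsSmoothImmersion (φ : M → Euc (n + 1)) : Prop where
  smooth : ContMDiff (𝓡 n) 𝓘(ℝ, Euc (n + 1)) ∞ φ
  injective : ∀ p, Function.Injective (mvfderiv (𝓡 n) φ p)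

/-- `D_v Y`: the derivative in the direction `v ∈ T_pM`, with respect to the flat connection `D`
of `ℝⁿ⁺¹`, of the vector field `dφ(Y)` along `φ`, for a vector field `Y` on `M`. -/
def flatDeriv (φ : M → Euc (n + 1)) (Y : Π q : M, TangentSpace (𝓡 n) q) (p : M)
    (v : TangentSpace (𝓡 n) p) : Euc (n + 1) :=
  mvfderiv (𝓡 n) (fun q ↦ mvfderiv (𝓡 n) φ q (Y q)) p v

/-- `ξ` is an affine normal (Blaschke normal) field of the immersion `φ` and `h` is the associated
affine metric. That is, `ξ` is a smooth transversal field, `h` is the `ξ`-component of `D`, i.e.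
`D_v Y - h(v,Y) ξ` is tangent to `M`; the derivative of `ξ` is tangent to `M`; and the volume of the
parallelepiped spanned by `dφ(X₁), …, dφ(Xₙ), ξ` is the `h`-volume of `X₁, …, Xₙ`.
These conditions determine the pair `(ξ, h)` up to a sign, and they force `h` to be nondegenerate.
The vector fields `Y` need only be defined and differentiable near the point considered,
their values elsewhere are irrelevant. -/
structure IsAffineNormal [IsManifold (𝓡 n) ∞ M] (φ ξ : M → Euc (n + 1))
    (h : Π p : M, TangentSpace (𝓡 n) p →L[ℝ] TangentSpace (𝓡 n) p →L[ℝ] ℝ) : Prop where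
  smooth : ContMDiff (𝓡 n) 𝓘(ℝ, Euc (n + 1)) ∞ ξ
  transversal : ∀ p, ξ p ∉ Set.range (mvfderiv (𝓡 n) φ p)
  gauss : ∀ (p : M) (Y : Π q : M, TangentSpace (𝓡 n) q) (v : TangentSpace (𝓡 n) p),
    MDifferentiableAt (𝓡 n) (𝓡 n).tangent
      (fun q ↦ (⟨q, Y q⟩ : TangentBundle (𝓡 n) M)) p →
    flatDeriv φ Y p v - h p v (Y p) • ξ p ∈ Set.range (mvfderiv (𝓡 n) φ p)
  weingarten : ∀ (p : M) (v : TangentSpace (𝓡 n) p),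
    mvfderiv (𝓡 n) ξ p v ∈ Set.range (mvfderiv (𝓡 n) φ p)
  volume : ∀ (p : M) (X : Fin n → TangentSpace (𝓡 n) p),
    (EuclideanSpace.basisFun (Fin (n + 1)) ℝ).toBasis.det
        (Fin.snoc (α := fun _ ↦ Euc (n + 1)) (fun i ↦ mvfderiv (𝓡 n) φ p (X i)) (ξ p)) ^ 2 =
      |Matrix.det (Matrix.of fun i j ↦ h p (X i) (X j))|

/-- `φ : Mⁿ → ℝⁿ⁺¹` is a positive definite hyperbolic affine hypersphere with affine mean
curvature `lam < 0`, with affine normal `ξ` and (positive definite) affine metric `h`: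
the affine shape operator `S`, given by `D_v ξ = -dφ(S v)`, is `lam` times the identity.
The positivity of `h` singles out one of the two choices `±ξ` of the affine normal. -/
structure IsHyperbolicAffineHypersphere [IsManifold (𝓡 n) ∞ M] (φ ξ : M → Euc (n + 1))
    (h : Π p : M, TangentSpace (𝓡 n) p →L[ℝ] TangentSpace (𝓡 n) p →L[ℝ] ℝ) (lam : ℝ) : Prop where
  immersion : IsSmoothImmersion φ
  affineNormal : IsAffineNormal φ ξ h
  posDef : ∀ (p : M) (v : TangentSpace (𝓡 n) p), v ≠ 0 → 0 < h p v v
  shape : ∀ (p : M) (v : TangentSpace (𝓡 n) p),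
    mvfderiv (𝓡 n) ξ p v = -mvfderiv (𝓡 n) φ p (lam • v)
  neg : lam < 0

/-- The connection `nab` is the induced affine connection: `D_v Y = dφ(∇_v Y) + h(v,Y) ξ`. -/
def IsInducedConnection [IsManifold (𝓡 n) ∞ M] (φ ξ : M → Euc (n + 1))
    (h : Π p : M, TangentSpace (𝓡 n) p →L[ℝ] TangentSpace (𝓡 n) p →L[ℝ] ℝ)
    (nab : CovariantDerivative (𝓡 n) (Euc n) (TangentSpace (𝓡 n) : M → Type _)) : Prop :=
  ∀ (p : M) (Y : Π q : M, TangentSpace (𝓡 n) q) (v : TangentSpace (𝓡 n) p),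
    MDifferentiableAt (𝓡 n) (𝓡 n).tangent
      (fun q ↦ (⟨q, Y q⟩ : TangentBundle (𝓡 n) M)) p →
    flatDeriv φ Y p v = mvfderiv (𝓡 n) φ p (nab Y p v) + h p v (Y p) • ξ p

/-- The connection `nab` is the Levi-Civita connection of `h`: it is torsion free and
`v(h(Y,Z)) = h(∇_v Y, Z) + h(Y, ∇_v Z)`. -/
structure IsLeviCivita [IsManifold (𝓡 n) ∞ M]
    (h : Π p : M, TangentSpace (𝓡 n) p →L[ℝ] TangentSpace (𝓡 n) p →L[ℝ] ℝ)
    (nab : CovariantDerivative (𝓡 n) (Euc n) (TangentSpace (𝓡 n) : M → Type _)) : Prop where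
  torsion_free : nab.torsion = 0
  metric : ∀ (p : M) (Y Z : Π q : M, TangentSpace (𝓡 n) q) (v : TangentSpace (𝓡 n) p),
    MDifferentiableAt (𝓡 n) (𝓡 n).tangent
      (fun q ↦ (⟨q, Y q⟩ : TangentBundle (𝓡 n) M)) p →
    MDifferentiableAt (𝓡 n) (𝓡 n).tangent
      (fun q ↦ (⟨q, Z q⟩ : TangentBundle (𝓡 n) M)) p →
    mvfderiv (𝓡 n) (fun q ↦ h q (Y q) (Z q)) p v =
      h p (nab Y p v) (Z p) + h p (Y p) (nab Z p v)

/-- The difference tensor `K(X, Y) = ∇_X Y - ∇̂_X Y` at the point `p`. -/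
def differenceTensor [IsManifold (𝓡 n) ∞ M]
    (nab nabHat : CovariantDerivative (𝓡 n) (Euc n) (TangentSpace (𝓡 n) : M → Type _))
    (p : M) (X Y : TangentSpace (𝓡 n) p) : TangentSpace (𝓡 n) p :=
  nab.difference nabHat p Y X

/-- `Dist` is a smooth distribution of dimension `k` on `M`: it is locally spanned by `k` smooth
vector fields which are linearly independent. -/
structure IsSmoothDistribution [IsManifold (𝓡 n) ∞ M] (k : ℕ)
    (Dist : Π p : M, Submodule ℝ (TangentSpace (𝓡 n) p)) : Prop where
  finrank_eq : ∀ p, Module.finrank ℝ (Dist p) = k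
  locally_spanned : ∀ p : M, ∃ U : Set M, IsOpen U ∧ p ∈ U ∧
    ∃ X : Fin k → Π q : M, TangentSpace (𝓡 n) q,
      (∀ i, ContMDiffOn (𝓡 n) (𝓡 n).tangent ∞
        (fun q ↦ (⟨q, X i q⟩ : TangentBundle (𝓡 n) M)) U) ∧
      ∀ q ∈ U, Dist q = Submodule.span ℝ (Set.range fun i ↦ X i q)

end Hypersurface

/-- The identification `ℝᵃ × ℝᵇ = ℝᶜ`, `c = a + b`, by concatenation of coordinates. -/
def concat {a b c : ℕ} (hc : c = a + b) (u : Euc a) (v : Euc b) : Euc c :=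
  WithLp.toLp 2 fun i ↦ Fin.append u v (Fin.cast hc i)

/-- The Calabi product
`(t, p, q) ↦ (c₁ exp(√(n₃+1) t / √(n₂+1)) ψ₁(p), c₂ exp(-√(n₂+1) t / √(n₃+1)) ψ₂(q))`
of `ψ₁ : M₁ → ℝ^{n₂+1}` and `ψ₂ : M₂ → ℝ^{n₃+1}`, with constants `c₁`, `c₂`. -/
def calabiProduct {n n₂ n₃ : ℕ} (hn : 1 + n₂ + n₃ = n) {M₁ M₂ : Type*} (c₁ c₂ : ℝ)
    (ψ₁ : M₁ → Euc (n₂ + 1)) (ψ₂ : M₂ → Euc (n₃ + 1)) (x : ℝ × M₁ × M₂) : Euc (n + 1) :=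
  concat (show n + 1 = (n₂ + 1) + (n₃ + 1) by omega)
    ((c₁ * Real.exp (√(n₃ + 1) * x.1 / √(n₂ + 1))) • ψ₁ x.2.1)
    ((c₂ * Real.exp (-(√(n₂ + 1) * x.1 / √(n₃ + 1)))) • ψ₂ x.2.2)

/-- `φ` is, near the point `p`, a Calabi product of two hyperbolic affine hyperspheres
`ψ₁ : M₁ → ℝ^{n₂+1}` and `ψ₂ : M₂ → ℝ^{n₃+1}` of dimensions `n₂`, `n₃` and mean curvature `-1`.
Here the hyperspheres are centred at the origin, i.e. their affine normals are `ψ₁` and `ψ₂`,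
as it is understood in the construction of the product. As the assertion is local, the manifolds
`M₁` and `M₂` may be taken to be coordinate neighbourhoods, diffeomorphic to `ℝ^{n₂}` and `ℝ^{n₃}`.
There are an open interval `I = (a, b)` and a diffeomorphism `e` of `I × M₁ × M₂` onto an open
neighbourhood of `p` such that `φ ∘ e` is the Calabi product, up to the equiaffine transformation
`y ↦ A y + o`, `det A = 1`, of `ℝⁿ⁺¹`. -/
def IsLocallyCalabiProductAt {n n₂ n₃ : ℕ} (hn : 1 + n₂ + n₃ = n)
    {M : Type*} [TopologicalSpace M] [ChartedSpace (Euc n) M]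
    (φ : M → Euc (n + 1)) (p : M) : Prop :=
  ∃ (ψ₁ : Euc n₂ → Euc (n₂ + 1)) (ψ₂ : Euc n₃ → Euc (n₃ + 1))
    (h₁ : Π x : Euc n₂, TangentSpace (𝓡 n₂) x →L[ℝ] TangentSpace (𝓡 n₂) x →L[ℝ] ℝ)
    (h₂ : Π x : Euc n₃, TangentSpace (𝓡 n₃) x →L[ℝ] TangentSpace (𝓡 n₃) x →L[ℝ] ℝ)
    (c₁ c₂ a b : ℝ)
    (e : OpenPartialHomeomorph (ℝ × Euc n₂ × Euc n₃) M)
    (A : Euc (n + 1) →ₗ[ℝ] Euc (n + 1)) (o : Euc (n + 1)),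
    IsHyperbolicAffineHypersphere ψ₁ ψ₁ h₁ (-1) ∧
    IsHyperbolicAffineHypersphere ψ₂ ψ₂ h₂ (-1) ∧
    0 < c₁ ∧ 0 < c₂ ∧
    e.source = Set.Ioo a b ×ˢ Set.univ ∧ p ∈ e.target ∧
    ContMDiffOn 𝓘(ℝ, ℝ × Euc n₂ × Euc n₃) (𝓡 n) ∞ e e.source ∧
    ContMDiffOn (𝓡 n) 𝓘(ℝ, ℝ × Euc n₂ × Euc n₃) ∞ e.symm e.target ∧
    LinearMap.det A = 1 ∧
    ∀ x ∈ e.source, φ (e x) = A (calabiProduct hn c₁ c₂ ψ₁ ψ₂ x) + o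

end

noncomputable section

/-! ### Derivatives of smooth maps on open sets. -/

section Calculus

variable {E F G : Type*} [NormedAddCommGroup E] [NormedSpace ℝ E]
  [NormedAddCommGroup F] [NormedSpace ℝ F] [NormedAddCommGroup G] [NormedSpace ℝ G]
  {U : Set E} {f g : E → F} {x : E}

/-! Since dξ = -λ dφ, the map φ is locally a translate of f = -ξ/λ, so it suffices to study a
centroaffine immersion in a chart: D²f = f_*Γ - λ h f. Its conormal map ν, with ν(f) = 1 and ν ∘ df
= 0, is again centroaffine, with the same metric and the conjugate connection Γ - 2K
(`IsCentroaffine.conormal_isCentroaffine`). This duality makes h(K·,·) totally symmetric. Comparing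
the integrability conditions of f_*T and ν_*T yields the Gauss and Codazzi equations along T
(`exists_hessianPair`).

The crux is that T is parallel for the Levi-Civita connection. Put N = ∇̂T. As λ₂λ₃ = λ < 0, the
eigenvalues λ₂, λ₃ are distinct, and the components of the Codazzi equation show that NT = 0, that
h(NV,V') = 0 within each distribution, and that h(∇̂_T V, W) = h(NV, W); hence N is skew
(`metric_N_skew`). The Gauss equation for V and T has no curvature term, because λ = λ₂λ₃, and reads
∇̂_T(NV) = N(∇̂_T V) - N²V. Pairing it with V, where h(NV,V) = 0 identically, leaves h(NV,NV) = 0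
(`N_V`, `N_eq_zero`).

With T parallel, h(T,·) = dτ, and the maps G₂ = e^{-λ₂τ}(f_*T - λ₃f)/(λ₂-λ₃) and its counterpart G₃
have derivatives only along 𝒟₂ and 𝒟₃ respectively (`fderiv_factorMap`), while f = e^{λ₂τ}G₂ +
e^{λ₃τ}G₃. The functions τ, G₂, G₃ furnish a product chart (`exists_product`). The analogous
combinations of ν_*T and ν are conormals of the factors which annihilate the opposite factor, so
that the two factors lie in complementary subspaces (`IsConormalPair.exists_linearEquiv`).

Finally, the Blaschke volume condition of f separates in the variables t, p, q. Constancy in t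
forces (n₂+1)λ₂ + (n₃+1)λ₃ = 0, which gives the Calabi exponents after rescaling τ; what remains is
the volume condition of each factor up to a constant (`exists_volume_constants`), and this constant
is absorbed in c₁ and c₂. -/

lemma ContDiffOn.fderiv_infty (hf : ContDiffOn ℝ ∞ f U) (hU : IsOpen U) :
    ContDiffOn ℝ ∞ (fderiv ℝ f) U :=
  hf.fderiv_of_isOpen hU (by simp)

lemma ContDiffOn.differentiableAt_infty (hf : ContDiffOn ℝ ∞ f U) (hU : IsOpen U) (hx : x ∈ U) :
    DifferentiableAt ℝ f x :=
  (hf.contDiffAt (hU.mem_nhds hx)).differentiableAt (by simp)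

lemma IsOpen.fderiv_eq_of_eqOn (hU : IsOpen U) (hx : x ∈ U) (h : Set.EqOn f g U) :
    fderiv ℝ f x = fderiv ℝ g x :=
  (Filter.eventuallyEq_of_mem (hU.mem_nhds hx) h).fderiv_eq

lemma fderiv_clm_apply_apply {c : E → F →L[ℝ] G} (hc : DifferentiableAt ℝ c x)
    (hf : DifferentiableAt ℝ f x) (w : E) :
    fderiv ℝ (fun y ↦ c y (f y)) x w = fderiv ℝ c x w (f x) + c x (fderiv ℝ f x w) := by
  rw [fderiv_clm_apply hc hf]
  simp [add_comm]

lemma ContDiffOn.fderiv_fderiv_symm (hf : ContDiffOn ℝ ∞ f U) (hU : IsOpen U) (hx : x ∈ U)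
    (u v : E) : fderiv ℝ (fderiv ℝ f) x u v = fderiv ℝ (fderiv ℝ f) x v u :=
  ((hf.contDiffAt (hU.mem_nhds hx)).isSymmSndFDerivAt
    (by simpa using WithTop.coe_le_coe.2 (le_top (a := (2 : ℕ∞))))).eq u v

end Calculus

/-! ### Centroaffine immersions, their conormal maps and duality. -/

section CentroAffine

variable {E W : Type*} [NormedAddCommGroup E] [NormedSpace ℝ E]
  [NormedAddCommGroup W] [NormedSpace ℝ W]

/-- `f` is a centroaffine immersion of the open set `U` whose position vector field, multiplied
by `-lam`, is a transversal field with second fundamental form `H` and induced connection `Γ`. -/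
structure IsCentroaffine (U : Set E) (lam : ℝ) (f : E → W) (Γ : E → E → E → E)
    (H : E → E →L[ℝ] E →L[ℝ] ℝ) : Prop where
  isOpen : IsOpen U
  smooth : ContDiffOn ℝ ∞ f U
  transversal : ∀ x ∈ U, ∀ (u : E) (a : ℝ), fderiv ℝ f x u + a • f x = 0 → u = 0 ∧ a = 0
  gauss : ∀ x ∈ U, ∀ u v, fderiv ℝ (fderiv ℝ f) x u v =
    fderiv ℝ f x (Γ x u v) - (lam * H x u v) • f x

/-- The linear map `(u, a) ↦ Df u + a f`. -/
def frameMap (f : E → W) (x : E) : E × ℝ →L[ℝ] W :=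
  (fderiv ℝ f x).coprod ((1 : ℝ →L[ℝ] ℝ).smulRight (f x))

@[simp] lemma frameMap_apply (f : E → W) (x u : E) (a : ℝ) :
    frameMap f x (u, a) = fderiv ℝ f x u + a • f x := by simp [frameMap]

/-- The conormal map of a centroaffine immersion. -/
def conormal (f : E → W) (x : E) : W →L[ℝ] ℝ :=
  (ContinuousLinearMap.snd ℝ E ℝ).comp (frameMap f x).inverse

namespace IsCentroaffine

variable {U : Set E} {lam : ℝ} {f : E → W} {Γ : E → E → E → E} {H : E → E →L[ℝ] E →L[ℝ] ℝ}
  {x : E}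

lemma ext (hf : IsCentroaffine U lam f Γ H) (hx : x ∈ U) {u v : E} {a b : ℝ}
    (h : fderiv ℝ f x u + a • f x = fderiv ℝ f x v + b • f x) : u = v ∧ a = b := by
  have := hf.transversal x hx (u - v) (a - b) (by
    rw [map_sub, sub_smul, ← sub_eq_zero.2 h]; abel)
  exact ⟨sub_eq_zero.1 this.1, sub_eq_zero.1 this.2⟩

/-- The second derivative of `f` is symmetric, and its tangential and radial parts are unique by
transversality. Only the product `lam * H` occurs in the radial part, whence `hlam`. -/
lemma symm (hf : IsCentroaffine U lam f Γ H) (hlam : lam ≠ 0) (hx : x ∈ U) (u v : E) :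
    Γ x u v = Γ x v u ∧ H x u v = H x v u := by
  have h := hf.smooth.fderiv_fderiv_symm hf.isOpen hx u v
  rw [hf.gauss x hx, hf.gauss x hx, sub_eq_add_neg, sub_eq_add_neg, ← neg_smul, ← neg_smul] at h
  obtain ⟨h1, h2⟩ := hf.ext hx h
  exact ⟨h1, mul_left_cancel₀ hlam (neg_injective h2)⟩

lemma contDiffOn_frameMap (hf : IsCentroaffine U lam f Γ H) : ContDiffOn ℝ ∞ (frameMap f) U := by
  have h1 := hf.smooth.fderiv_infty hf.isOpen
  have : frameMap f = fun x ↦ (fderiv ℝ f x).comp (ContinuousLinearMap.fst ℝ E ℝ) +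
      (ContinuousLinearMap.smulRightL ℝ (E × ℝ) W (ContinuousLinearMap.snd ℝ E ℝ)) (f x) := by
    ext x u <;> simp [frameMap]
  rw [this]
  exact (h1.clm_comp contDiffOn_const).add (contDiffOn_const.clm_apply hf.smooth)

variable [FiniteDimensional ℝ E] [FiniteDimensional ℝ W]

lemma isInvertible (hf : IsCentroaffine U lam f Γ H)
    (hd : Module.finrank ℝ W = Module.finrank ℝ E + 1) (hx : x ∈ U) :
    (frameMap f x).IsInvertible := by
  have hinj : Function.Injective (frameMap f x : E × ℝ →ₗ[ℝ] W) := by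
    rw [← LinearMap.ker_eq_bot, LinearMap.ker_eq_bot']
    rintro ⟨u, a⟩ h
    have := hf.transversal x hx u a (by simpa using h)
    simp [this.1, this.2]
  have hdim : Module.finrank ℝ (E × ℝ) = Module.finrank ℝ W := by simp [hd]
  refine ⟨(LinearMap.linearEquivOfInjective _ hinj hdim).toContinuousLinearEquiv, ?_⟩
  ext <;> simp

/-- Components with respect to the moving frame are smooth because inversion is smooth at an
invertible operator. The conormal, the metric and the covariant derivative of a field inherit their
smoothness from this. -/
lemma contDiffOn_inverse (hf : IsCentroaffine U lam f Γ H)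
    (hd : Module.finrank ℝ W = Module.finrank ℝ E + 1) :
    ContDiffOn ℝ ∞ (fun x ↦ (frameMap f x).inverse) U := by
  intro x hx
  have : CompleteSpace (E × ℝ) := FiniteDimensional.complete ℝ _
  obtain ⟨e, he⟩ := hf.isInvertible hd hx
  have h2 := (contDiffAt_map_inverse (n := ∞) e)
  rw [he] at h2
  exact (h2.comp x (hf.contDiffOn_frameMap.contDiffAt (hf.isOpen.mem_nhds hx))).contDiffWithinAt

lemma inverse_apply (hf : IsCentroaffine U lam f Γ H)
    (hd : Module.finrank ℝ W = Module.finrank ℝ E + 1) (hx : x ∈ U) (u : E) (a : ℝ) :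
    (frameMap f x).inverse (fderiv ℝ f x u + a • f x) = (u, a) := by
  rw [← frameMap_apply, (hf.isInvertible hd hx).inverse_apply_self]

lemma exists_eq (hf : IsCentroaffine U lam f Γ H)
    (hd : Module.finrank ℝ W = Module.finrank ℝ E + 1) (hx : x ∈ U) (w : W) :
    ∃ (u : E) (a : ℝ), w = fderiv ℝ f x u + a • f x := by
  obtain ⟨e, he⟩ := hf.isInvertible hd hx
  refine ⟨(e.symm w).1, (e.symm w).2, ?_⟩
  rw [← frameMap_apply, ← he]
  simp

lemma contDiffOn_conormal (hf : IsCentroaffine U lam f Γ H)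
    (hd : Module.finrank ℝ W = Module.finrank ℝ E + 1) : ContDiffOn ℝ ∞ (conormal f) U :=
  contDiffOn_const.clm_comp (hf.contDiffOn_inverse hd)

lemma conormal_self (hf : IsCentroaffine U lam f Γ H)
    (hd : Module.finrank ℝ W = Module.finrank ℝ E + 1) (hx : x ∈ U) :
    conormal f x (f x) = 1 := by
  have := hf.inverse_apply hd hx 0 1
  simp only [map_zero, one_smul, zero_add] at this
  simp [conormal, this]

lemma conormal_fderiv (hf : IsCentroaffine U lam f Γ H)
    (hd : Module.finrank ℝ W = Module.finrank ℝ E + 1) (hx : x ∈ U) (u : E) :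
    conormal f x (fderiv ℝ f x u) = 0 := by
  have := hf.inverse_apply hd hx u 0
  simp only [zero_smul, add_zero] at this
  simp [conormal, this]

/-- Differentiate ν(f_*v) = 0: the conormal sees only the radial part of D²f. -/
lemma fderiv_conormal_fderiv (hf : IsCentroaffine U lam f Γ H)
    (hd : Module.finrank ℝ W = Module.finrank ℝ E + 1) (hx : x ∈ U) (u v : E) :
    fderiv ℝ (conormal f) x u (fderiv ℝ f x v) = lam * H x u v := by
  have h0 := hf.isOpen.fderiv_eq_of_eqOn hx (f := fun y ↦ conormal f y (fderiv ℝ f y v))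
    (g := fun _ ↦ (0 : ℝ)) fun y hy ↦ hf.conormal_fderiv hd hy v
  have hν := (hf.contDiffOn_conormal hd).differentiableAt_infty hf.isOpen hx
  have hf' := (hf.smooth.fderiv_infty hf.isOpen).differentiableAt_infty hf.isOpen hx
  have h1 := fderiv_clm_apply_apply (f := fun y ↦ fderiv ℝ f y v) hν
    (hf'.clm_apply (differentiableAt_const v)) u
  rw [h0, fderiv_clm_apply_apply hf' (differentiableAt_const v), hf.gauss x hx] at h1
  simp [hf.conormal_self hd hx, hf.conormal_fderiv hd hx] at h1
  linarith

lemma fderiv_conormal_self (hf : IsCentroaffine U lam f Γ H)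
    (hd : Module.finrank ℝ W = Module.finrank ℝ E + 1) (hx : x ∈ U) (u : E) :
    fderiv ℝ (conormal f) x u (f x) = 0 := by
  have h0 := hf.isOpen.fderiv_eq_of_eqOn hx (f := fun y ↦ conormal f y (f y))
    (g := fun _ ↦ (1 : ℝ)) fun y hy ↦ hf.conormal_self hd hy
  have hν := (hf.contDiffOn_conormal hd).differentiableAt_infty hf.isOpen hx
  have h1 := fderiv_clm_apply_apply hν (hf.smooth.differentiableAt_infty hf.isOpen hx) u
  rw [h0] at h1
  simpa [hf.conormal_fderiv hd hx] using h1.symm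

/-- Smoothness of `H` is not part of `IsCentroaffine`; it follows by expressing `H` through the
derivatives of `f` and of its conormal. -/
lemma contDiffOn_metric (hf : IsCentroaffine U lam f Γ H) (hlam : lam ≠ 0)
    (hd : Module.finrank ℝ W = Module.finrank ℝ E + 1) : ContDiffOn ℝ ∞ H U := by
  have : Set.EqOn H (fun x ↦ lam⁻¹ • (((ContinuousLinearMap.compL ℝ E W ℝ).flip
      (fderiv ℝ f x)).comp (fderiv ℝ (conormal f) x))) U := by
    intro x hx
    ext u v
    simp [hf.fderiv_conormal_fderiv hd hx, hlam]
  refine ContDiffOn.congr ?_ this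
  exact ((contDiffOn_const.clm_apply (hf.smooth.fderiv_infty hf.isOpen)).clm_comp
    ((hf.contDiffOn_conormal hd).fderiv_infty hf.isOpen)).const_smul _

/-- The dual equation: the conormal map is again centroaffine for the same metric, with
the conjugate connection; in particular the cubic form is totally symmetric. -/
lemma conormal_isCentroaffine (hf : IsCentroaffine U lam f Γ H) (hlam : lam ≠ 0)
    (hd : Module.finrank ℝ W = Module.finrank ℝ E + 1) {K : E → E →L[ℝ] E →L[ℝ] E}
    (hpos : ∀ x ∈ U, ∀ u, u ≠ 0 → 0 < H x u u)
    (hK : ∀ x ∈ U, ∀ u v, K x u v = K x v u)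
    (hmetric : ∀ x ∈ U, ∀ w u v, fderiv ℝ H x w u v =
      H x (Γ x w u - K x w u) v + H x u (Γ x w v - K x w v)) :
    IsCentroaffine U lam (conormal f) (fun x u v ↦ Γ x u v - (2 : ℝ) • K x u v) H ∧
    ∀ x ∈ U, ∀ u v w, H x (K x w u) v = H x (K x w v) u := by
  have hν := hf.contDiffOn_conormal hd
  -- Differentiate dν(v)(f_*w) = λ H(v,w). The radial part of D²f drops out because dν(v)(f) = 0,
  -- and `hmetric` replaces the derivative of `H`.
  have key : ∀ x ∈ U, ∀ u v w, fderiv ℝ (fderiv ℝ (conormal f)) x u v (fderiv ℝ f x w) =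
      lam * (H x (Γ x u v - K x u v) w - H x v (K x u w)) := by
    intro x hx u v w
    have dν := (hν.fderiv_infty hf.isOpen).differentiableAt_infty hf.isOpen hx
    have hf' := (hf.smooth.fderiv_infty hf.isOpen).differentiableAt_infty hf.isOpen hx
    have dH := (hf.contDiffOn_metric hlam hd).differentiableAt_infty hf.isOpen hx
    have h0 := hf.isOpen.fderiv_eq_of_eqOn hx
      (f := fun y ↦ fderiv ℝ (conormal f) y v (fderiv ℝ f y w))
      (g := fun y ↦ lam * H y v w) fun y hy ↦ hf.fderiv_conormal_fderiv hd hy v w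
    have h1 := fderiv_clm_apply_apply (c := fun y ↦ fderiv ℝ (conormal f) y v)
      (f := fun y ↦ fderiv ℝ f y w) (dν.clm_apply (differentiableAt_const v))
      (hf'.clm_apply (differentiableAt_const w)) u
    have h2 : fderiv ℝ (fun y ↦ lam * H y v w) x u = lam * fderiv ℝ H x u v w := by
      rw [fderiv_const_mul (by fun_prop)]
      have := fderiv_clm_apply_apply (c := fun y ↦ H y v) (f := fun _ ↦ w)
        (dH.clm_apply (differentiableAt_const v)) (differentiableAt_const w) u
      have h' := fderiv_clm_apply_apply dH (differentiableAt_const v) u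
      simp at this h'
      simp [this, h']
    rw [h0, h2, fderiv_clm_apply_apply dν (differentiableAt_const v),
      fderiv_clm_apply_apply hf' (differentiableAt_const w), hf.gauss x hx, hmetric x hx] at h1
    simp [hf.fderiv_conormal_fderiv hd hx, hf.fderiv_conormal_self hd hx] at h1
    simp
    linarith
  -- Antisymmetrising the previous formula in `u`, `v` cancels the Christoffel terms and leaves the
  -- symmetry of the cubic form.
  have hsym : ∀ x ∈ U, ∀ u v w, H x (K x w u) v = H x (K x w v) u := by
    intro x hx u v w
    have h := hν.fderiv_fderiv_symm hf.isOpen hx u v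
    have h' := DFunLike.congr_fun h (fderiv ℝ f x w)
    rw [key x hx, key x hx, (hf.symm hlam hx u v).1, hK x hx u v] at h'
    have := mul_left_cancel₀ hlam h'
    rw [hK x hx w u, hK x hx w v, (hf.symm hlam hx _ v).2, (hf.symm hlam hx _ u).2]
    linarith
  refine ⟨⟨hf.isOpen, hν, ?_, ?_⟩, hsym⟩
  -- Transversality for ν: evaluation at `f` gives `a = 0`, and evaluation at f_*u then gives λ
  -- H(u,u) = 0, so definiteness applies.
  · intro x hx u a h
    have ha := DFunLike.congr_fun h (f x)
    simp [hf.fderiv_conormal_self hd hx, hf.conormal_self hd hx] at ha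
    refine ⟨?_, ha⟩
    by_contra hu
    have h' := DFunLike.congr_fun h (fderiv ℝ f x u)
    simp [hf.fderiv_conormal_fderiv hd hx, ha, hlam] at h'
    exact (hpos x hx u hu).ne' h'
  · intro x hx u v
    have dν := (hν.fderiv_infty hf.isOpen).differentiableAt_infty hf.isOpen hx
    have df := hf.smooth.differentiableAt_infty hf.isOpen hx
    ext w
    -- Functionals are compared on the moving frame of `f`: tangent vectors use `key`, and the
    -- position vector uses the derivative of dν(v)(f) = 0.
    obtain ⟨w, a, rfl⟩ := hf.exists_eq hd hx w
    have h0 := hf.isOpen.fderiv_eq_of_eqOn hx (f := fun y ↦ fderiv ℝ (conormal f) y v (f y))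
      (g := fun _ ↦ (0 : ℝ)) fun y hy ↦ hf.fderiv_conormal_self hd hy v
    have h1 := fderiv_clm_apply_apply (c := fun y ↦ fderiv ℝ (conormal f) y v)
      (dν.clm_apply (differentiableAt_const v)) df u
    rw [h0, fderiv_clm_apply_apply dν (differentiableAt_const v)] at h1
    simp [hf.fderiv_conormal_fderiv hd hx] at h1
    have h2 : H x v (K x u w) = H x (K x u v) w := by
      rw [(hf.symm hlam hx _ _).2, hsym x hx]
    simp only [map_add, map_smul, key x hx, sub_apply,
      smul_apply, hf.fderiv_conormal_fderiv hd hx, hf.conormal_self hd hx,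
      hf.conormal_fderiv hd hx, hf.fderiv_conormal_self hd hx, h2, map_sub, smul_eq_mul]
    rw [(hf.symm hlam hx v u).2] at h1
    linear_combination (-a) * h1

/-- The derivative of a tangent field along a centroaffine immersion, and the symmetry
of its second derivative. -/
lemma exists_endomorphism (hf : IsCentroaffine U lam f Γ H) (hlam : lam ≠ 0)
    (hd : Module.finrank ℝ W = Module.finrank ℝ E + 1) {T : E → E} (hT : ContDiffOn ℝ ∞ T U) :
    ∃ P : E → E →L[ℝ] E, ContDiffOn ℝ ∞ P U ∧
      (∀ x ∈ U, ∀ u, P x u = Γ x u (T x) + fderiv ℝ T x u) ∧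
      (∀ x ∈ U, ∀ u, fderiv ℝ (fun y ↦ fderiv ℝ f y (T y)) x u =
        fderiv ℝ f x (P x u) - (lam * H x u (T x)) • f x) ∧
      ∀ x ∈ U, ∀ u w, Γ x w (P x u) + fderiv ℝ P x w u - (lam * H x u (T x)) • w =
        Γ x u (P x w) + fderiv ℝ P x u w - (lam * H x w (T x)) • u := by
  have hU := hf.isOpen
  have hf' := hf.smooth.fderiv_infty hU
  have hσ : ContDiffOn ℝ ∞ (fun y ↦ fderiv ℝ f y (T y)) U := hf'.clm_apply hT
  have hH := hf.contDiffOn_metric hlam hd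
  -- The tangential part of D(f_*T), read off from the inverse frame. Defined this way it is visibly
  -- linear and smooth, which the formula with the unrestricted function `Γ` would not show.
  let P : E → E →L[ℝ] E := fun x ↦ (ContinuousLinearMap.fst ℝ E ℝ).comp
    ((frameMap f x).inverse.comp (fderiv ℝ (fun y ↦ fderiv ℝ f y (T y)) x))
  have hP : ContDiffOn ℝ ∞ P U := contDiffOn_const.clm_comp
    ((hf.contDiffOn_inverse hd).clm_comp (hσ.fderiv_infty hU))
  have dσ : ∀ x ∈ U, ∀ u, fderiv ℝ (fun y ↦ fderiv ℝ f y (T y)) x u =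
      fderiv ℝ f x (Γ x u (T x) + fderiv ℝ T x u) + (-(lam * H x u (T x))) • f x := by
    intro x hx u
    rw [fderiv_clm_apply_apply (hf'.differentiableAt_infty hU hx)
      (hT.differentiableAt_infty hU hx), hf.gauss x hx, map_add]
    module
  have hP' : ∀ x ∈ U, ∀ u, P x u = Γ x u (T x) + fderiv ℝ T x u := by
    intro x hx u
    simp only [P, ContinuousLinearMap.comp_apply]
    rw [dσ x hx, hf.inverse_apply hd hx]
    rfl
  have dσ' : ∀ x ∈ U, ∀ u, fderiv ℝ (fun y ↦ fderiv ℝ f y (T y)) x u =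
        fderiv ℝ f x (P x u) - (lam * H x u (T x)) • f x := by
    intro x hx u
    rw [dσ x hx, hP' x hx, neg_smul, sub_eq_add_neg]
  refine ⟨P, hP, hP', dσ', ?_⟩
  intro x hx
  -- Only the tangential part of the second derivative is needed, so its radial coefficient `b`
  -- stays unspecified.
  have key : ∀ u w, ∃ b : ℝ, fderiv ℝ (fderiv ℝ (fun y ↦ fderiv ℝ f y (T y))) x w u =
      fderiv ℝ f x (Γ x w (P x u) + fderiv ℝ P x w u - (lam * H x u (T x)) • w) + b • f x := by
    intro u w
    have d1 := (hσ.fderiv_infty hU).differentiableAt_infty hU hx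
    have d2 := hf'.differentiableAt_infty hU hx
    have d3 := hP.differentiableAt_infty hU hx
    have d4 := hf.smooth.differentiableAt_infty hU hx
    have d5 : DifferentiableAt ℝ (fun y ↦ lam * H y u (T y)) x :=
      (((hH.differentiableAt_infty hU hx).clm_apply (differentiableAt_const u)).clm_apply
        (hT.differentiableAt_infty hU hx)).const_mul lam
    have h0 := hU.fderiv_eq_of_eqOn hx (fun y hy ↦ dσ' y hy u)
    have h1 := fderiv_clm_apply_apply d1 (differentiableAt_const u) w
    have d6 : DifferentiableAt ℝ (fun y ↦ P y u) x := d3.clm_apply (differentiableAt_const u)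
    have d7 : DifferentiableAt ℝ (fun y ↦ (lam * H y u (T y)) • f y) x := d5.smul d4
    rw [h0, fderiv_fun_sub (d2.clm_apply d6) d7, sub_apply,
      fderiv_clm_apply_apply d2 d6, fderiv_clm_apply_apply d3 (differentiableAt_const u),
      fderiv_fun_smul d5 d4, hf.gauss x hx] at h1
    simp at h1
    refine ⟨- (lam * H x w (P x u)) - fderiv ℝ (fun y ↦ lam * H y u (T y)) x w, ?_⟩
    rw [← h1]
    simp only [map_add, map_sub, map_smul]
    module
  intro u w
  obtain ⟨b, hb⟩ := key u w
  obtain ⟨c, hc⟩ := key w u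
  rw [hσ.fderiv_fderiv_symm hU hx, hc] at hb
  exact (hf.ext hx hb.symm).1

end IsCentroaffine

end CentroAffine

/-! ### Adapted frames; the Gauss and Codazzi equations along T. -/

section CalabiFrame

variable {E W : Type*} [NormedAddCommGroup E] [NormedSpace ℝ E]
  [NormedAddCommGroup W] [NormedSpace ℝ W] {ι κ : Type*}

/-- A centroaffine hypersurface in local coordinates, with Levi-Civita connection `Γ - K` of the
metric, and with an adapted frame `T`, `V i`, `Z j` with respect to which the difference tensor
`K` has the form that characterizes Calabi products. -/
structure IsCalabiFrame (U : Set E) (lam l₂ l₃ : ℝ) (f : E → W) (Γ : E → E → E → E)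
    (H : E → E →L[ℝ] E →L[ℝ] ℝ) (K : E → E →L[ℝ] E →L[ℝ] E) (T : E → E) (V : ι → E → E)
    (Z : κ → E → E) : Prop extends IsCentroaffine U lam f Γ H where
  neg : lam < 0
  prod : l₂ * l₃ = lam
  posDef : ∀ x ∈ U, ∀ u, u ≠ 0 → 0 < H x u u
  K_symm : ∀ x ∈ U, ∀ u v, K x u v = K x v u
  metric : ∀ x ∈ U, ∀ w u v, fderiv ℝ H x w u v =
      H x (Γ x w u - K x w u) v + H x u (Γ x w v - K x w v)
  smooth_T : ContDiffOn ℝ ∞ T U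
  smooth_V : ∀ i, ContDiffOn ℝ ∞ (V i) U
  smooth_Z : ∀ i, ContDiffOn ℝ ∞ (Z i) U
  T_unit : ∀ x ∈ U, H x (T x) (T x) = 1
  T_V : ∀ x ∈ U, ∀ i, H x (T x) (V i x) = 0
  T_Z : ∀ x ∈ U, ∀ j, H x (T x) (Z j x) = 0
  V_Z : ∀ x ∈ U, ∀ i j, H x (V i x) (Z j x) = 0
  K_T_T : ∀ x ∈ U, K x (T x) (T x) = (l₂ + l₃) • T x
  K_T_V : ∀ x ∈ U, ∀ i, K x (T x) (V i x) = l₂ • V i x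
  K_T_Z : ∀ x ∈ U, ∀ j, K x (T x) (Z j x) = l₃ • Z j x
  K_V_Z : ∀ x ∈ U, ∀ i j, K x (V i x) (Z j x) = 0
  span : ∀ x ∈ U, Submodule.span ℝ ({T x} ∪ Set.range (fun i ↦ V i x) ∪
    Set.range (fun j ↦ Z j x)) = ⊤

/-- The covariant derivative, in coordinates, of the vector field `Y` in the direction `w`
with respect to the connection with Christoffel symbols `Γ - K`. -/
def covDerivAt (Γ : E → E → E → E) (K : E → E →L[ℝ] E →L[ℝ] E) (Y : E → E) (x w : E) : E :=
  fderiv ℝ Y x w + Γ x w (Y x) - K x w (Y x)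

namespace IsCalabiFrame

variable {U : Set E} {lam l₂ l₃ : ℝ} {f : E → W} {Γ : E → E → E → E}
    {H : E → E →L[ℝ] E →L[ℝ] ℝ} {K : E → E →L[ℝ] E →L[ℝ] E} {T : E → E} {V : ι → E → E}
    {Z : κ → E → E} {x : E}

/-- The hypotheses are symmetric in the two distributions, so each statement about `V` and `l₂` also
serves for `Z` and `l₃`. -/
lemma swap (S : IsCalabiFrame U lam l₂ l₃ f Γ H K T V Z) :
    IsCalabiFrame U lam l₃ l₂ f Γ H K T Z V where
  toIsCentroaffine := S.toIsCentroaffine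
  neg := S.neg
  prod := by rw [mul_comm, S.prod]
  posDef := S.posDef
  K_symm := S.K_symm
  metric := S.metric
  smooth_T := S.smooth_T
  smooth_V := S.smooth_Z
  smooth_Z := S.smooth_V
  T_unit := S.T_unit
  T_V := S.T_Z
  T_Z := S.T_V
  V_Z := fun x hx i j ↦ by rw [(S.symm S.neg.ne hx _ _).2, S.V_Z x hx]
  K_T_T := fun x hx ↦ by rw [add_comm, S.K_T_T x hx]
  K_T_V := S.K_T_Z
  K_T_Z := S.K_T_V
  K_V_Z := fun x hx i j ↦ by rw [S.K_symm x hx, S.K_V_Z x hx]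
  span := fun x hx ↦ by rw [Set.union_assoc, Set.union_comm (Set.range _), ← Set.union_assoc,
    S.span x hx]

/-- Equality would make `lam` a square, against `lam < 0`. -/
lemma ne (S : IsCalabiFrame U lam l₂ l₃ f Γ H K T V Z) : l₂ ≠ l₃ := by
  rintro h
  have h1 := S.prod
  have h2 := S.neg
  rw [← h1, h] at h2
  nlinarith [mul_self_nonneg l₃]

lemma metric_symm (S : IsCalabiFrame U lam l₂ l₃ f Γ H K T V Z) (hx : x ∈ U) (u v : E) :
    H x u v = H x v u := (S.symm S.neg.ne hx u v).2

/-- `Γ` is a bare function; its linearity is recovered from that of D²f and the uniqueness of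
tangential parts. -/
lemma christoffel_smul (S : IsCalabiFrame U lam l₂ l₃ f Γ H K T V Z) (hx : x ∈ U) (u v : E)
    (a : ℝ) : Γ x u (a • v) = a • Γ x u v := by
  have h := S.gauss x hx u (a • v)
  rw [map_smul, S.gauss x hx] at h
  refine (S.ext hx (a := -(a * (lam * H x u v))) (b := -(lam * H x u (a • v))) ?_).1.symm
  rw [neg_smul, neg_smul, ← sub_eq_add_neg, ← sub_eq_add_neg, ← h, map_smul]
  module

lemma christoffel_add (S : IsCalabiFrame U lam l₂ l₃ f Γ H K T V Z) (hx : x ∈ U) (u v w : E) :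
    Γ x u (v + w) = Γ x u v + Γ x u w := by
  have h := S.gauss x hx u (v + w)
  rw [map_add, S.gauss x hx, S.gauss x hx] at h
  refine (S.ext hx (a := -(lam * H x u (v + w)))
    (b := -(lam * H x u v) - (lam * H x u w)) ?_).1
  rw [neg_smul, ← sub_eq_add_neg, ← h, map_add]
  module

lemma christoffel_sub (S : IsCalabiFrame U lam l₂ l₃ f Γ H K T V Z) (hx : x ∈ U) (u v w : E) :
    Γ x u (v - w) = Γ x u v - Γ x u w := by
  rw [eq_sub_iff_add_eq, ← S.christoffel_add hx, sub_add_cancel]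

lemma eq_of_frame (S : IsCalabiFrame U lam l₂ l₃ f Γ H K T V Z) (hx : x ∈ U)
    {G : Type*} [AddCommGroup G] [Module ℝ G] {α β : E →ₗ[ℝ] G} (hT : α (T x) = β (T x))
    (hV : ∀ i, α (V i x) = β (V i x)) (hZ : ∀ j, α (Z j x) = β (Z j x)) : α = β := by
  refine LinearMap.ext_on (S.span x hx) ?_
  rintro v ((rfl | ⟨i, rfl⟩) | ⟨j, rfl⟩)
  exacts [hT, hV i, hZ j]

lemma eq_zero_of_frame (S : IsCalabiFrame U lam l₂ l₃ f Γ H K T V Z) (hx : x ∈ U)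
    {u : E} (hT : H x u (T x) = 0) (hV : ∀ i, H x u (V i x) = 0) (hZ : ∀ j, H x u (Z j x) = 0) :
    u = 0 := by
  by_contra hu
  have h := S.eq_of_frame hx (α := (H x u : E →ₗ[ℝ] ℝ)) (β := 0) (by simpa using hT)
    (by simpa using hV) (by simpa using hZ)
  have := S.posDef x hx u hu
  rw [show H x u u = 0 from DFunLike.congr_fun h u] at this
  exact this.ne rfl

variable [FiniteDimensional ℝ E] [FiniteDimensional ℝ W]

lemma conormal_isCentroaffine' (S : IsCalabiFrame U lam l₂ l₃ f Γ H K T V Z)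
    (hd : Module.finrank ℝ W = Module.finrank ℝ E + 1) :
    IsCentroaffine U lam (conormal f) (fun x u v ↦ Γ x u v - (2 : ℝ) • K x u v) H :=
  (S.conormal_isCentroaffine S.neg.ne hd S.posDef S.K_symm S.metric).1

lemma cubic_symm (S : IsCalabiFrame U lam l₂ l₃ f Γ H K T V Z)
    (hd : Module.finrank ℝ W = Module.finrank ℝ E + 1) (hx : x ∈ U) (u v w : E) :
    H x (K x w u) v = H x (K x w v) u :=
  (S.conormal_isCentroaffine S.neg.ne hd S.posDef S.K_symm S.metric).2 x hx u v w

lemma fderiv_metric (S : IsCalabiFrame U lam l₂ l₃ f Γ H K T V Z)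
    (hd : Module.finrank ℝ W = Module.finrank ℝ E + 1) (hx : x ∈ U) {Y Y' : E → E}
    (hY : DifferentiableAt ℝ Y x) (hY' : DifferentiableAt ℝ Y' x) (w : E) :
    fderiv ℝ (fun y ↦ H y (Y y) (Y' y)) x w =
      H x (covDerivAt Γ K Y x w) (Y' x) + H x (Y x) (covDerivAt Γ K Y' x w) := by
  have dH := (S.contDiffOn_metric S.neg.ne hd).differentiableAt_infty S.isOpen hx
  rw [fderiv_clm_apply_apply (dH.clm_apply hY) hY', fderiv_clm_apply_apply dH hY]
  simp only [add_apply, S.metric x hx, covDerivAt, map_add, map_sub, sub_apply]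
  ring

/-- The second fundamental equations for the field `T`: `N` is the covariant derivative of `T` for
the Levi-Civita connection, `k` is the endomorphism `K(T, ·)`. -/
structure IsHessianPair (lam : ℝ) (U : Set E) (f : E → W) (Γ : E → E → E → E)
    (H : E → E →L[ℝ] E →L[ℝ] ℝ) (K : E → E →L[ℝ] E →L[ℝ] E) (T : E → E)
    (N k : E → E →L[ℝ] E) : Prop where
  smooth_N : ContDiffOn ℝ ∞ N U
  smooth_k : ContDiffOn ℝ ∞ k U
  N_apply : ∀ x ∈ U, ∀ u, N x u = covDerivAt Γ K T x u
  k_apply : ∀ x ∈ U, ∀ u, k x u = K x u (T x)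
  fderiv_eq : ∀ x ∈ U, ∀ u, fderiv ℝ (fun y ↦ fderiv ℝ f y (T y)) x u =
    fderiv ℝ f x (N x u + k x u) - (lam * H x u (T x)) • f x
  fderiv_conormal_eq : ∀ x ∈ U, ∀ u, fderiv ℝ (fun y ↦ fderiv ℝ (conormal f) y (T y)) x u =
    fderiv ℝ (conormal f) x (N x u - k x u) - (lam * H x u (T x)) • conormal f x
  symm_N : ∀ x ∈ U, ∀ u w, Γ x w (N x u) - K x w (N x u) + fderiv ℝ N x w u + K x w (k x u)
      - (lam * H x u (T x)) • w =
    Γ x u (N x w) - K x u (N x w) + fderiv ℝ N x u w + K x u (k x w) - (lam * H x w (T x)) • u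
  symm_k : ∀ x ∈ U, ∀ u w, Γ x w (k x u) - K x w (k x u) + fderiv ℝ k x w u + K x w (N x u) =
    Γ x u (k x w) - K x u (k x w) + fderiv ℝ k x u w + K x u (N x w)

/-- The tangential derivatives P of f_*T and Q of ν_*T are ∇T and ∇*T for conjugate connections.
Half their sum is ∇̂T and half their difference is K(·,T). The same combinations of the two
integrability conditions give the Gauss-type identity `symm_N` and the Codazzi-type identity
`symm_k`. -/
lemma exists_hessianPair (S : IsCalabiFrame U lam l₂ l₃ f Γ H K T V Z)
    (hd : Module.finrank ℝ W = Module.finrank ℝ E + 1) :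
    ∃ N k : E → E →L[ℝ] E, IsHessianPair lam U f Γ H K T N k := by
  obtain ⟨P, hP, hPa, hPf, hPs⟩ := S.exists_endomorphism S.neg.ne hd S.smooth_T
  obtain ⟨Q, hQ, hQa, hQf, hQs⟩ := (S.conormal_isCentroaffine' hd).exists_endomorphism S.neg.ne
    (by simpa [Subspace.dual_finrank_eq] using
      ((LinearMap.toContinuousLinearMap (𝕜 := ℝ) (E := W) (F' := ℝ)).symm.finrank_eq.trans
        (Subspace.dual_finrank_eq)).trans hd) S.smooth_T
  have hU := S.isOpen
  refine ⟨fun x ↦ (2⁻¹ : ℝ) • (P x + Q x), fun x ↦ (2⁻¹ : ℝ) • (P x - Q x),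
    (hP.add hQ).const_smul _, (hP.sub hQ).const_smul _, ?_, ?_, ?_, ?_, ?_, ?_⟩
  · intro x hx u
    simp only [smul_apply, add_apply, hPa x hx, hQa x hx, covDerivAt]
    module
  · intro x hx u
    simp only [smul_apply, sub_apply, hPa x hx, hQa x hx]
    module
  · intro x hx u
    rw [hPf x hx]
    congr 2
    simp only [smul_apply, sub_apply, add_apply]
    module
  · intro x hx u
    rw [hQf x hx]
    congr 2
    simp only [smul_apply, sub_apply, add_apply]
    module
  all_goals
    intro x hx u w
    have dP := hP.differentiableAt_infty hU hx
    have dQ := hQ.differentiableAt_infty hU hx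
    have h1 := hPs x hx u w
    have h2 := hQs x hx u w
    first
    | rw [fderiv_fun_const_smul (dP.fun_add dQ), fderiv_fun_add dP dQ]
    | rw [fderiv_fun_const_smul (dP.fun_sub dQ), fderiv_fun_sub dP dQ]
    simp only [smul_apply, sub_apply, add_apply, S.christoffel_smul hx, S.christoffel_add hx,
      S.christoffel_sub hx, map_smul, map_add, map_sub] at h1 h2 ⊢
    first
    | linear_combination (norm := module) (2⁻¹ : ℝ) • h1 + (2⁻¹ : ℝ) • h2
    | linear_combination (norm := module) (2⁻¹ : ℝ) • h1 - (2⁻¹ : ℝ) • h2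

end IsCalabiFrame

end CalabiFrame

/-! ### The field T is parallel for the Levi-Civita connection. -/

section Parallel

variable {E W : Type*} [NormedAddCommGroup E] [NormedSpace ℝ E]
  [NormedAddCommGroup W] [NormedSpace ℝ W] {ι κ : Type*}

namespace IsCalabiFrame

variable {U : Set E} {lam l₂ l₃ : ℝ} {f : E → W} {Γ : E → E → E → E}
    {H : E → E →L[ℝ] E →L[ℝ] ℝ} {K : E → E →L[ℝ] E →L[ℝ] E} {T : E → E} {V : ι → E → E}
    {Z : κ → E → E} {x : E} {N k : E → E →L[ℝ] E}

/-- This is `symm_k` at the pair (V, T), with the derivatives of `k` eliminated by differentiating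
the eigenvector equations k V = l₂ V and k T = (l₂ + l₃) T. Its components along T, V and Z are
exploited separately below. -/
lemma codazzi_V (S : IsCalabiFrame U lam l₂ l₃ f Γ H K T V Z)
    (hN : IsHessianPair lam U f Γ H K T N k) (hx : x ∈ U) (i : ι) :
    l₂ • covDerivAt Γ K (V i) x (T x) - k x (covDerivAt Γ K (V i) x (T x)) + k x (N x (V i x)) =
      (l₂ + l₃) • N x (V i x) - k x (N x (V i x)) + K x (V i x) (N x (T x)) := by
  have hU := S.isOpen
  have dk := hN.smooth_k.differentiableAt_infty hU hx
  have dV := (S.smooth_V i).differentiableAt_infty hU hx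
  have dT := S.smooth_T.differentiableAt_infty hU hx
  have kV : ∀ y ∈ U, k y (V i y) = l₂ • V i y := fun y hy ↦ by
    rw [hN.k_apply y hy, S.K_symm y hy, S.K_T_V y hy]
  have kT : ∀ y ∈ U, k y (T y) = (l₂ + l₃) • T y := fun y hy ↦ by
    rw [hN.k_apply y hy, S.K_T_T y hy]
  have h1 := fderiv_clm_apply_apply dk dV (T x)
  rw [hU.fderiv_eq_of_eqOn hx kV, fderiv_fun_const_smul dV, smul_apply] at h1
  have h2 := fderiv_clm_apply_apply dk dT (V i x)
  rw [hU.fderiv_eq_of_eqOn hx kT, fderiv_fun_const_smul dT, smul_apply] at h2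
  have h := hN.symm_k x hx (V i x) (T x)
  have hNV := hN.N_apply x hx (V i x)
  simp only [kV x hx, kT x hx, S.christoffel_smul hx, map_smul] at h
  have hK : K x (T x) (N x (V i x)) = k x (N x (V i x)) := by
    rw [hN.k_apply x hx, S.K_symm x hx]
  have hk : k x (N x (V i x)) = k x (fderiv ℝ T x (V i x)) + k x (Γ x (T x) (V i x))
      - k x (K x (T x) (V i x)) := by
    rw [hNV, covDerivAt, S.K_symm x hx, (S.symm S.neg.ne hx _ _).1]
    simp
  have hNV' : N x (V i x) = fderiv ℝ T x (V i x) + Γ x (T x) (V i x) - K x (T x) (V i x) := by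
    rw [hNV, covDerivAt, S.K_symm x hx, (S.symm S.neg.ne hx _ _).1]
  rw [hK, S.K_symm x hx (V i x) (T x), (S.symm S.neg.ne hx (V i x) (T x)).1] at h
  simp only [covDerivAt, map_add, map_sub] at *
  linear_combination (norm := module) h + h1 - h2 + hk + (l₂ + l₃) • hNV'.symm

variable [FiniteDimensional ℝ E] [FiniteDimensional ℝ W]

lemma metric_k (S : IsCalabiFrame U lam l₂ l₃ f Γ H K T V Z)
    (hd : Module.finrank ℝ W = Module.finrank ℝ E + 1)
    (hN : IsHessianPair lam U f Γ H K T N k) (hx : x ∈ U) (u v : E) :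
    H x (k x u) v = H x u (k x v) := by
  rw [hN.k_apply x hx, hN.k_apply x hx, S.K_symm x hx, S.cubic_symm hd hx, S.metric_symm hx,
    S.K_symm x hx v]

lemma metric_N_T (S : IsCalabiFrame U lam l₂ l₃ f Γ H K T V Z)
    (hd : Module.finrank ℝ W = Module.finrank ℝ E + 1)
    (hN : IsHessianPair lam U f Γ H K T N k) (hx : x ∈ U) (u : E) : H x (N x u) (T x) = 0 := by
  have dT := S.smooth_T.differentiableAt_infty S.isOpen hx
  have h := S.fderiv_metric hd hx dT dT u
  rw [S.isOpen.fderiv_eq_of_eqOn hx S.T_unit, ← hN.N_apply x hx, S.metric_symm hx (T x)] at h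
  simp at h
  linarith

lemma metric_covDeriv_T (S : IsCalabiFrame U lam l₂ l₃ f Γ H K T V Z)
    (hd : Module.finrank ℝ W = Module.finrank ℝ E + 1)
    (hN : IsHessianPair lam U f Γ H K T N k) (hx : x ∈ U) (i : ι) (u : E) :
    H x (covDerivAt Γ K (V i) x u) (T x) = - H x (N x u) (V i x) := by
  have dT := S.smooth_T.differentiableAt_infty S.isOpen hx
  have dV := (S.smooth_V i).differentiableAt_infty S.isOpen hx
  have h := S.fderiv_metric hd hx dT dV u
  rw [S.isOpen.fderiv_eq_of_eqOn hx (fun y hy ↦ S.T_V y hy i), ← hN.N_apply x hx,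
    S.metric_symm hx (T x)] at h
  simp at h
  linarith

lemma metric_covDeriv_V_Z (S : IsCalabiFrame U lam l₂ l₃ f Γ H K T V Z)
    (hd : Module.finrank ℝ W = Module.finrank ℝ E + 1) (hx : x ∈ U) (i : ι) (j : κ) (u : E) :
    H x (covDerivAt Γ K (V i) x u) (Z j x) = - H x (covDerivAt Γ K (Z j) x u) (V i x) := by
  have dZ := (S.smooth_Z j).differentiableAt_infty S.isOpen hx
  have dV := (S.smooth_V i).differentiableAt_infty S.isOpen hx
  have h := S.fderiv_metric hd hx dV dZ u
  rw [S.isOpen.fderiv_eq_of_eqOn hx (fun y hy ↦ S.V_Z y hy i j), S.metric_symm hx (V i x)] at h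
  simp at h
  linarith

/-- The T-component of `codazzi_V` reads l₃ h(NT,V) = l₂ h(NT,V), and l₂ ≠ l₃. -/
lemma metric_N_T_V (S : IsCalabiFrame U lam l₂ l₃ f Γ H K T V Z)
    (hd : Module.finrank ℝ W = Module.finrank ℝ E + 1)
    (hN : IsHessianPair lam U f Γ H K T N k) (hx : x ∈ U) (i : ι) :
    H x (N x (T x)) (V i x) = 0 := by
  have h := congrArg (fun u ↦ H x u (T x)) (S.codazzi_V hN hx i)
  have kT : k x (T x) = (l₂ + l₃) • T x := by rw [hN.k_apply x hx, S.K_T_T x hx]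
  simp only [map_add, map_sub, map_smul, add_apply, sub_apply, smul_apply, S.metric_k hd hN hx, kT, S.metric_N_T hd hN hx, S.metric_covDeriv_T hd hN hx,
    smul_eq_mul] at h
  rw [S.cubic_symm hd hx, S.K_symm x hx, S.K_T_V x hx, map_smul, smul_apply, smul_eq_mul,
    S.metric_symm hx (V i x)] at h
  have h' : (l₂ - l₃) * H x (N x (T x)) (V i x) = 0 := by linarith
  exact (mul_eq_zero.1 h').resolve_left (sub_ne_zero.2 S.ne)

lemma N_T (S : IsCalabiFrame U lam l₂ l₃ f Γ H K T V Z)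
    (hd : Module.finrank ℝ W = Module.finrank ℝ E + 1)
    (hN : IsHessianPair lam U f Γ H K T N k) (hx : x ∈ U) : N x (T x) = 0 :=
  S.eq_zero_of_frame hx (S.metric_N_T hd hN hx _) (fun i ↦ S.metric_N_T_V hd hN hx i)
    (fun j ↦ S.swap.metric_N_T_V hd hN hx j)

/-- The V-component of `codazzi_V`, with NT = 0: the terms in ∇̂_T V cancel, leaving l₂ h(NV,V') =
l₃ h(NV,V'). -/
lemma metric_N_V_V (S : IsCalabiFrame U lam l₂ l₃ f Γ H K T V Z)
    (hd : Module.finrank ℝ W = Module.finrank ℝ E + 1)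
    (hN : IsHessianPair lam U f Γ H K T N k) (hx : x ∈ U) (i j : ι) :
    H x (N x (V i x)) (V j x) = 0 := by
  have h := congrArg (fun u ↦ H x u (V j x)) (S.codazzi_V hN hx i)
  have kV : k x (V j x) = l₂ • V j x := by rw [hN.k_apply x hx, S.K_symm x hx, S.K_T_V x hx]
  simp only [map_add, map_sub, map_smul, add_apply, sub_apply, smul_apply, S.metric_k hd hN hx,
    kV, S.N_T hd hN hx, map_zero, zero_apply, smul_eq_mul] at h
  have h' : (l₂ - l₃) * H x (N x (V i x)) (V j x) = 0 := by linarith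
  exact (mul_eq_zero.1 h').resolve_left (sub_ne_zero.2 S.ne)

/-- The Z-component of `codazzi_V`. It links N to ∇̂_T V, whose mixed components are skew because V
and Z stay orthogonal; this is what makes N skew. -/
lemma metric_covDeriv_T_Z (S : IsCalabiFrame U lam l₂ l₃ f Γ H K T V Z)
    (hd : Module.finrank ℝ W = Module.finrank ℝ E + 1)
    (hN : IsHessianPair lam U f Γ H K T N k) (hx : x ∈ U) (i : ι) (j : κ) :
    H x (covDerivAt Γ K (V i) x (T x)) (Z j x) = H x (N x (V i x)) (Z j x) := by
  have h := congrArg (fun u ↦ H x u (Z j x)) (S.codazzi_V hN hx i)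
  have kZ : k x (Z j x) = l₃ • Z j x := by rw [hN.k_apply x hx, S.K_symm x hx, S.K_T_Z x hx]
  simp only [map_add, map_sub, map_smul, add_apply, sub_apply, smul_apply, S.metric_k hd hN hx,
    kZ, S.N_T hd hN hx, map_zero, zero_apply, smul_eq_mul] at h
  have h' : (l₂ - l₃) * (H x (covDerivAt Γ K (V i) x (T x)) (Z j x) - H x (N x (V i x)) (Z j x))
    = 0 := by linarith
  exact sub_eq_zero.1 ((mul_eq_zero.1 h').resolve_left (sub_ne_zero.2 S.ne))

/-- The covariant derivative of `T` is skew-symmetric. -/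
lemma metric_N_skew (S : IsCalabiFrame U lam l₂ l₃ f Γ H K T V Z)
    (hd : Module.finrank ℝ W = Module.finrank ℝ E + 1)
    (hN : IsHessianPair lam U f Γ H K T N k) (hx : x ∈ U) (u v : E) :
    H x (N x u) v = - H x (N x v) u := by
  have hVZ : ∀ i j, H x (N x (V i x)) (Z j x) = - H x (N x (Z j x)) (V i x) := by
    intro i j
    rw [← S.metric_covDeriv_T_Z hd hN hx, ← S.swap.metric_covDeriv_T_Z hd hN hx,
      S.metric_covDeriv_V_Z hd hx]
  have : (H x).comp (N x) = - ((H x).comp (N x)).flip := by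
    refine ContinuousLinearMap.coe_injective (S.eq_of_frame hx ?_ ?_ ?_)
    · ext v
      simp [S.N_T hd hN hx, S.metric_N_T hd hN hx]
    · intro i
      refine ContinuousLinearMap.coe_injective (S.eq_of_frame hx ?_ ?_ ?_)
      · simp [S.N_T hd hN hx, S.metric_N_T hd hN hx]
      · simp [S.metric_N_V_V hd hN hx]
      · simp [hVZ]
    · intro i
      refine ContinuousLinearMap.coe_injective (S.eq_of_frame hx ?_ ?_ ?_)
      · simp [S.N_T hd hN hx, S.metric_N_T hd hN hx]
      · simp [hVZ]
      · simp [S.swap.metric_N_V_V hd hN hx]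
  exact DFunLike.congr_fun (DFunLike.congr_fun this u) v

/-- A Riccati argument. The algebraic terms of `symm_N` at (V, T) cancel because λ = l₂l₃, so
∇̂_T(NV) = N(∇̂_T V) - N²V. Differentiate h(NV,V) = 0 along T: skewness of N cancels the terms with
∇̂_T V and turns the rest into h(NV,NV) = 0. -/
lemma N_V (S : IsCalabiFrame U lam l₂ l₃ f Γ H K T V Z)
    (hd : Module.finrank ℝ W = Module.finrank ℝ E + 1)
    (hN : IsHessianPair lam U f Γ H K T N k) (hx : x ∈ U) (i : ι) : N x (V i x) = 0 := by
  have hU := S.isOpen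
  have dN := hN.smooth_N.differentiableAt_infty hU hx
  have dV := (S.smooth_V i).differentiableAt_infty hU hx
  have dT := S.smooth_T.differentiableAt_infty hU hx
  have dNV : DifferentiableAt ℝ (fun y ↦ N y (V i y)) x := dN.clm_apply dV
  have kV : k x (V i x) = l₂ • V i x := by rw [hN.k_apply x hx, S.K_symm x hx, S.K_T_V x hx]
  have kT : k x (T x) = (l₂ + l₃) • T x := by rw [hN.k_apply x hx, S.K_T_T x hx]
  have h1 := fderiv_clm_apply_apply dN dV (T x)
  have h2 := fderiv_clm_apply_apply dN dT (V i x)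
  rw [hU.fderiv_eq_of_eqOn hx (g := fun _ ↦ (0 : E)) (fun y hy ↦ S.N_T hd hN hy)] at h2
  have hΓ0 : Γ x (V i x) 0 = 0 := by simpa using S.christoffel_smul hx (V i x) 0 0
  have h := hN.symm_N x hx (V i x) (T x)
  simp only [kV, kT, S.N_T hd hN hx, hΓ0, map_smul, map_zero, S.K_symm x hx (V i x) (T x),
    S.K_T_V x hx, S.T_unit x hx, S.metric_symm hx (V i x), S.T_V x hx] at h
  simp at h2
  have hNV : N x (V i x) = fderiv ℝ T x (V i x) + Γ x (T x) (V i x) - l₂ • V i x := by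
    rw [hN.N_apply x hx, covDerivAt, S.K_symm x hx (V i x), (S.symm S.neg.ne hx _ _).1,
      S.K_T_V x hx]
  have key : covDerivAt Γ K (fun y ↦ N y (V i y)) x (T x) =
      N x (covDerivAt Γ K (V i) x (T x)) - N x (N x (V i x)) := by
    have e1 := congrArg (N x) hNV
    simp only [covDerivAt, map_add, map_sub, S.K_T_V x hx] at e1 ⊢
    rw [e1]
    have hlam := S.prod
    subst hlam
    linear_combination (norm := module) h + h1 - h2
  have h3 := S.fderiv_metric hd hx dNV dV (T x)
  rw [hU.fderiv_eq_of_eqOn hx (g := fun _ ↦ (0 : ℝ)) (fun y hy ↦ S.metric_N_V_V hd hN hy i i),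
    key] at h3
  simp only [map_sub, sub_apply, fderiv_fun_const, Pi.zero_apply, zero_apply] at h3
  rw [S.metric_N_skew hd hN hx _ (V i x), S.metric_N_skew hd hN hx (N x (V i x)) (V i x)] at h3
  by_contra hne
  have := S.posDef x hx _ hne
  linarith

/-- The field `T` is parallel for the Levi-Civita connection of the metric. -/
lemma N_eq_zero (S : IsCalabiFrame U lam l₂ l₃ f Γ H K T V Z)
    (hd : Module.finrank ℝ W = Module.finrank ℝ E + 1)
    (hN : IsHessianPair lam U f Γ H K T N k) (hx : x ∈ U) : N x = 0 :=
  ContinuousLinearMap.coe_injective (S.eq_of_frame hx (by simpa using S.N_T hd hN hx)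
    (fun i ↦ by simpa using S.N_V hd hN hx i) (fun i ↦ by simpa using S.swap.N_V hd hN hx i))

end IsCalabiFrame

end Parallel

/-! ### The two factor maps and their conormals. -/

section Factors

variable {E W : Type*} [NormedAddCommGroup E] [NormedSpace ℝ E]
  [NormedAddCommGroup W] [NormedSpace ℝ W] {ι κ : Type*}

/-- The orthogonal projection onto the distribution on which `k` is `l₂`. -/
def factorProj (l₂ l₃ : ℝ) (H : E → E →L[ℝ] E →L[ℝ] ℝ) (T : E → E) (k : E → E →L[ℝ] E)
    (x : E) : E →L[ℝ] E :=
  (l₂ - l₃)⁻¹ • (k x - l₃ • ContinuousLinearMap.id ℝ E - l₂ • (H x (T x)).smulRight (T x))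

/-- The map which is the immersion of the factor tangent to the `l₂`-distribution. -/
def factorMap (l₂ l₃ : ℝ) (τ : E → ℝ) (f : E → W) (T : E → E) (x : E) : W :=
  (l₂ - l₃)⁻¹ • Real.exp (-(l₂ * τ x)) • (fderiv ℝ f x (T x) - l₃ • f x)

/-- The conormal map of the factor tangent to the `l₂`-distribution. -/
def factorDual (l₂ l₃ : ℝ) (τ : E → ℝ) (f : E → W) (T : E → E) (x : E) : W →L[ℝ] ℝ :=
  l₃⁻¹ • Real.exp (l₂ * τ x) • (fderiv ℝ (conormal f) x (T x) + l₃ • conormal f x)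

namespace IsCalabiFrame

variable {U : Set E} {lam l₂ l₃ : ℝ} {f : E → W} {Γ : E → E → E → E}
    {H : E → E →L[ℝ] E →L[ℝ] ℝ} {K : E → E →L[ℝ] E →L[ℝ] E} {T : E → E} {V : ι → E → E}
    {Z : κ → E → E} {x : E} {N k : E → E →L[ℝ] E} {τ : E → ℝ}

lemma ne_zero (S : IsCalabiFrame U lam l₂ l₃ f Γ H K T V Z) : l₂ ≠ 0 ∧ l₃ ≠ 0 :=
  mul_ne_zero_iff.1 (S.prod ▸ S.neg.ne)

lemma coeff_pos (S : IsCalabiFrame U lam l₂ l₃ f Γ H K T V Z) : 0 < (l₂ - l₃) * l₂ := by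
  nlinarith [S.neg, S.prod, mul_self_nonneg l₂]

section Projections

variable (S : IsCalabiFrame U lam l₂ l₃ f Γ H K T V Z) (hN : IsHessianPair lam U f Γ H K T N k)
include S hN

lemma factorProj_T (hx : x ∈ U) : factorProj l₂ l₃ H T k x (T x) = 0 := by
  simp [factorProj, S.T_unit x hx, hN.k_apply x hx, S.K_T_T x hx]
  right; module

lemma factorProj_V (hx : x ∈ U) (i : ι) : factorProj l₂ l₃ H T k x (V i x) = V i x := by
  have := sub_ne_zero.2 S.ne
  simp [factorProj, S.T_V x hx, hN.k_apply x hx, S.K_symm x hx (V i x), S.K_T_V x hx]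
  rw [← sub_smul, smul_smul, inv_mul_cancel₀ this, one_smul]

lemma factorProj_Z (hx : x ∈ U) (j : κ) : factorProj l₂ l₃ H T k x (Z j x) = 0 := by
  simp [factorProj, S.T_Z x hx, hN.k_apply x hx, S.K_symm x hx (Z j x), S.K_T_Z x hx]

lemma factorProj_decomp (hx : x ∈ U) (u : E) : u = H x (T x) u • T x +
    factorProj l₂ l₃ H T k x u + factorProj l₃ l₂ H T k x u := by
  have := S.eq_of_frame hx (α := (ContinuousLinearMap.id ℝ E : E →ₗ[ℝ] E))
    (β := (((H x (T x)).smulRight (T x) + factorProj l₂ l₃ H T k x +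
      factorProj l₃ l₂ H T k x : E →L[ℝ] E) : E →ₗ[ℝ] E))
    (by simp [S.factorProj_T hN hx, S.swap.factorProj_T hN hx, S.T_unit x hx])
    (by simp [S.factorProj_V hN hx, S.swap.factorProj_Z hN hx, S.T_V x hx])
    (by simp [S.factorProj_Z hN hx, S.swap.factorProj_V hN hx, S.T_Z x hx])
  exact DFunLike.congr_fun this u

lemma factorProj_idem (hx : x ∈ U) (u : E) : factorProj l₂ l₃ H T k x
    (factorProj l₂ l₃ H T k x u) = factorProj l₂ l₃ H T k x u := by
  have := S.eq_of_frame hx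
    (α := ((factorProj l₂ l₃ H T k x).comp (factorProj l₂ l₃ H T k x) : E →L[ℝ] E).toLinearMap)
    (β := (factorProj l₂ l₃ H T k x).toLinearMap)
    (by simp [S.factorProj_T hN hx]) (by simp [S.factorProj_V hN hx])
    (by simp [S.factorProj_Z hN hx])
  exact DFunLike.congr_fun this u

lemma factorProj_comp (hx : x ∈ U) (u : E) : factorProj l₃ l₂ H T k x
    (factorProj l₂ l₃ H T k x u) = 0 := by
  have := S.eq_of_frame hx
    (α := ((factorProj l₃ l₂ H T k x).comp (factorProj l₂ l₃ H T k x) : E →L[ℝ] E).toLinearMap)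
    (β := 0)
    (by simp [S.factorProj_T hN hx]) (by simp [S.factorProj_V hN hx, S.swap.factorProj_Z hN hx])
    (by simp [S.factorProj_Z hN hx])
  exact DFunLike.congr_fun this u

lemma metric_T_factorProj (hx : x ∈ U) (u : E) : H x (T x) (factorProj l₂ l₃ H T k x u) = 0 := by
  have := S.eq_of_frame hx
    (α := ((H x (T x)).comp (factorProj l₂ l₃ H T k x)).toLinearMap)
    (β := 0)
    (by simp [S.factorProj_T hN hx]) (by simp [S.factorProj_V hN hx, S.T_V x hx])
    (by simp [S.factorProj_Z hN hx])
  exact DFunLike.congr_fun this u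

lemma factorProj_mem_span (hx : x ∈ U) (u : E) :
    factorProj l₂ l₃ H T k x u ∈ Submodule.span ℝ (Set.range fun i ↦ V i x) := by
  have : Submodule.span ℝ ({T x} ∪ Set.range (fun i ↦ V i x) ∪ Set.range (fun j ↦ Z j x)) ≤
      (Submodule.span ℝ (Set.range fun i ↦ V i x)).comap
        (factorProj l₂ l₃ H T k x).toLinearMap := by
    rw [Submodule.span_le]
    rintro v ((rfl | ⟨i, rfl⟩) | ⟨j, rfl⟩)
    · simp [S.factorProj_T hN hx]
    · simpa [S.factorProj_V hN hx] using Submodule.subset_span (Set.mem_range_self i)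
    · simp [S.factorProj_Z hN hx]
  rw [S.span x hx] at this
  exact this (Submodule.mem_top (x := u))

lemma metric_factorProj_factorProj (hx : x ∈ U) (u v : E) :
    H x (factorProj l₂ l₃ H T k x u) (factorProj l₃ l₂ H T k x v) = 0 := by
  have : (factorProj l₃ l₂ H T k x).toLinearMap.range ≤
      LinearMap.ker (H x (factorProj l₂ l₃ H T k x u)).toLinearMap := by
    rintro _ ⟨v, rfl⟩
    refine (Submodule.span_le (s := Set.range fun j ↦ Z j x)).2 ?_
      (S.swap.factorProj_mem_span hN hx v)
    rintro _ ⟨j, rfl⟩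
    change H x _ _ = 0
    rw [S.metric_symm hx]
    refine (Submodule.span_le (s := Set.range fun i ↦ V i x)
      (p := LinearMap.ker (H x (Z j x)).toLinearMap)).2 ?_ (S.factorProj_mem_span hN hx u)
    rintro _ ⟨i, rfl⟩
    change H x _ _ = 0
    rw [S.metric_symm hx, S.V_Z x hx]
  exact this ⟨v, rfl⟩

lemma metric_decomp (hx : x ∈ U) (u v : E) : H x u v = H x (T x) u * H x (T x) v +
    H x (factorProj l₂ l₃ H T k x u) (factorProj l₂ l₃ H T k x v) +
    H x (factorProj l₃ l₂ H T k x u) (factorProj l₃ l₂ H T k x v) := by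
  conv_lhs => rw [S.factorProj_decomp hN hx u, S.factorProj_decomp hN hx v]
  simp only [map_add, map_smul, add_apply, smul_apply, S.T_unit x hx, smul_eq_mul,
    S.metric_T_factorProj hN hx, S.swap.metric_T_factorProj hN hx,
    S.metric_symm hx _ (T x), S.metric_factorProj_factorProj hN hx,
    S.swap.metric_factorProj_factorProj hN hx]
  ring

end Projections

variable [FiniteDimensional ℝ E] [FiniteDimensional ℝ W]

section Potential

variable (S : IsCalabiFrame U lam l₂ l₃ f Γ H K T V Z)
  (hd : Module.finrank ℝ W = Module.finrank ℝ E + 1) (hN : IsHessianPair lam U f Γ H K T N k)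
include S hd hN

/-- The `1`-form dual to `T` is exact. -/
lemma exists_potential (hU : Convex ℝ U) :
    ∃ τ : E → ℝ, ContDiffOn ℝ ∞ τ U ∧ ∀ x ∈ U, HasFDerivAt τ (H x (T x)) x := by
  have hω : ContDiffOn ℝ ∞ (fun x ↦ H x (T x)) U :=
    (S.contDiffOn_metric S.neg.ne hd).clm_apply S.smooth_T
  obtain ⟨τ, hτ⟩ := hU.exists_forall_hasFDerivAt_of_fderiv_symmetric S.isOpen
    (show DifferentiableOn ℝ (fun x ↦ H x (T x)) U from fun x hx ↦
      (hω.differentiableAt_infty S.isOpen hx).differentiableWithinAt) (by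
      -- As T is parallel, only the Levi-Civita symbols Γ - K remain, and these are symmetric; the
      -- form is therefore closed.
      have key : ∀ x ∈ U, ∀ u v, fderiv ℝ (fun x ↦ H x (T x)) x u v =
          H x (T x) (Γ x u v - K x u v) := by
        intro x hx u v
        have h1 := fderiv_clm_apply_apply (hω.differentiableAt_infty S.isOpen hx)
          (differentiableAt_const v) u
        rw [S.fderiv_metric hd hx (S.smooth_T.differentiableAt_infty S.isOpen hx)
          (differentiableAt_const v), ← hN.N_apply x hx, S.N_eq_zero hd hN hx] at h1
        simpa [covDerivAt] using h1.symm
      intro x hx u v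
      rw [key x hx, key x hx, (S.symm S.neg.ne hx u v).1, S.K_symm x hx])
  refine ⟨τ, ?_, hτ⟩
  rw [contDiffOn_infty_iff_fderiv_of_isOpen S.isOpen]
  exact ⟨fun x hx ↦ (hτ x hx).differentiableAt.differentiableWithinAt,
    hω.congr fun x hx ↦ (hτ x hx).fderiv⟩

variable (hτ : ContDiffOn ℝ ∞ τ U)
include hτ

omit hN hd [FiniteDimensional ℝ E] [FiniteDimensional ℝ W] in
lemma contDiffOn_factorMap : ContDiffOn ℝ ∞ (factorMap l₂ l₃ τ f T) U :=
  contDiffOn_const.smul ((contDiffOn_const.mul hτ).neg.exp.smul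
    (((S.smooth.fderiv_infty S.isOpen).clm_apply S.smooth_T).sub
      (contDiffOn_const.smul S.smooth)))

omit hN in
lemma contDiffOn_factorDual : ContDiffOn ℝ ∞ (factorDual l₂ l₃ τ f T) U :=
  have h := S.contDiffOn_conormal hd
  (contDiffOn_const (c := l₃⁻¹)).smul (((contDiffOn_const (c := l₂)).mul hτ).exp.smul
    (((h.fderiv_infty S.isOpen).clm_apply S.smooth_T).add ((contDiffOn_const (c := l₃)).smul h)))

omit hτ
variable (hdτ : ∀ x ∈ U, HasFDerivAt τ (H x (T x)) x)
include hdτ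

/-- With N = 0, the derivative of f_*T - l₃ f is f_*(ku - l₃u) - l₂l₃ h(T,u) f. The factor e^{-l₂τ}
contributes -l₂ h(T,u)(f_*T - l₃ f), which cancels the radial term and leaves f_* of a multiple of
the projection. -/
lemma fderiv_factorMap (hx : x ∈ U) (u : E) : fderiv ℝ (factorMap l₂ l₃ τ f T) x u =
    Real.exp (-(l₂ * τ x)) • fderiv ℝ f x (factorProj l₂ l₃ H T k x u) := by
  have hc := sub_ne_zero.2 S.ne
  have d1 : DifferentiableAt ℝ (fun y ↦ fderiv ℝ f y (T y)) x :=
    ((S.smooth.fderiv_infty S.isOpen).clm_apply S.smooth_T).differentiableAt_infty S.isOpen hx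
  have d2 := S.smooth.differentiableAt_infty S.isOpen hx
  have h1 := ((((hdτ x hx).const_mul l₂).neg.exp).smul
    (d1.hasFDerivAt.sub (d2.hasFDerivAt.const_smul l₃))).const_smul (l₂ - l₃)⁻¹
  have h2 : fderiv ℝ (factorMap l₂ l₃ τ f T) x = _ := h1.fderiv
  rw [h2]
  simp only [smul_apply, add_apply, sub_apply, ContinuousLinearMap.smulRight_apply, neg_apply,
    hN.fderiv_eq x hx, S.N_eq_zero hd hN hx, zero_apply, zero_add, factorProj, map_sub, map_smul,
    smul_sub, smul_smul, smul_eq_mul, ContinuousLinearMap.id_apply, S.metric_symm hx u (T x),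
    ← S.prod, Pi.smul_apply, Pi.neg_apply, Pi.sub_apply]
  module

lemma fderiv_factorDual (hx : x ∈ U) (u : E) : fderiv ℝ (factorDual l₂ l₃ τ f T) x u =
    (-((l₂ - l₃) / l₃) * Real.exp (l₂ * τ x)) •
      fderiv ℝ (conormal f) x (factorProj l₂ l₃ H T k x u) := by
  have hc := sub_ne_zero.2 S.ne
  have hl := S.ne_zero.2
  have hν := S.contDiffOn_conormal hd
  have d1 : DifferentiableAt ℝ (fun y ↦ fderiv ℝ (conormal f) y (T y)) x :=
    ((hν.fderiv_infty S.isOpen).clm_apply S.smooth_T).differentiableAt_infty S.isOpen hx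
  have d2 := hν.differentiableAt_infty S.isOpen hx
  have h1 := ((((hdτ x hx).const_mul l₂).exp).smul
    (d1.hasFDerivAt.add (d2.hasFDerivAt.const_smul l₃))).const_smul l₃⁻¹
  have h2 : fderiv ℝ (factorDual l₂ l₃ τ f T) x = _ := h1.fderiv
  rw [h2]
  have e : (-((l₂ - l₃) / l₃) * Real.exp (l₂ * τ x)) •
      fderiv ℝ (conormal f) x (factorProj l₂ l₃ H T k x u) =
      (-(1 / l₃) * Real.exp (l₂ * τ x)) • fderiv ℝ (conormal f) x
        ((l₂ - l₃) • factorProj l₂ l₃ H T k x u) := by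
    rw [map_smul, smul_smul]
    congr 1
    ring
  have e' : (l₂ - l₃) • factorProj l₂ l₃ H T k x u =
      k x u - l₃ • u - (l₂ * H x (T x) u) • T x := by
    simp [factorProj, smul_inv_smul₀ hc, smul_smul]
  rw [e, e']
  simp only [smul_apply, add_apply, ContinuousLinearMap.smulRight_apply,
    hN.fderiv_conormal_eq x hx, S.N_eq_zero hd hN hx, zero_apply, zero_sub, map_sub,
    map_smul, smul_sub, smul_smul, smul_eq_mul,
    S.metric_symm hx u (T x), ← S.prod, Pi.smul_apply, map_neg, Pi.add_apply]
  module

omit hdτ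

omit hd hN [FiniteDimensional ℝ E] [FiniteDimensional ℝ W] in
-- The difference of f_*T - l₃ f and f_*T - l₂ f is (l₂ - l₃) f.
lemma eq_factorMap_add : f x = Real.exp (l₂ * τ x) • factorMap l₂ l₃ τ f T x +
    Real.exp (l₃ * τ x) • factorMap l₃ l₂ τ f T x := by
  have hc := sub_ne_zero.2 S.ne
  have h : l₃ - l₂ = -(l₂ - l₃) := by ring
  have e1 : ∀ a : ℝ, Real.exp a * Real.exp (-a) = 1 := fun a ↦ by
    rw [← Real.exp_add, add_neg_cancel, Real.exp_zero]
  simp only [factorMap, h, smul_smul, mul_left_comm (Real.exp _), e1]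
  rw [mul_one, mul_one, inv_neg, neg_smul, ← sub_eq_add_neg, ← smul_sub]
  rw [eq_inv_smul_iff₀ hc]
  module

omit hN in
-- Here (ν_*T + l₃ν)(f_*T - l₃f) = λ - l₃² = l₃(l₂ - l₃), which accounts for the normalising
-- constants in `factorMap` and `factorDual`.
lemma factorDual_factorMap (hx : x ∈ U) :
    factorDual l₂ l₃ τ f T x (factorMap l₂ l₃ τ f T x) = 1 := by
  have hc := sub_ne_zero.2 S.ne
  have hl := S.ne_zero.2
  simp only [factorDual, factorMap, smul_apply, add_apply, map_smul, map_sub, smul_eq_mul,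
    S.fderiv_conormal_fderiv hd hx, S.fderiv_conormal_self hd hx, S.conormal_self hd hx,
    S.conormal_fderiv hd hx, S.T_unit x hx, Real.exp_neg]
  have := (Real.exp_pos (l₂ * τ x)).ne'
  rw [← S.prod]
  field_simp
  ring

omit hN in
-- Here (ν_*T + l₃ν)(f_*T - l₂f) = λ - l₂l₃ = 0. This relation is what later puts the two factors
-- into complementary subspaces.
lemma factorDual_factorMap_swap (hx : x ∈ U) :
    factorDual l₂ l₃ τ f T x (factorMap l₃ l₂ τ f T x) = 0 := by
  simp only [factorDual, factorMap, smul_apply, add_apply, map_smul, map_sub, smul_eq_mul,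
    S.fderiv_conormal_fderiv hd hx, S.fderiv_conormal_self hd hx, S.conormal_self hd hx,
    S.conormal_fderiv hd hx, S.T_unit x hx, ← S.prod]
  ring

include hdτ

lemma factorDual_fderiv_factorMap (hx : x ∈ U) (u : E) :
    factorDual l₂ l₃ τ f T x (fderiv ℝ (factorMap l₂ l₃ τ f T) x u) = 0 := by
  rw [S.fderiv_factorMap hd hN hdτ hx]
  simp [factorDual, S.fderiv_conormal_fderiv hd hx, S.conormal_fderiv hd hx,
    S.metric_T_factorProj hN hx]

/-- The exponentials cancel, so the centroaffine metric of the factor is a constant multiple of the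
restriction of h to its distribution; the multiple is positive by `coeff_pos`. -/
lemma fderiv_factorDual_fderiv_factorMap (hx : x ∈ U) (u v : E) :
    fderiv ℝ (factorDual l₂ l₃ τ f T) x u (fderiv ℝ (factorMap l₂ l₃ τ f T) x v) =
      -((l₂ - l₃) * l₂ *
        H x (factorProj l₂ l₃ H T k x u) (factorProj l₂ l₃ H T k x v)) := by
  have hl := S.ne_zero.2
  rw [S.fderiv_factorMap hd hN hdτ hx, S.fderiv_factorDual hd hN hdτ hx]
  simp only [smul_apply, map_smul, S.fderiv_conormal_fderiv hd hx, smul_eq_mul, Real.exp_neg,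
    ← S.prod]
  have := (Real.exp_pos (l₂ * τ x)).ne'
  field_simp

end Potential

end IsCalabiFrame

end Factors

/-! ### Box-shaped charts from the inverse function theorem. -/

section Straightening

lemma Convex.eq_of_fderiv_apply_eq_zero {E G : Type*} [NormedAddCommGroup E] [NormedSpace ℝ E]
    [NormedAddCommGroup G] [NormedSpace ℝ G] {s : Set E} (hs : Convex ℝ s) {R : E → G}
    (hR : ∀ z ∈ s, DifferentiableAt ℝ R z) {y y' : E} (hy : y ∈ s) (hy' : y' ∈ s)
    (h : ∀ z ∈ s, fderiv ℝ R z (y' - y) = 0) : R y' = R y := by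
  have hmem : ∀ t ∈ Set.Icc (0 : ℝ) 1, AffineMap.lineMap y y' t ∈ s := fun t ht ↦
    hs.lineMap_mem hy hy' ht
  have hd : ∀ t ∈ Set.Icc (0 : ℝ) 1,
      HasDerivAt (fun t : ℝ ↦ R (AffineMap.lineMap y y' t)) 0 t := by
    intro t ht
    have h1 := (hR _ (hmem t ht)).hasFDerivAt.comp_hasDerivAt t
      (AffineMap.hasDerivAt_lineMap (a := y) (b := y') (x := t))
    rwa [h _ (hmem t ht)] at h1
  have := constant_of_has_deriv_right_zero
    (fun t ht ↦ (hd t ht).continuousAt.continuousWithinAt)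
    (fun t ht ↦ (hd t ⟨ht.1, ht.2.le⟩).hasDerivWithinAt) 1 (by simp)
  simpa using this

/-- A version of the inverse function theorem: the inverse is defined on a box, whose last two
sides are parametrized by the whole space. -/
lemma exists_box_chart {E : Type*} [NormedAddCommGroup E] [NormedSpace ℝ E]
    [FiniteDimensional ℝ E] {m l : ℕ} (hdim : Module.finrank ℝ E = 1 + m + l)
    {Φ : E → ℝ × Euc m × Euc l} {U : Set E} (hU : IsOpen U) (hΦ : ContDiffOn ℝ ∞ Φ U)
    {x₀ : E} (hx₀ : x₀ ∈ U) (hinj : Function.Injective (fderiv ℝ Φ x₀)) :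
    ∃ (a b : ℝ) (e : OpenPartialHomeomorph (ℝ × Euc m × Euc l) E) (β : Euc m → Euc m)
      (γ : Euc l → Euc l), e.source = Set.Ioo a b ×ˢ Set.univ ∧ e.target ⊆ U ∧ x₀ ∈ e.target ∧
      ContDiffOn ℝ ∞ e e.source ∧ ContDiffOn ℝ ∞ e.symm e.target ∧
      ContDiff ℝ ∞ β ∧ ContDiff ℝ ∞ γ ∧
      (∀ y ∈ e.source, Φ (e y) = (y.1, β y.2.1, γ y.2.2)) ∧
      ∀ x ∈ e.target, Function.Injective (fderiv ℝ Φ x) := by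
  have : CompleteSpace E := FiniteDimensional.complete ℝ E
  have hequiv : ∀ x, Function.Injective (fderiv ℝ Φ x) →
      fderiv ℝ Φ x ∈ Set.range (ContinuousLinearEquiv.toContinuousLinearMap :
        (E ≃L[ℝ] ℝ × Euc m × Euc l) → _) := fun x hx ↦
    ⟨(LinearMap.linearEquivOfInjective (fderiv ℝ Φ x).toLinearMap hx
      (by simp [hdim, add_assoc])).toContinuousLinearEquiv, by ext1 v; simp⟩
  obtain ⟨Φ', hΦ'⟩ := hequiv x₀ hinj
  have hx₀Φ : HasFDerivAt Φ (Φ' : E →L[ℝ] ℝ × Euc m × Euc l) x₀ := by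
    rw [hΦ']
    exact (hΦ.differentiableAt_infty hU hx₀).hasFDerivAt
  let R := (hΦ.contDiffAt (hU.mem_nhds hx₀)).toOpenPartialHomeomorph Φ hx₀Φ (by simp)
  have hR : ⇑R = Φ := ContDiffAt.toOpenPartialHomeomorph_coe _ _ _
  have hx₀R : x₀ ∈ R.source := ContDiffAt.mem_toOpenPartialHomeomorph_source _ _ _
  -- Restricting to the open set where the derivative is invertible makes the local inverse smooth
  -- throughout, not merely at the image of `x₀`.
  let O := U ∩ fderiv ℝ Φ ⁻¹' Set.range (ContinuousLinearEquiv.toContinuousLinearMap :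
        (E ≃L[ℝ] ℝ × Euc m × Euc l) → _)
  have hO : IsOpen O := (hΦ.continuousOn_fderiv_of_isOpen hU (by simp)).isOpen_inter_preimage hU
    (ContinuousLinearEquiv.isOpen (𝕜 := ℝ))
  let R' := R.restrOpen O hO
  have hR'src : R'.source = R.source ∩ O := rfl
  have hx₀' : x₀ ∈ R'.source := ⟨hx₀R, hx₀, hequiv x₀ hinj⟩
  have hR' : ⇑R' = Φ := hR
  have htgt : Φ x₀ ∈ R'.target := by rw [← hR']; exact R'.map_source hx₀'
  obtain ⟨ε, hε, hball⟩ := Metric.isOpen_iff.1 R'.open_target _ htgt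
  -- The product carries the sup norm, so a ball is already a box.
  rw [← ball_prod_same, ← ball_prod_same, Real.ball_eq_Ioo] at hball
  -- The interval is kept, while the two balls are stretched to whole Euclidean spaces; this
  -- reparametrisation produces `β` and `γ`.
  let B : OpenPartialHomeomorph (ℝ × Euc m × Euc l) (ℝ × Euc m × Euc l) :=
    (OpenPartialHomeomorph.ofSet (Set.Ioo ((Φ x₀).1 - ε) ((Φ x₀).1 + ε)) isOpen_Ioo).prod
    ((OpenPartialHomeomorph.univBall (Φ x₀).2.1 ε).prod
      (OpenPartialHomeomorph.univBall (Φ x₀).2.2 ε))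
  have hBs : B.source = Set.Ioo ((Φ x₀).1 - ε) ((Φ x₀).1 + ε) ×ˢ Set.univ := by
    simp [B]
  have hBt : B.target = Set.Ioo ((Φ x₀).1 - ε) ((Φ x₀).1 + ε) ×ˢ
      (Metric.ball (Φ x₀).2.1 ε ×ˢ Metric.ball (Φ x₀).2.2 ε) := by
    simp [B, OpenPartialHomeomorph.univBall_target _ hε]
  have hBt' : B.target ⊆ R'.target := by rw [hBt]; exact hball
  have hes : (B.trans R'.symm).source = B.source := by
    rw [OpenPartialHomeomorph.trans_source]
    exact Set.inter_eq_left.2 fun y hy ↦ hBt' (B.map_source hy)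
  have het : (B.trans R'.symm).target ⊆ R'.source := by
    rw [OpenPartialHomeomorph.trans_target]
    exact Set.inter_subset_left
  have hsymm : ∀ z ∈ R'.target, ContDiffAt ℝ ∞ R'.symm z := by
    intro z hz
    have h1 := R'.map_target hz
    rw [hR'src] at h1
    obtain ⟨L, hL⟩ := h1.2.2
    refine R'.contDiffAt_symm (f₀' := L) hz ?_ ?_
    · rw [hL, hR']
      exact (hΦ.differentiableAt_infty hU h1.2.1).hasFDerivAt
    · rw [hR']
      exact hΦ.contDiffAt (hU.mem_nhds h1.2.1)
  refine ⟨(Φ x₀).1 - ε, (Φ x₀).1 + ε, B.trans R'.symm,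
    OpenPartialHomeomorph.univBall (Φ x₀).2.1 ε, OpenPartialHomeomorph.univBall (Φ x₀).2.2 ε,
    hes.trans hBs, fun x hx ↦ (het hx).2.1, ?_, ?_, ?_,
    OpenPartialHomeomorph.contDiff_univBall, OpenPartialHomeomorph.contDiff_univBall, ?_, ?_⟩
  · rw [OpenPartialHomeomorph.trans_target]
    refine ⟨hx₀', ?_⟩
    rw [hBt]
    simp [hR', hε]
  · rw [hes]
    intro y hy
    have hB : ContDiffAt ℝ ∞ B y := by
      have : ContDiff ℝ ∞ B := contDiff_fst.prodMk
        ((OpenPartialHomeomorph.contDiff_univBall.comp (contDiff_fst.comp contDiff_snd)).prodMk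
        (OpenPartialHomeomorph.contDiff_univBall.comp (contDiff_snd.comp contDiff_snd)))
      exact this.contDiffAt
    exact ((hsymm _ (hBt' (B.map_source hy))).comp y hB).contDiffWithinAt
  · have hB : ContDiffOn ℝ ∞ B.symm B.target := by
      rw [hBt]
      refine contDiff_fst.contDiffOn.prodMk (ContDiffOn.prodMk ?_ ?_)
      · exact OpenPartialHomeomorph.contDiffOn_univBall_symm.comp
          (contDiff_fst.comp contDiff_snd).contDiffOn fun y hy ↦ hy.2.1
      · exact OpenPartialHomeomorph.contDiffOn_univBall_symm.comp
          (contDiff_snd.comp contDiff_snd).contDiffOn fun y hy ↦ hy.2.2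
    have hsub : (B.trans R'.symm).target ⊆ R'.source ∩ Φ ⁻¹' B.target := by
      rw [OpenPartialHomeomorph.trans_target]
      intro x hx
      refine ⟨hx.1, ?_⟩
      have := hx.2
      simpa [hR'] using this
    have h1 : ContDiffOn ℝ ∞ (fun x ↦ B.symm (Φ x)) (B.trans R'.symm).target :=
      hB.comp (hΦ.mono fun x hx ↦ (het hx).2.1) fun x hx ↦ (hsub hx).2
    refine h1.congr fun x hx ↦ ?_
    simp [hR']
  · intro y hy
    rw [hes] at hy
    have : Φ (R'.symm (B y)) = B y := by
      rw [← hR']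
      exact R'.right_inv (hBt' (B.map_source hy))
    simpa [B] using this
  · intro x hx
    obtain ⟨L, hL⟩ := (het hx).2.2
    rw [← hL]
    exact L.injective

end Straightening

/-! ### Product coordinates adapted to the factor maps. -/

section ProductChart

lemma fderiv_comp_chart {P E G : Type*} [NormedAddCommGroup P] [NormedSpace ℝ P]
    [NormedAddCommGroup E] [NormedSpace ℝ E] [NormedAddCommGroup G] [NormedSpace ℝ G]
    {e : OpenPartialHomeomorph P E} {U : Set E} (hU : IsOpen U)
    (het : e.target ⊆ U) (he : ContDiffOn ℝ ∞ e e.source) {R : E → G} (hR : ContDiffOn ℝ ∞ R U)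
    {y : P} (hy : y ∈ e.source) (w : P) :
    fderiv ℝ (fun y ↦ R (e y)) y w = fderiv ℝ R (e y) (fderiv ℝ e y w) := by
  have h1 := (hR.differentiableAt_infty hU (het (e.map_source hy))).hasFDerivAt.comp y
    (he.differentiableAt_infty e.open_source hy).hasFDerivAt
  have : fderiv ℝ (fun y ↦ R (e y)) y = _ := h1.fderiv
  rw [this]
  rfl

/-- A function whose derivative vanishes on the kernel of the projection `q` factors through
`q` in the chart `e`. -/
lemma exists_descend {P E G Y : Type*} [NormedAddCommGroup P] [NormedSpace ℝ P]
    [NormedAddCommGroup E] [NormedSpace ℝ E] [NormedAddCommGroup G] [NormedSpace ℝ G]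
    [NormedAddCommGroup Y] [NormedSpace ℝ Y] {e : OpenPartialHomeomorph P E} {U : Set E}
    (hU : IsOpen U) (hconv : Convex ℝ e.source)
    (het : e.target ⊆ U) (he : ContDiffOn ℝ ∞ e e.source) {R : E → G} (hR : ContDiffOn ℝ ∞ R U)
    (q : P →L[ℝ] Y) {j : Y → P} (hj : ContDiff ℝ ∞ j) (hjs : ∀ u, j u ∈ e.source)
    (hqj : ∀ u, q (j u) = u)
    (h0 : ∀ y ∈ e.source, ∀ w, q w = 0 → fderiv ℝ R (e y) (fderiv ℝ e y w) = 0) :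
    ∃ r : Y → G, ContDiff ℝ ∞ r ∧ (∀ y ∈ e.source, R (e y) = r (q y)) ∧
      ∀ y ∈ e.source, ∀ w, fderiv ℝ R (e y) (fderiv ℝ e y w) = fderiv ℝ r (q y) (q w) := by
  have hRe : ContDiffOn ℝ ∞ (fun y ↦ R (e y)) e.source :=
    hR.comp he fun y hy ↦ het (e.map_source hy)
  have hr : ContDiff ℝ ∞ fun u ↦ R (e (j u)) :=
    contDiffOn_univ.1 (hRe.comp hj.contDiffOn fun u _ ↦ hjs u)
  have heq : ∀ y ∈ e.source, R (e y) = R (e (j (q y))) := by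
    intro y hy
    -- The points `y` and `j (q y)` differ by a vector in the kernel of `q`, so `R ∘ e` is constant
    -- on the segment joining them.
    refine hconv.eq_of_fderiv_apply_eq_zero (R := fun y ↦ R (e y))
      (fun z hz ↦ hRe.differentiableAt_infty e.open_source hz) (hjs _) hy fun z hz ↦ ?_
    rw [fderiv_comp_chart hU het he hR hz]
    exact h0 z hz _ (by simp [hqj])
  refine ⟨fun u ↦ R (e (j u)), hr, heq, fun y hy w ↦ ?_⟩
  rw [← fderiv_comp_chart hU het he hR hy, e.open_source.fderiv_eq_of_eqOn hy heq]
  have h1 := ((hr.differentiable (by simp)) (q y)).hasFDerivAt.comp y q.hasFDerivAt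
  have : fderiv ℝ (fun y ↦ R (e (j (q y)))) y = _ := h1.fderiv
  rw [this]
  rfl

/-- Serves to choose linear functions on the ambient space that restrict to coordinates on the image
of one distribution at the base point. -/
lemma exists_clm_injOn {W : Type*} [NormedAddCommGroup W] [NormedSpace ℝ W]
    [FiniteDimensional ℝ W] (p : Submodule ℝ W) {m : ℕ} (hp : Module.finrank ℝ p = m) :
    ∃ A : W →L[ℝ] Euc m, ∀ w ∈ p, A w = 0 → w = 0 := by
  let L : p ≃ₗ[ℝ] Euc m := LinearEquiv.ofFinrankEq _ _ (by simp [hp])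
  obtain ⟨A, hA⟩ := LinearMap.exists_extend L.toLinearMap
  refine ⟨LinearMap.toContinuousLinearMap A, fun w hw h ↦ ?_⟩
  have h1 : L ⟨w, hw⟩ = 0 := by
    have := DFunLike.congr_fun hA ⟨w, hw⟩
    simpa [this] using h.symm.trans this |>.symm
  simpa using congrArg Subtype.val (L.map_eq_zero_iff.1 h1)

/-- `g` is a centroaffine immersion of dimension `m`, `p` its conormal map, and the centroaffine
metric is positive definite. -/
structure IsConormalPair {W : Type*} [NormedAddCommGroup W] [NormedSpace ℝ W] {m : ℕ}
    (g : Euc m → W) (p : Euc m → W →L[ℝ] ℝ) : Prop where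
  smooth : ContDiff ℝ ∞ g
  smooth_dual : ContDiff ℝ ∞ p
  apply_self : ∀ u, p u (g u) = 1
  apply_fderiv : ∀ u a, p u (fderiv ℝ g u a) = 0
  pos : ∀ u a, a ≠ 0 → 0 < -(fderiv ℝ p u a (fderiv ℝ g u a))

namespace IsCalabiFrame

variable {E W : Type*} [NormedAddCommGroup E] [NormedSpace ℝ E]
  [NormedAddCommGroup W] [NormedSpace ℝ W]
  {U : Set E} {lam l₂ l₃ : ℝ} {f : E → W} {Γ : E → E → E → E}
  {H : E → E →L[ℝ] E →L[ℝ] ℝ} {K : E → E →L[ℝ] E →L[ℝ] E} {T : E → E} {x : E}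
  [FiniteDimensional ℝ E] [FiniteDimensional ℝ W]

/-- One of the two factors of the product structure, in a chart `e` adapted to it. -/
lemma exists_factor {ι κ P : Type*} {V : ι → E → E} {Z : κ → E → E}
    [NormedAddCommGroup P] [NormedSpace ℝ P]
    {k N : E → E →L[ℝ] E} {τ : E → ℝ}
    (S : IsCalabiFrame U lam l₂ l₃ f Γ H K T V Z)
    (hd : Module.finrank ℝ W = Module.finrank ℝ E + 1) (hN : IsHessianPair lam U f Γ H K T N k)
    (hτ : ContDiffOn ℝ ∞ τ U) (hdτ : ∀ x ∈ U, HasFDerivAt τ (H x (T x)) x)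
    {e : OpenPartialHomeomorph P E} (hconv : Convex ℝ e.source) (het : e.target ⊆ U)
    (he : ContDiffOn ℝ ∞ e e.source) {m : ℕ} (q : P →L[ℝ] Euc m) {j : Euc m → P}
    (hj : ContDiff ℝ ∞ j) (hjs : ∀ u, j u ∈ e.source) (hqj : ∀ u, q (j u) = u)
    (h0 : ∀ y ∈ e.source, ∀ w, q w = 0 → factorProj l₂ l₃ H T k (e y) (fderiv ℝ e y w) = 0)
    (i : Euc m → P) (hqi : ∀ a, q (i a) = a)
    (h1 : ∀ y ∈ e.source, ∀ a, a ≠ 0 →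
      factorProj l₂ l₃ H T k (e y) (fderiv ℝ e y (i a)) ≠ 0) :
    ∃ (g : Euc m → W) (p : Euc m → W →L[ℝ] ℝ), IsConormalPair g p ∧
      (∀ y ∈ e.source, factorMap l₂ l₃ τ f T (e y) = g (q y)) ∧
      (∀ y ∈ e.source, factorDual l₂ l₃ τ f T (e y) = p (q y)) ∧
      ∀ y ∈ e.source, ∀ w w', (l₂ - l₃) * l₂ *
        H (e y) (factorProj l₂ l₃ H T k (e y) (fderiv ℝ e y w))
          (factorProj l₂ l₃ H T k (e y) (fderiv ℝ e y w')) =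
        -(fderiv ℝ p (q y) (q w) (fderiv ℝ g (q y) (q w'))) := by
  have hU := S.isOpen
  have hmem : ∀ y ∈ e.source, e y ∈ U := fun y hy ↦ het (e.map_source hy)
  obtain ⟨g, hg, hge, hgd⟩ := exists_descend hU hconv het he (S.contDiffOn_factorMap hτ)
    q hj hjs hqj fun y hy w hw ↦ by
      rw [S.fderiv_factorMap hd hN hdτ (hmem y hy), h0 y hy w hw, map_zero, smul_zero]
  obtain ⟨p, hp, hpe, hpd⟩ := exists_descend hU hconv het he (S.contDiffOn_factorDual hd hτ)
    q hj hjs hqj fun y hy w hw ↦ by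
      rw [S.fderiv_factorDual hd hN hdτ (hmem y hy), h0 y hy w hw, map_zero, smul_zero]
  have hform : ∀ y ∈ e.source, ∀ w w', (l₂ - l₃) * l₂ *
        H (e y) (factorProj l₂ l₃ H T k (e y) (fderiv ℝ e y w))
          (factorProj l₂ l₃ H T k (e y) (fderiv ℝ e y w')) =
        -(fderiv ℝ p (q y) (q w) (fderiv ℝ g (q y) (q w'))) := by
    intro y hy w w'
    rw [← hgd y hy, ← hpd y hy, S.fderiv_factorDual_fderiv_factorMap hd hN hdτ (hmem y hy),
      neg_neg]
  refine ⟨g, p, ⟨hg, hp, fun u ↦ ?_, fun u a ↦ ?_, fun u a ha ↦ ?_⟩, hge, hpe, hform⟩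
  · have := S.factorDual_factorMap (τ := τ) hd (hmem _ (hjs u))
    rwa [hge _ (hjs u), hpe _ (hjs u), hqj] at this
  · have := S.factorDual_fderiv_factorMap hd hN hdτ (hmem _ (hjs u)) (fderiv ℝ e (j u) (i a))
    rwa [hgd _ (hjs u), hpe _ (hjs u), hqj, hqi] at this
  · have := hform _ (hjs u) (i a) (i a)
    rw [hqj, hqi] at this
    rw [← this]
    exact mul_pos S.coeff_pos (S.posDef _ (hmem _ (hjs u)) _ (h1 _ (hjs u) a ha))

theorem exists_product {m l : ℕ} {V : Fin m → E → E} {Z : Fin l → E → E}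
    (S : IsCalabiFrame U lam l₂ l₃ f Γ H K T V Z) (hconv : Convex ℝ U)
    (hd : Module.finrank ℝ W = Module.finrank ℝ E + 1) (hE : Module.finrank ℝ E = 1 + m + l)
    {x₀ : E} (hx₀ : x₀ ∈ U)
    (hV : Module.finrank ℝ (Submodule.span ℝ (Set.range fun i ↦ V i x₀)) = m)
    (hZ : Module.finrank ℝ (Submodule.span ℝ (Set.range fun i ↦ Z i x₀)) = l)
    {s : ℝ} (hs : s ≠ 0) :
    ∃ (a b : ℝ) (e : OpenPartialHomeomorph (ℝ × Euc m × Euc l) E)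
      (g₂ : Euc m → W) (p₂ : Euc m → W →L[ℝ] ℝ) (g₃ : Euc l → W) (p₃ : Euc l → W →L[ℝ] ℝ),
      e.source = Set.Ioo a b ×ˢ Set.univ ∧ e.target ⊆ U ∧ x₀ ∈ e.target ∧
      ContDiffOn ℝ ∞ e e.source ∧ ContDiffOn ℝ ∞ e.symm e.target ∧
      IsConormalPair g₂ p₂ ∧ IsConormalPair g₃ p₃ ∧
      (∀ u v, p₂ u (g₃ v) = 0) ∧ (∀ u v, p₃ v (g₂ u) = 0) ∧
      (∀ y ∈ e.source, f (e y) = Real.exp (l₂ * (s * y.1)) • g₂ y.2.1 +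
        Real.exp (l₃ * (s * y.1)) • g₃ y.2.2) ∧
      ∀ y ∈ e.source, ∀ w w', H (e y) (fderiv ℝ e y w) (fderiv ℝ e y w') =
        s ^ 2 * (w.1 * w'.1) +
        ((l₂ - l₃) * l₂)⁻¹ * -(fderiv ℝ p₂ y.2.1 w.2.1 (fderiv ℝ g₂ y.2.1 w'.2.1)) +
        ((l₃ - l₂) * l₃)⁻¹ * -(fderiv ℝ p₃ y.2.2 w.2.2 (fderiv ℝ g₃ y.2.2 w'.2.2)) := by
  have hU := S.isOpen
  obtain ⟨N, k, hN⟩ := S.exists_hessianPair hd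
  obtain ⟨τ, hτ, hdτ⟩ := S.exists_potential hd hN hconv
  have hfinj : ∀ x ∈ U, Function.Injective (fderiv ℝ f x).toLinearMap := fun x hx ↦ by
    rw [← LinearMap.ker_eq_bot, LinearMap.ker_eq_bot']
    intro u hu
    exact (S.transversal x hx u 0 (by simpa using hu)).1
  have hrank : ∀ p : Submodule ℝ E, Module.finrank ℝ (p.map (fderiv ℝ f x₀).toLinearMap) =
      Module.finrank ℝ p := fun p ↦
    (Submodule.equivMapOfInjective _ (hfinj x₀ hx₀) p).finrank_eq.symm
  obtain ⟨A₂, hA₂⟩ := exists_clm_injOn _ ((hrank _).trans hV)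
  obtain ⟨A₃, hA₃⟩ := exists_clm_injOn _ ((hrank _).trans hZ)
  have hG₂ := S.contDiffOn_factorMap hτ
  have hG₃ := S.swap.contDiffOn_factorMap hτ
  set G₂ := factorMap l₂ l₃ τ f T
  set G₃ := factorMap l₃ l₂ τ f T
  -- The three components differentiate only along T, 𝒟₂ and 𝒟₃ respectively, so injectivity of the
  -- derivative at `x₀` can be checked on each summand. The factor `s⁻¹` rescales the time variable.
  let Φ : E → ℝ × Euc m × Euc l := fun x ↦ (s⁻¹ * τ x, A₂ (G₂ x), A₃ (G₃ x))
  have hΦ : ContDiffOn ℝ ∞ Φ U := (contDiffOn_const.mul hτ).prodMk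
    ((A₂.contDiff.comp_contDiffOn hG₂).prodMk (A₃.contDiff.comp_contDiffOn hG₃))
  have hdΦ : ∀ x ∈ U, ∀ u, fderiv ℝ Φ x u = (s⁻¹ * H x (T x) u, A₂ (fderiv ℝ G₂ x u),
      A₃ (fderiv ℝ G₃ x u)) := by
    intro x hx u
    have h1 := ((hdτ x hx).const_mul s⁻¹).prodMk
      ((A₂.hasFDerivAt.comp x (hG₂.differentiableAt_infty hU hx).hasFDerivAt).prodMk
      (A₃.hasFDerivAt.comp x (hG₃.differentiableAt_infty hU hx).hasFDerivAt))
    have h2 : fderiv ℝ Φ x = _ := h1.fderiv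
    rw [h2]
    simp
  have hzero : ∀ x ∈ U, ∀ u, H x (T x) u = 0 → factorProj l₂ l₃ H T k x u = 0 →
      factorProj l₃ l₂ H T k x u = 0 → u = 0 := by
    intro x hx u h1 h2 h3
    rw [S.factorProj_decomp hN hx u, h1, h2, h3]
    simp
  have hinj : Function.Injective (fderiv ℝ Φ x₀) := by
    refine (injective_iff_map_eq_zero _).2 fun u hu ↦ ?_
    rw [hdΦ x₀ hx₀, Prod.mk_eq_zero, Prod.mk_eq_zero, S.fderiv_factorMap hd hN hdτ hx₀,
      S.swap.fderiv_factorMap hd hN hdτ hx₀, map_smul, map_smul] at hu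
    have hinj₀ : ∀ v, fderiv ℝ f x₀ v = 0 → v = 0 := fun v hv ↦
      (S.transversal x₀ hx₀ v 0 (by simpa using hv)).1
    refine hzero x₀ hx₀ u ?_ ?_ ?_
    · exact (mul_eq_zero.1 hu.1).resolve_left (inv_ne_zero hs)
    · exact hinj₀ _ (hA₂ _ ⟨_, S.factorProj_mem_span hN hx₀ u, rfl⟩
        ((smul_eq_zero.1 hu.2.1).resolve_left (Real.exp_pos _).ne'))
    · exact hinj₀ _ (hA₃ _ ⟨_, S.swap.factorProj_mem_span hN hx₀ u, rfl⟩
        ((smul_eq_zero.1 hu.2.2).resolve_left (Real.exp_pos _).ne'))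
  obtain ⟨a, b, e, β, γ, hsrc, het, hx₀e, he, hes, hβ, hγ, heΦ, hinjΦ⟩ :=
    exists_box_chart hE hU hΦ hx₀ hinj
  have hmem : ∀ y ∈ e.source, e y ∈ U := fun y hy ↦ het (e.map_source hy)
  have hde : ∀ y ∈ e.source, ∀ w, (s⁻¹ * H (e y) (T (e y)) (fderiv ℝ e y w),
      A₂ (fderiv ℝ G₂ (e y) (fderiv ℝ e y w)), A₃ (fderiv ℝ G₃ (e y) (fderiv ℝ e y w))) =
      (w.1, fderiv ℝ β y.2.1 w.2.1, fderiv ℝ γ y.2.2 w.2.2) := by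
    intro y hy w
    rw [← hdΦ _ (hmem y hy), ← fderiv_comp_chart hU het he hΦ hy,
      e.open_source.fderiv_eq_of_eqOn hy heΦ]
    have h1 := (hasFDerivAt_fst (𝕜 := ℝ) (p := y)).prodMk
      ((((hβ.differentiable (by simp)) y.2.1).hasFDerivAt.comp y
        (hasFDerivAt_fst.comp y hasFDerivAt_snd)).prodMk
      (((hγ.differentiable (by simp)) y.2.2).hasFDerivAt.comp y
        (hasFDerivAt_snd.comp y hasFDerivAt_snd)))
    have h2 : fderiv ℝ (fun y : ℝ × Euc m × Euc l ↦ (y.1, β y.2.1, γ y.2.2)) y = _ := h1.fderiv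
    rw [h2]
    simp
  -- `A₂` was chosen only at `x₀`. At other points of the chart, the 𝒟₂-part of such a `u` is killed
  -- by the whole derivative of `Φ`, which is still injective there.
  have hker₂ : ∀ x ∈ e.target, ∀ u, A₂ (fderiv ℝ G₂ x u) = 0 →
      factorProj l₂ l₃ H T k x u = 0 := by
    intro x hx u hu
    refine (injective_iff_map_eq_zero _).1 (hinjΦ x hx) _ ?_
    have hx' := het hx
    rw [S.fderiv_factorMap hd hN hdτ hx'] at hu
    rw [hdΦ x hx', S.fderiv_factorMap hd hN hdτ hx', S.swap.fderiv_factorMap hd hN hdτ hx',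
      S.metric_T_factorProj hN hx', S.factorProj_idem hN hx', S.factorProj_comp hN hx', hu]
    simp
  have hker₃ : ∀ x ∈ e.target, ∀ u, A₃ (fderiv ℝ G₃ x u) = 0 →
      factorProj l₃ l₂ H T k x u = 0 := by
    intro x hx u hu
    refine (injective_iff_map_eq_zero _).1 (hinjΦ x hx) _ ?_
    have hx' := het hx
    rw [S.swap.fderiv_factorMap hd hN hdτ hx'] at hu
    rw [hdΦ x hx', S.fderiv_factorMap hd hN hdτ hx', S.swap.fderiv_factorMap hd hN hdτ hx',
      S.swap.metric_T_factorProj hN hx', S.swap.factorProj_idem hN hx',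
      S.swap.factorProj_comp hN hx', hu]
    simp
  have hT : ∀ y ∈ e.source, ∀ w, H (e y) (T (e y)) (fderiv ℝ e y w) = s * w.1 := by
    intro y hy w
    have := congrArg Prod.fst (hde y hy w)
    simp only at this
    rw [← this, mul_inv_cancel_left₀ hs]
  have hw₂ : ∀ y ∈ e.source, ∀ w, w.2.1 = 0 →
      factorProj l₂ l₃ H T k (e y) (fderiv ℝ e y w) = 0 := by
    intro y hy w hw
    refine hker₂ _ (e.map_source hy) _ ?_
    have := congrArg (fun z ↦ z.2.1) (hde y hy w)
    simp only at this
    rw [this, hw, map_zero]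
  have hw₃ : ∀ y ∈ e.source, ∀ w, w.2.2 = 0 →
      factorProj l₃ l₂ H T k (e y) (fderiv ℝ e y w) = 0 := by
    intro y hy w hw
    refine hker₃ _ (e.map_source hy) _ ?_
    have := congrArg (fun z ↦ z.2.2) (hde y hy w)
    simp only at this
    rw [this, hw, map_zero]
  -- By the chain rule for `e.symm ∘ e = id`.
  have hinje : ∀ y ∈ e.source, ∀ w, fderiv ℝ e y w = 0 → w = 0 := by
    intro y hy w hw
    have h1 := fderiv_comp_chart e.open_target le_rfl he hes hy w
    rw [hw, map_zero, e.open_source.fderiv_eq_of_eqOn hy (g := fun y ↦ y)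
      (fun y hy ↦ e.left_inv hy)] at h1
    simpa using h1
  set t₀ := (e.symm x₀).1
  have ht₀ : t₀ ∈ Set.Ioo a b := by
    have := e.map_target hx₀e
    rw [hsrc] at this
    exact this.1
  have hsconv : Convex ℝ e.source := by
    rw [hsrc]
    exact (convex_Ioo a b).prod convex_univ
  let q₂ : ℝ × Euc m × Euc l →L[ℝ] Euc m :=
    (ContinuousLinearMap.fst ℝ _ _).comp (ContinuousLinearMap.snd ℝ _ _)
  let q₃ : ℝ × Euc m × Euc l →L[ℝ] Euc l :=
    (ContinuousLinearMap.snd ℝ _ _).comp (ContinuousLinearMap.snd ℝ _ _)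
  obtain ⟨g₂, p₂, hgp₂, hg₂, hp₂, hform₂⟩ := S.exists_factor hd hN hτ hdτ hsconv het he q₂
    (j := fun u ↦ (t₀, u, 0)) (contDiff_const.prodMk (contDiff_id.prodMk contDiff_const))
    (fun u ↦ by rw [hsrc]; exact ⟨ht₀, trivial⟩) (fun u ↦ rfl) hw₂ (fun a ↦ (0, a, 0))
    (fun u ↦ rfl) (fun y hy a ha h ↦ ha (by
      have := hinje y hy (0, a, 0) (hzero _ (hmem y hy) _ (by simp [hT y hy]) h
        (hw₃ y hy _ rfl))
      simpa using this))
  obtain ⟨g₃, p₃, hgp₃, hg₃, hp₃, hform₃⟩ := S.swap.exists_factor hd hN hτ hdτ hsconv het he q₃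
    (j := fun u ↦ (t₀, 0, u)) (contDiff_const.prodMk (contDiff_const.prodMk contDiff_id))
    (fun u ↦ by rw [hsrc]; exact ⟨ht₀, trivial⟩) (fun u ↦ rfl) hw₃ (fun a ↦ (0, 0, a))
    (fun u ↦ rfl) (fun y hy a ha h ↦ ha (by
      have := hinje y hy (0, 0, a) (hzero _ (hmem y hy) _ (by simp [hT y hy])
        (hw₂ y hy _ rfl) h)
      simpa using this))
  have hbase : ∀ u v, ((t₀, u, v) : ℝ × Euc m × Euc l) ∈ e.source := fun u v ↦ by
    rw [hsrc]; exact ⟨ht₀, trivial⟩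
  refine ⟨a, b, e, g₂, p₂, g₃, p₃, hsrc, het, hx₀e, he, hes, hgp₂, hgp₃, ?_, ?_, ?_, ?_⟩
  · intro u v
    have := S.factorDual_factorMap_swap (τ := τ) hd (hmem _ (hbase u v))
    rwa [hg₃ _ (hbase u v), hp₂ _ (hbase u v)] at this
  · intro u v
    have := S.swap.factorDual_factorMap_swap (τ := τ) hd (hmem _ (hbase u v))
    rwa [hg₂ _ (hbase u v), hp₃ _ (hbase u v)] at this
  · intro y hy
    have h1 : s * y.1 = τ (e y) := by
      have := congrArg Prod.fst (heΦ y hy)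
      simp only [Φ] at this
      rw [← this, mul_inv_cancel_left₀ hs]
    have := S.eq_factorMap_add (x := e y) (τ := τ)
    rw [this, hg₂ y hy, hg₃ y hy, h1]
    rfl
  · intro y hy w w'
    rw [S.metric_decomp hN (hmem y hy), hT y hy, hT y hy,
      show y.2.1 = q₂ y from rfl, show w.2.1 = q₂ w from rfl, show w'.2.1 = q₂ w' from rfl,
      show y.2.2 = q₃ y from rfl, show w.2.2 = q₃ w from rfl, show w'.2.2 = q₃ w' from rfl,
      ← hform₂ y hy, ← hform₃ y hy, inv_mul_cancel_left₀ S.coeff_pos.ne',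
      inv_mul_cancel_left₀ S.swap.coeff_pos.ne']
    ring

end IsCalabiFrame

end ProductChart

/-! ### From conormal pairs to affine hyperspheres. -/

section Hypersphere

lemma mvfderiv_eq_fderiv' {E F : Type*} [NormedAddCommGroup E] [NormedSpace ℝ E]
    [NormedAddCommGroup F] [NormedSpace ℝ F] (f : E → F) (x : E) :
    mvfderiv 𝓘(ℝ, E) f x = fderiv ℝ f x := by
  unfold mvfderiv
  rw [mfderiv_eq_fderiv]
  rfl

lemma differentiableAt_of_mdifferentiableAt_tangent {E : Type*} [NormedAddCommGroup E]
    [NormedSpace ℝ E] {Y : Π q : E, TangentSpace 𝓘(ℝ, E) q} {u : E}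
    (hY : MDifferentiableAt 𝓘(ℝ, E) 𝓘(ℝ, E).tangent
      (fun q ↦ (⟨q, Y q⟩ : TangentBundle 𝓘(ℝ, E) E)) u) :
    DifferentiableAt ℝ (fun q ↦ (Y q : E)) u := by
  have h := ((contMDiff_snd_tangentBundle_modelSpace E 𝓘(ℝ, E) (n := 1)).mdifferentiableAt
    one_ne_zero).comp u hY
  exact h.differentiableAt

variable {m : ℕ} {W : Type*} [NormedAddCommGroup W] [NormedSpace ℝ W]

/-- The centroaffine metric of `g` computed with the conormal map `p`. -/
def conormalMetric (g : Euc m → W) (p : Euc m → W →L[ℝ] ℝ) (x : Euc m) :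
    Euc m →L[ℝ] Euc m →L[ℝ] ℝ :=
  -((ContinuousLinearMap.compL ℝ (Euc m) W ℝ).flip (fderiv ℝ g x)).comp (fderiv ℝ p x)

@[simp] lemma conormalMetric_apply (g : Euc m → W) (p : Euc m → W →L[ℝ] ℝ) (x a b : Euc m) :
    conormalMetric g p x a b = -(fderiv ℝ p x a (fderiv ℝ g x b)) := by
  simp [conormalMetric]

namespace IsConormalPair

variable {g : Euc m → W} {p : Euc m → W →L[ℝ] ℝ}

lemma injective (h : IsConormalPair g p) (x : Euc m) : Function.Injective (fderiv ℝ g x) := by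
  refine (injective_iff_map_eq_zero _).2 fun a ha ↦ ?_
  by_contra hne
  have := h.pos x a hne
  simp [ha] at this

lemma apply_fderiv_fderiv (h : IsConormalPair g p) (x a b : Euc m) :
    p x (fderiv ℝ (fderiv ℝ g) x a b) = -(fderiv ℝ p x a (fderiv ℝ g x b)) := by
  have dp := (h.smooth_dual.differentiable (by simp)) x
  have dg := ((contDiffOn_univ.2 h.smooth).fderiv_infty isOpen_univ).differentiableAt_infty
    isOpen_univ (Set.mem_univ x)
  have h1 := fderiv_clm_apply_apply (f := fun y ↦ fderiv ℝ g y b) dp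
    (dg.clm_apply (differentiableAt_const b)) a
  rw [isOpen_univ.fderiv_eq_of_eqOn (Set.mem_univ x) (g := fun _ ↦ (0 : ℝ))
    fun y _ ↦ h.apply_fderiv y b, fderiv_clm_apply_apply dg (differentiableAt_const b)] at h1
  simp at h1
  linarith

/-- The tangent space lies in the kernel of the conormal. The former has dimension `m`, the latter
at most `m` because the conormal is nonzero on `g x`. -/
lemma mem_range [FiniteDimensional ℝ W] (h : IsConormalPair g p)
    (hW : Module.finrank ℝ W = m + 1) (x : Euc m) {w : W} (hw : p x w = 0) :
    w ∈ Set.range (fderiv ℝ g x) := by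
  have hle : (fderiv ℝ g x).toLinearMap.range ≤ LinearMap.ker (p x).toLinearMap := by
    rintro _ ⟨a, rfl⟩
    exact h.apply_fderiv x a
  have h1 : Module.finrank ℝ (fderiv ℝ g x).toLinearMap.range = m := by
    rw [LinearMap.finrank_range_of_inj (h.injective x)]
    simp
  have h2 : Module.finrank ℝ (LinearMap.ker (p x).toLinearMap) < m + 1 := by
    rw [← hW]
    refine Submodule.finrank_lt fun htop ↦ ?_
    have : g x ∈ LinearMap.ker (p x).toLinearMap := htop ▸ Submodule.mem_top
    have h' : p x (g x) = 0 := this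
    rw [h.apply_self] at h'
    exact one_ne_zero h'
  have h3 := Submodule.eq_of_le_of_finrank_le hle (by omega)
  have : w ∈ LinearMap.ker (p x).toLinearMap := hw
  rw [← h3] at this
  exact this

/-- The pairing of conormal and immersion is natural under linear maps, so a factor can be moved
into its own Euclidean space without changing its centroaffine metric. -/
lemma contDiff_linear {W' : Type*} [NormedAddCommGroup W'] [NormedSpace ℝ W']
    (h : IsConormalPair g p) {g' : Euc m → W'} (A : W' →L[ℝ] W) (hA : ∀ u, A (g' u) = g u)
    (hg' : ContDiff ℝ ∞ g') : IsConormalPair g' (fun u ↦ (p u).comp A) ∧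
    ∀ u a b, conormalMetric g' (fun u ↦ (p u).comp A) u a b = conormalMetric g p u a b := by
  have hd : ∀ u a, A (fderiv ℝ g' u a) = fderiv ℝ g u a := by
    intro u a
    have h1 := A.hasFDerivAt.comp u ((hg'.differentiable (by simp)) u).hasFDerivAt
    have h2 : fderiv ℝ g u = A.comp (fderiv ℝ g' u) := by
      rw [← h1.fderiv]
      exact congrArg (fun F ↦ fderiv ℝ F u) (funext fun v ↦ (hA v).symm)
    rw [h2]
    rfl
  have hp : ∀ u a, fderiv ℝ (fun u ↦ (p u).comp A) u a = (fderiv ℝ p u a).comp A := by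
    intro u a
    have h1 := ((h.smooth_dual.differentiable (by simp)) u).hasFDerivAt.clm_comp
      (hasFDerivAt_const A u)
    rw [h1.fderiv]
    ext w
    simp
  refine ⟨⟨hg', h.smooth_dual.clm_comp contDiff_const, fun u ↦ ?_, fun u a ↦ ?_,
    fun u a ha ↦ ?_⟩, fun u a b ↦ ?_⟩
  · simp [hA, h.apply_self]
  · simp [hd, h.apply_fderiv]
  · simpa [hp, hd] using h.pos u a ha
  · simp [hp, hd]

/-- Homotheties leave the centroaffine metric unchanged but not the volume of the frame; this
freedom normalises the volume condition. -/
lemma smul (h : IsConormalPair g p) {c : ℝ} (hc : c ≠ 0) :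
    IsConormalPair (fun u ↦ c • g u) (fun u ↦ c⁻¹ • p u) ∧
    ∀ u a b, conormalMetric (fun u ↦ c • g u) (fun u ↦ c⁻¹ • p u) u a b =
      conormalMetric g p u a b := by
  have hd : ∀ u, fderiv ℝ (fun u ↦ c • g u) u = c • fderiv ℝ g u := fun u ↦
    fderiv_fun_const_smul ((h.smooth.differentiable (by simp)) u) c
  have hp : ∀ u, fderiv ℝ (fun u ↦ c⁻¹ • p u) u = c⁻¹ • fderiv ℝ p u := fun u ↦
    fderiv_fun_const_smul ((h.smooth_dual.differentiable (by simp)) u) c⁻¹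
  refine ⟨⟨h.smooth.const_smul c, h.smooth_dual.const_smul c⁻¹, fun u ↦ ?_, fun u a ↦ ?_,
    fun u a ha ↦ ?_⟩, fun u a b ↦ ?_⟩
  · simp [hc, h.apply_self]
  · simp [hd, h.apply_fderiv]
  · simpa [hp, hd, hc] using h.pos u a ha
  · simp [hp, hd, hc]

end IsConormalPair

/-- A centroaffine immersion with positive definite metric whose position vector satisfies the
volume condition is a hyperbolic affine hypersphere of mean curvature `-1`. -/
lemma IsConormalPair.isHyperbolicAffineHypersphere {ψ : Euc m → Euc (m + 1)}
    {p : Euc m → Euc (m + 1) →L[ℝ] ℝ} (h : IsConormalPair ψ p)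
    (hvol : ∀ (u : Euc m) (X : Fin m → Euc m),
      (EuclideanSpace.basisFun (Fin (m + 1)) ℝ).toBasis.det
        (Fin.snoc (α := fun _ ↦ Euc (m + 1)) (fun i ↦ fderiv ℝ ψ u (X i)) (ψ u)) ^ 2 =
      |Matrix.det (Matrix.of fun i j ↦ conormalMetric ψ p u (X i) (X j))|) :
    IsHyperbolicAffineHypersphere ψ ψ (fun u ↦ conormalMetric ψ p u) (-1) := by
  have hs : ContMDiff (𝓡 m) 𝓘(ℝ, Euc (m + 1)) ∞ ψ := h.smooth.contMDiff
  have hmv : ∀ u, mvfderiv (𝓡 m) ψ u = fderiv ℝ ψ u := mvfderiv_eq_fderiv' ψ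
  refine ⟨⟨hs, fun u ↦ ?_⟩, ⟨hs, fun u ↦ ?_, fun u Y v hY ↦ ?_, fun u v ↦ ?_, fun u X ↦ ?_⟩,
    fun u v hv ↦ ?_, fun u v ↦ ?_, by norm_num⟩
  · rw [hmv]
    exact h.injective u
  · rw [hmv]
    rintro ⟨a, ha⟩
    exact one_ne_zero (((h.apply_self u).symm.trans (congrArg (p u) ha.symm)).trans
      (h.apply_fderiv u a))
  · have hY' : DifferentiableAt ℝ (fun q : Euc m ↦ (Y q : Euc m)) u :=
      (differentiableAt_of_mdifferentiableAt_tangent hY)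
    rw [hmv]
    refine h.mem_range (by simp) u ?_
    have dg := ((contDiffOn_univ.2 h.smooth).fderiv_infty isOpen_univ).differentiableAt_infty
      isOpen_univ (Set.mem_univ u)
    have hfd : flatDeriv ψ Y u v = fderiv ℝ (fderiv ℝ ψ) u v (Y u) +
        fderiv ℝ ψ u (fderiv ℝ (fun q : Euc m ↦ (Y q : Euc m)) u v) := by
      unfold flatDeriv
      rw [mvfderiv_eq_fderiv']
      simp only [hmv]
      exact fderiv_clm_apply_apply dg hY' v
    have key : ∀ a b c : Euc m, p u (fderiv ℝ (fderiv ℝ ψ) u a b + fderiv ℝ ψ u c -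
        conormalMetric ψ p u a b • ψ u) = 0 := by
      intro a b c
      rw [map_sub, map_add, h.apply_fderiv_fderiv, h.apply_fderiv, map_smul, h.apply_self]
      simp
    rw [hfd]
    exact key v (Y u) _
  · rw [hmv]
    exact Set.mem_range_self v
  · simp only [hmv]
    exact hvol u X
  · exact (h.pos u v hv).trans_eq (conormalMetric_apply ψ p u v v).symm
  · rw [neg_one_smul, map_neg, neg_neg]

end Hypersphere

/-! ### Determinants of product frames and Gram matrices. -/

section ProductVolume

/-- Recombining two of the arguments of an alternating map multiplies it by a `2 × 2`
determinant. -/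
lemma AlternatingMap.map_update_update_add {ι R M N : Type*} [DecidableEq ι] [CommRing R]
    [AddCommGroup M] [Module R M] [AddCommGroup N] [Module R N] (F : M [⋀^ι]→ₗ[R] N) (v : ι → M)
    {i j : ι} (hij : i ≠ j) (a b c d : R) :
    F (Function.update (Function.update v i (a • v i + b • v j)) j (c • v i + d • v j)) =
      (a * d - b * c) • F v := by
  have hadd : ∀ x x' y, F (Function.update (Function.update v i (x + x')) j y) =
      F (Function.update (Function.update v i x) j y) +
      F (Function.update (Function.update v i x') j y) := by
    intro x x' y
    simp only [Function.update_comm hij, F.map_update_add]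
  have hsmul : ∀ (r : R) x y, F (Function.update (Function.update v i (r • x)) j y) =
      r • F (Function.update (Function.update v i x) j y) := by
    intro r x y
    simp only [Function.update_comm hij, F.map_update_smul]
  have hself : ∀ x, F (Function.update (Function.update v i x) j x) = 0 := fun x ↦
    F.map_eq_zero_of_eq _ (by simp [hij]) hij
  -- Expanding this zero gives the sign change under exchanging the two arguments.
  have h1 := hself (v i + v j)
  rw [hadd, F.map_update_add, F.map_update_add, hself, hself, zero_add, add_zero] at h1
  have h0 : Function.update (Function.update v i (v i)) j (v j) = v := by simp
  rw [h0] at h1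
  rw [hadd, F.map_update_add, F.map_update_add]
  simp only [F.map_update_smul, hsmul, hself, h0]
  rw [eq_neg_of_add_eq_zero_right h1]
  module

lemma Fin.snoc_comp_equiv {m : ℕ} {W : Type*} (a : Fin m → W) (c : W) :
    (Fin.snoc (α := fun _ ↦ W) a c : Fin (m + 1) → W) ∘
      ((Equiv.sumCongr (Equiv.refl (Fin m)) (Equiv.ofUnique Unit (Fin 1))).trans finSumFinEquiv) =
      Sum.elim a fun _ ↦ c := by
  funext i
  rcases i with i | i
  · simp [Fin.snoc]
  · exact Fin.snoc_last (α := fun _ ↦ W) c a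

variable {m : ℕ} {W : Type*} [AddCommGroup W] [Module ℝ W]

/-- A basis indexed by `Fin (m + 1)`, indexed by `Fin m ⊕ Unit`. -/
def Module.Basis.splitLast (b : Module.Basis (Fin (m + 1)) ℝ W) :
    Module.Basis (Fin m ⊕ Unit) ℝ W :=
  b.reindex ((Equiv.sumCongr (Equiv.refl (Fin m)) (Equiv.ofUnique Unit (Fin 1))).trans
    finSumFinEquiv).symm

lemma Module.Basis.det_snoc (b : Module.Basis (Fin (m + 1)) ℝ W) (a : Fin m → W) (c : W) :
    b.det (Fin.snoc (α := fun _ ↦ W) a c) = b.splitLast.det (Sum.elim a fun _ ↦ c) := by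
  rw [splitLast, Module.Basis.det_reindex, ← Fin.snoc_comp_equiv]
  congr 1
  funext i
  simp

lemma Module.Basis.det_sumElim_smul (b : Module.Basis (Fin m ⊕ Unit) ℝ W) (x : Fin m → W) (y : W)
    (r : ℝ) : b.det (Sum.elim (fun i ↦ r • x i) fun _ ↦ r • y) =
      r ^ (m + 1) * b.det (Sum.elim x fun _ ↦ y) := by
  have := b.det.map_smul_univ (fun _ ↦ r) (Sum.elim x fun _ ↦ y)
  simp only [Finset.prod_const, Finset.card_univ, Fintype.card_sum, Fintype.card_fin,
    Fintype.card_unit, smul_eq_mul] at this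
  rw [← this]
  congr 1
  funext i
  rcases i with i | i <;> rfl

lemma Module.Basis.det_prod {ι κ W' : Type*} [Fintype ι] [DecidableEq ι] [Fintype κ]
    [DecidableEq κ] [AddCommGroup W'] [Module ℝ W'] (b : Module.Basis ι ℝ W)
    (b' : Module.Basis κ ℝ W') (v : ι → W) (v' : κ → W') :
    (b.prod b').det (Sum.elim (fun i ↦ (v i, 0)) fun j ↦ (0, v' j)) = b.det v * b'.det v' := by
  rw [Module.Basis.det_apply, Module.Basis.det_apply, Module.Basis.det_apply,
    ← Matrix.det_fromBlocks_zero₂₁ _ 0]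
  congr 1
  ext i j
  rcases i with i | i <;> rcases j with j | j <;> simp [Module.Basis.toMatrix]

/-- The volume of the tangent frame and the position vector of a product parametrised as
`α • g₂ + β • g₃`. -/
lemma det_product_frame {l : ℕ} {W₂ W₃ : Type*}
    [AddCommGroup W₂] [Module ℝ W₂] [AddCommGroup W₃] [Module ℝ W₃]
    (b₂ : Module.Basis (Fin m ⊕ Unit) ℝ W₂) (b₃ : Module.Basis (Fin l ⊕ Unit) ℝ W₃)
    (x₂ : Fin m → W₂) (y₂ : W₂) (x₃ : Fin l → W₃) (y₃ : W₃) (α β k₂ k₃ : ℝ) :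
    (b₂.prod b₃).det (Sum.elim
      (Sum.elim (fun i ↦ (α • x₂ i, 0)) fun _ ↦ ((k₂ * α) • y₂, (k₃ * β) • y₃))
      (Sum.elim (fun j ↦ (0, β • x₃ j)) fun _ ↦ (α • y₂, β • y₃))) =
      (k₂ - k₃) * (α ^ (m + 1) * β ^ (l + 1)) * (b₂.det (Sum.elim x₂ fun _ ↦ y₂) *
        b₃.det (Sum.elim x₃ fun _ ↦ y₃)) := by
  have h1 := Module.Basis.det_prod b₂ b₃ (Sum.elim (fun i ↦ α • x₂ i) fun _ ↦ α • y₂)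
    (Sum.elim (fun i ↦ β • x₃ i) fun _ ↦ β • y₃)
  have hs₂ := Module.Basis.det_sumElim_smul b₂ x₂ y₂ α
  have hs₃ := Module.Basis.det_sumElim_smul b₃ x₃ y₃ β
  rw [hs₂, hs₃] at h1
  -- The t-derivative and the position vector are combinations of α y₂ and β y₃ with rows (k₂, k₃)
  -- and (1, 1); hence the factor k₂ - k₃.
  have h2 := (b₂.prod b₃).det.map_update_update_add (Sum.elim
    (fun i ↦ ((Sum.elim (fun i ↦ α • x₂ i) fun _ ↦ α • y₂ : Fin m ⊕ Unit → W₂) i, (0 : W₃)))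
    fun j ↦ ((0 : W₂), (Sum.elim (fun i ↦ β • x₃ i) fun _ ↦ β • y₃ : Fin l ⊕ Unit → W₃) j))
    (i := Sum.inl (Sum.inr ())) (j := Sum.inr (Sum.inr ())) (by simp) k₂ k₃ 1 1
  rw [h1, smul_eq_mul] at h2
  trans (k₂ * 1 - k₃ * 1) * (α ^ (m + 1) * (b₂.det (Sum.elim x₂ fun _ ↦ y₂)) *
    (β ^ (l + 1) * b₃.det (Sum.elim x₃ fun _ ↦ y₃)))
  · rw [← h2]
    congr 1
    funext i
    rcases i with (i | i) | (i | i) <;> simp [Function.update, smul_smul]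
  · ring

lemma det_product_gram {m l : ℕ} (G₂ : Matrix (Fin m) (Fin m) ℝ) (G₃ : Matrix (Fin l) (Fin l) ℝ)
    (r c₂ c₃ : ℝ) (G : Matrix ((Fin m ⊕ Unit) ⊕ Fin l) ((Fin m ⊕ Unit) ⊕ Fin l) ℝ)
    (hG : G = Matrix.fromBlocks (Matrix.fromBlocks (c₂ • G₂) 0 0 (Matrix.of fun _ _ ↦ r)) 0 0
      (c₃ • G₃)) :
    G.det = c₂ ^ m * r * c₃ ^ l * (G₂.det * G₃.det) := by
  rw [hG, Matrix.det_fromBlocks_zero₂₁, Matrix.det_fromBlocks_zero₂₁]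
  simp
  ring

lemma Matrix.det_ne_zero_of_dotProduct_pos {m : ℕ} (G : Matrix (Fin m) (Fin m) ℝ)
    (h : ∀ a, a ≠ 0 → 0 < a ⬝ᵥ Matrix.mulVec G a) : G.det ≠ 0 := by
  intro h0
  obtain ⟨a, ha, ha'⟩ := Matrix.exists_mulVec_eq_zero_iff.2 h0
  have := h a ha
  simp [ha'] at this

end ProductVolume

/-! ### Decomposition of the ambient space, with unit determinant. -/

section Splitting

variable {m l : ℕ} {W : Type*} [NormedAddCommGroup W] [NormedSpace ℝ W]

/-- The functional `p₂ u` isolates `c`. A fixed vector killed by every `p₂ u` is also killed by the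
derivatives of `p₂`, so applying the derivative in direction `a` leaves only the metric value at (a,
a), which is nonzero unless a = 0. -/
lemma IsConormalPair.coeff_eq_zero {g₂ : Euc m → W} {p₂ : Euc m → W →L[ℝ] ℝ}
    {g₃ : Euc l → W} (h₂ : IsConormalPair g₂ p₂) (hg₃ : ContDiff ℝ ∞ g₃)
    (h₂₃ : ∀ u v, p₂ u (g₃ v) = 0) (u : Euc m) (v : Euc l) {w : W} (hw : ∀ u, p₂ u w = 0)
    {c c' : ℝ} {a : Euc m} {b : Euc l}
    (he : c • g₂ u + fderiv ℝ g₂ u a + (c' • g₃ v + fderiv ℝ g₃ v b) = w) : c = 0 ∧ a = 0 := by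
  have h₂₃' : ∀ u, p₂ u (fderiv ℝ g₃ v b) = 0 := by
    intro u
    have h1 := (p₂ u).hasFDerivAt.comp v ((hg₃.differentiable (by simp)) v).hasFDerivAt
    have h2 : (p₂ u) ∘ g₃ = fun _ ↦ 0 := funext fun v ↦ h₂₃ u v
    rw [h2] at h1
    have h3 := h1.unique (hasFDerivAt_const (0 : ℝ) v)
    simpa using congrArg (fun F ↦ F b) h3
  have hc : c = 0 := by
    have h1 := congrArg (p₂ u) he
    simpa [h₂.apply_self, h₂.apply_fderiv, h₂₃, h₂₃', hw] using h1
  refine ⟨hc, ?_⟩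
  by_contra ha
  have hpos := h₂.pos u a ha
  have hD : ∀ z : W, (∀ u, p₂ u z = 0) → fderiv ℝ p₂ u a z = 0 := by
    intro z hz
    have h1 := fderiv_clm_apply_apply ((h₂.smooth_dual.differentiable (by simp)) u)
      (differentiableAt_const z) a
    simpa [hz] using h1.symm
  have h1 := congrArg (fderiv ℝ p₂ u a) he
  rw [hc] at h1
  simp [hD _ hw, hD _ h₂₃', hD _ (fun u ↦ h₂₃ u v)] at h1
  linarith

/-- Two complementary conormal pairs split the ambient space. -/
lemma IsConormalPair.exists_linearEquiv [FiniteDimensional ℝ W]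
    {g₂ : Euc m → W} {p₂ : Euc m → W →L[ℝ] ℝ} {g₃ : Euc l → W} {p₃ : Euc l → W →L[ℝ] ℝ}
    (h₂ : IsConormalPair g₂ p₂) (h₃ : IsConormalPair g₃ p₃) (h₂₃ : ∀ u v, p₂ u (g₃ v) = 0)
    (h₃₂ : ∀ u v, p₃ v (g₂ u) = 0) (hW : Module.finrank ℝ W = (m + 1) + (l + 1)) :
    ∃ A : (Euc (m + 1) × Euc (l + 1)) ≃ₗ[ℝ] W,
      (∀ u, (A.symm (g₂ u)).2 = 0) ∧ ∀ v, (A.symm (g₃ v)).1 = 0 := by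
  -- The summands are spanned by the position and tangent vectors of each factor at the point 0.
  -- Every other value of `g₂` lies in the first summand because all `p₃ v` annihilate it, and
  -- likewise for `g₃`.
  let J₂ : (ℝ × Euc m) →ₗ[ℝ] W := (LinearMap.toSpanSingleton ℝ W (g₂ 0)).coprod
    (fderiv ℝ g₂ 0).toLinearMap
  let J₃ : (ℝ × Euc l) →ₗ[ℝ] W := (LinearMap.toSpanSingleton ℝ W (g₃ 0)).coprod
    (fderiv ℝ g₃ 0).toLinearMap
  let J := J₂.coprod J₃
  have hJ : ∀ x, J x = x.1.1 • g₂ 0 + fderiv ℝ g₂ 0 x.1.2 +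
      (x.2.1 • g₃ 0 + fderiv ℝ g₃ 0 x.2.2) := fun x ↦ rfl
  have hz₂ : ∀ x, (∀ u, p₂ u (J x) = 0) → x.1 = 0 := by
    intro x hx
    have := h₂.coeff_eq_zero h₃.smooth h₂₃ 0 0 hx (hJ x).symm
    exact Prod.ext this.1 this.2
  have hz₃ : ∀ x, (∀ v, p₃ v (J x) = 0) → x.2 = 0 := by
    intro x hx
    have := h₃.coeff_eq_zero h₂.smooth (fun u v ↦ h₃₂ v u) 0 0 hx
      ((add_comm _ _).trans (hJ x).symm)
    exact Prod.ext this.1 this.2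
  have hinj : Function.Injective J := by
    refine (injective_iff_map_eq_zero _).2 fun x hx ↦ Prod.ext (hz₂ x ?_) (hz₃ x ?_) <;> simp [hx]
  let L : ((ℝ × Euc m) × (ℝ × Euc l)) ≃ₗ[ℝ] W :=
    LinearMap.linearEquivOfInjective J hinj (by simp [hW]; ring)
  let E₂ : Euc (m + 1) ≃ₗ[ℝ] (ℝ × Euc m) := LinearEquiv.ofFinrankEq _ _ (by simp; ring)
  let E₃ : Euc (l + 1) ≃ₗ[ℝ] (ℝ × Euc l) := LinearEquiv.ofFinrankEq _ _ (by simp; ring)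
  have hL : ∀ w, J (L.symm w) = w := fun w ↦ L.apply_symm_apply w
  refine ⟨(E₂.prodCongr E₃).trans L, fun u ↦ ?_, fun v ↦ ?_⟩
  · have := hz₃ (L.symm (g₂ u)) fun v ↦ by rw [hL, h₃₂]
    simp [this]
  · have := hz₂ (L.symm (g₃ v)) fun u ↦ by rw [hL, h₂₃]
    simp [this]

/-- The linear form of `concat`. -/
def concatEquiv {a b c : ℕ} (hc : c = a + b) : (Euc a × Euc b) ≃ₗ[ℝ] Euc c where
  toFun x := concat hc x.1 x.2
  invFun y := (WithLp.toLp 2 fun i ↦ y (Fin.cast hc.symm (Fin.castAdd b i)),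
    WithLp.toLp 2 fun i ↦ y (Fin.cast hc.symm (Fin.natAdd a i)))
  map_add' x y := by
    subst hc
    ext i
    refine Fin.addCases (fun i ↦ ?_) (fun i ↦ ?_) i <;> simp [concat]
  map_smul' r x := by
    subst hc
    ext i
    refine Fin.addCases (fun i ↦ ?_) (fun i ↦ ?_) i <;> simp [concat]
  left_inv x := by
    subst hc
    refine Prod.ext ?_ ?_ <;> ext i <;> simp [concat]
  right_inv y := by
    subst hc
    ext i
    refine Fin.addCases (fun i ↦ ?_) (fun i ↦ ?_) i <;> simp [concat]

lemma exists_linearEquiv_det_eq (m : ℕ) {d : ℝ} (hd : d ≠ 0) :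
    ∃ B : Euc (m + 1) ≃ₗ[ℝ] Euc (m + 1), LinearMap.det B.toLinearMap = d := by
  let b := (EuclideanSpace.basisFun (Fin (m + 1)) ℝ).toBasis
  let B := Matrix.toLin b b (Matrix.diagonal (Pi.mulSingle 0 d))
  have hB : LinearMap.det B = d := by
    rw [LinearMap.det_toLin, Matrix.det_diagonal, Finset.prod_pi_mulSingle']
    simp
  exact ⟨LinearEquiv.ofIsUnitDet (f := B) (v := b) (v' := b) (by
    rw [LinearMap.toMatrix_toLin, Matrix.det_diagonal, Finset.prod_pi_mulSingle']
    simpa using hd), by simpa using hB⟩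

/-- A splitting of `ℝᶜ` may be normalised to be unimodular. -/
lemma exists_det_eq_one {a b c : ℕ} (hc : c = (a + 1) + b)
    (A : (Euc (a + 1) × Euc b) ≃ₗ[ℝ] Euc c) :
    ∃ A' : (Euc (a + 1) × Euc b) ≃ₗ[ℝ] Euc c,
      LinearMap.det ((concatEquiv hc).symm.trans A').toLinearMap = 1 ∧
      (∀ w, (A.symm w).2 = 0 → (A'.symm w).2 = 0) ∧
      ∀ w, (A.symm w).1 = 0 → (A'.symm w).1 = 0 := by
  let F := ((concatEquiv hc).symm.trans A)
  have hF : LinearMap.det F.toLinearMap ≠ 0 := (LinearEquiv.isUnit_det' F).ne_zero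
  -- The determinant is corrected inside the first factor only, so both summands are preserved.
  obtain ⟨B, hB⟩ := exists_linearEquiv_det_eq a (inv_ne_zero hF)
  let P := B.prodCongr (LinearEquiv.refl ℝ (Euc b))
  refine ⟨P.trans A, ?_, fun w hw ↦ ?_, fun w hw ↦ ?_⟩
  · have h1 : ((concatEquiv hc).symm.trans (P.trans A)).toLinearMap = F.toLinearMap ∘ₗ
        ((concatEquiv hc).toLinearMap ∘ₗ P.toLinearMap ∘ₗ (concatEquiv hc).symm.toLinearMap) := by
      ext; simp [F]
    rw [h1, LinearMap.det_comp, LinearMap.det_conj]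
    have h2 : P.toLinearMap = LinearMap.prodMap B.toLinearMap LinearMap.id := rfl
    rw [h2, LinearMap.det_prodMap, hB]
    simp [hF]
  · simpa [P] using hw
  · simp [P, hw]

end Splitting

/-! ### Separation of the volume condition and the Calabi exponents. -/

section CalabiCoordinates

/-- Arranges the frame as 𝒟₂-vectors, t-direction, 𝒟₃-vectors, position, to match the product
determinant. No sign appears, since the basis is reindexed together with the vectors and a Gram
determinant is invariant under simultaneous permutations of rows and columns. -/
lemma exists_basis_det_sum {n m l : ℕ} (hn : 1 + m + l = n) {E W : Type*} [AddCommGroup W]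
    [Module ℝ W] (b : Module.Basis (Fin (n + 1)) ℝ W) :
    ∃ b' : Module.Basis ((Fin m ⊕ Unit) ⊕ (Fin l ⊕ Unit)) ℝ W,
      ∀ (F : E → W) (y : W) (G : E → E → ℝ) (c : ℝ),
        (∀ X : Fin n → E, b.det (Fin.snoc (α := fun _ ↦ W) (fun i ↦ F (X i)) y) ^ 2 * c =
          |Matrix.det (Matrix.of fun i j ↦ G (X i) (X j))|) →
        ∀ X : (Fin m ⊕ Unit) ⊕ Fin l → E,
          b'.det (Sum.elim (fun i ↦ F (X (Sum.inl i)))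
            (Sum.elim (fun j ↦ F (X (Sum.inr j))) fun _ ↦ y)) ^ 2 * c =
          |Matrix.det (Matrix.of fun i j ↦ G (X i) (X j))| := by
  let σ : (Fin m ⊕ Unit) ⊕ Fin l ≃ Fin n := Fintype.equivFinOfCardEq (by simp; omega)
  let τ : (Fin m ⊕ Unit) ⊕ (Fin l ⊕ Unit) ≃ Fin n ⊕ Unit :=
    (Equiv.sumAssoc _ _ _).symm.trans (Equiv.sumCongr σ (Equiv.refl Unit))
  refine ⟨b.splitLast.reindex τ.symm, fun F y G c h X ↦ ?_⟩
  have h1 := h (X ∘ σ.symm)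
  rw [b.det_snoc] at h1
  rw [Module.Basis.det_reindex]
  have h2 : (Sum.elim (fun i ↦ F (X (Sum.inl i)))
      (Sum.elim (fun j ↦ F (X (Sum.inr j))) fun _ ↦ y)) ∘ τ.symm =
      Sum.elim (fun i ↦ F ((X ∘ σ.symm) i)) fun _ ↦ y := by
    rw [← Equiv.eq_comp_symm, Equiv.symm_symm]
    funext i
    rcases i with (i | i) | (i | i) <;> simp [τ]
  rw [h2, h1, ← Matrix.det_submatrix_equiv_self σ]
  congr 2
  ext i j
  simp

namespace IsConormalPair

variable {m l : ℕ} {W₂ W₃ : Type*} [NormedAddCommGroup W₂] [NormedSpace ℝ W₂]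
  [NormedAddCommGroup W₃] [NormedSpace ℝ W₃]

lemma det_gram_ne_zero {g : Euc m → W₂} {p : Euc m → W₂ →L[ℝ] ℝ} (h : IsConormalPair g p)
    (u : Euc m) : Matrix.det (Matrix.of fun i j ↦ conormalMetric g p u
      (EuclideanSpace.basisFun (Fin m) ℝ i) (EuclideanSpace.basisFun (Fin m) ℝ j)) ≠ 0 := by
  refine Matrix.det_ne_zero_of_dotProduct_pos _ fun a ha ↦ ?_
  have hne : WithLp.toLp 2 a ≠ (0 : Euc m) := fun h0 ↦ ha (by
    simpa using congrArg (WithLp.ofLp) h0)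
  have h1 : WithLp.toLp 2 a = ∑ i, a i • EuclideanSpace.basisFun (Fin m) ℝ i := by
    conv_lhs => rw [← (EuclideanSpace.basisFun (Fin m) ℝ).sum_repr (WithLp.toLp 2 a)]
    simp
  have h2 : 0 < conormalMetric g p u (WithLp.toLp 2 a) (WithLp.toLp 2 a) := by
    rw [conormalMetric_apply]
    exact h.pos u _ hne
  rw [h1] at h2
  convert h2 using 1
  simp only [dotProduct, Matrix.mulVec, map_sum, map_smul, sum_apply,
    smul_apply, smul_eq_mul, Matrix.of_apply, Finset.mul_sum]
  rw [Finset.sum_comm]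
  exact Finset.sum_congr rfl fun i _ ↦ Finset.sum_congr rfl fun j _ ↦ by ring

/-- The volume condition of a product separates. -/
lemma exists_volume_constants {g₂ : Euc m → W₂} {p₂ : Euc m → W₂ →L[ℝ] ℝ} {g₃ : Euc l → W₃}
    {p₃ : Euc l → W₃ →L[ℝ] ℝ} (h₂ : IsConormalPair g₂ p₂) (h₃ : IsConormalPair g₃ p₃)
    {δ₂ : Euc m → (Fin m → Euc m) → ℝ} {δ₃ : Euc l → (Fin l → Euc l) → ℝ} {Q k a b : ℝ}
    (hab : a < b) (hQ : 0 < Q)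
    (hvol : ∀ t ∈ Set.Ioo a b, ∀ u v X₂ X₃,
      Q * Real.exp (k * t) ^ 2 * (δ₂ u X₂ ^ 2 * δ₃ v X₃ ^ 2) =
        |Matrix.det (Matrix.of fun i j ↦ conormalMetric g₂ p₂ u (X₂ i) (X₂ j))| *
        |Matrix.det (Matrix.of fun i j ↦ conormalMetric g₃ p₃ v (X₃ i) (X₃ j))|) :
    k = 0 ∧ (∃ r, 0 < r ∧ ∀ u X, δ₂ u X ^ 2 =
        r * |Matrix.det (Matrix.of fun i j ↦ conormalMetric g₂ p₂ u (X i) (X j))|) ∧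
      ∃ r, 0 < r ∧ ∀ u X, δ₃ u X ^ 2 =
        r * |Matrix.det (Matrix.of fun i j ↦ conormalMetric g₃ p₃ u (X i) (X j))| := by
  have hG₂ := abs_pos.2 (h₂.det_gram_ne_zero 0)
  have hG₃ := abs_pos.2 (h₃.det_gram_ne_zero 0)
  set X₂ : Fin m → Euc m := fun i ↦ EuclideanSpace.basisFun (Fin m) ℝ i
  set X₃ : Fin l → Euc l := fun i ↦ EuclideanSpace.basisFun (Fin l) ℝ i
  obtain ⟨t₁, ht₁, ht₁'⟩ := exists_between hab
  obtain ⟨t₂, ht₂, ht₂'⟩ := exists_between ht₁'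
  have e₁ := hvol t₁ ⟨ht₁, ht₁'⟩ 0 0 X₂ X₃
  have e₂ := hvol t₂ ⟨ht₁.trans ht₂, ht₂'⟩ 0 0 X₂ X₃
  have hpos := mul_pos hG₂ hG₃
  have hδ : δ₂ 0 X₂ ^ 2 * δ₃ 0 X₃ ^ 2 ≠ 0 := by
    intro h0
    rw [h0, mul_zero] at e₁
    exact hpos.ne e₁
  have hδ₂ : 0 < δ₂ 0 X₂ ^ 2 := lt_of_le_of_ne (sq_nonneg _) (left_ne_zero_of_mul hδ).symm
  have hδ₃ : 0 < δ₃ 0 X₃ ^ 2 := lt_of_le_of_ne (sq_nonneg _) (right_ne_zero_of_mul hδ).symm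
  -- At fixed points and frames of the factors only the exponential depends on t; comparing two
  -- times forces its exponent to vanish.
  have hk : k = 0 := by
    have h1 := mul_left_cancel₀ hQ.ne' (mul_right_cancel₀ hδ (e₁.trans e₂.symm))
    have h2 := (sq_eq_sq₀ (Real.exp_pos _).le (Real.exp_pos _).le).1 h1
    have h3 : k * (t₁ - t₂) = 0 := by
      have := Real.exp_injective h2
      linarith
    exact (mul_eq_zero.1 h3).resolve_right (by linarith)
  -- Each constant comes from freezing the other factor at the point 0 with its standard frame.
  refine ⟨hk, ⟨_, div_pos hG₃ (mul_pos hQ hδ₃), fun u X ↦ ?_⟩,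
    ⟨_, div_pos hG₂ (mul_pos hQ hδ₂), fun v X ↦ ?_⟩⟩
  · have := hvol t₁ ⟨ht₁, ht₁'⟩ u 0 X X₃
    rw [hk, zero_mul, Real.exp_zero] at this
    have hne := hδ₃.ne'
    have hne' := hQ.ne'
    rw [div_mul_eq_mul_div, eq_div_iff (mul_ne_zero hne' hne)]
    linear_combination this
  · have := hvol t₁ ⟨ht₁, ht₁'⟩ 0 v X₂ X
    rw [hk, zero_mul, Real.exp_zero] at this
    have hne := hδ₂.ne'
    have hne' := hQ.ne'
    rw [div_mul_eq_mul_div, eq_div_iff (mul_ne_zero hne' hne)]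
    linear_combination this

/-- Rescaling normalises the volume condition. -/
lemma exists_smul_isHyperbolicAffineHypersphere {ψ : Euc m → Euc (m + 1)}
    {p : Euc m → Euc (m + 1) →L[ℝ] ℝ} (h : IsConormalPair ψ p) {r : ℝ} (hr : 0 < r)
    (hvol : ∀ (u : Euc m) (X : Fin m → Euc m),
      (EuclideanSpace.basisFun (Fin (m + 1)) ℝ).toBasis.det
        (Fin.snoc (α := fun _ ↦ Euc (m + 1)) (fun i ↦ fderiv ℝ ψ u (X i)) (ψ u)) ^ 2 =
      r * |Matrix.det (Matrix.of fun i j ↦ conormalMetric ψ p u (X i) (X j))|) :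
    ∃ (c : ℝ) (h : Π u : Euc m, TangentSpace (𝓡 m) u →L[ℝ] TangentSpace (𝓡 m) u →L[ℝ] ℝ),
      0 < c ∧ IsHyperbolicAffineHypersphere (fun u ↦ c⁻¹ • ψ u) (fun u ↦ c⁻¹ • ψ u) h (-1) := by
  -- Scaling by `c⁻¹` multiplies the squared determinant of `m + 1` vectors by `c ^ (-2 (m + 1))`
  -- and keeps the metric.
  obtain ⟨c, hc, hcr⟩ : ∃ c : ℝ, 0 < c ∧ c ^ (2 * (m + 1)) = r :=
    ⟨r ^ ((2 * (m + 1) : ℕ) : ℝ)⁻¹, by positivity, Real.rpow_inv_natCast_pow hr.le (by simp)⟩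
  obtain ⟨h1, h2⟩ := h.smul (inv_ne_zero hc.ne')
  refine ⟨c, _, hc, h1.isHyperbolicAffineHypersphere fun u X ↦ ?_⟩
  have hd : fderiv ℝ (fun u ↦ c⁻¹ • ψ u) u = c⁻¹ • fderiv ℝ ψ u :=
    fderiv_fun_const_smul ((h.smooth.differentiable (by simp)) u) _
  simp only [h2, hd, smul_apply]
  rw [Module.Basis.det_snoc, Module.Basis.det_sumElim_smul, ← Module.Basis.det_snoc, mul_pow,
    hvol, ← mul_assoc, ← hcr]
  rw [← pow_mul, mul_comm (m + 1) 2, ← mul_pow, inv_mul_cancel₀ hc.ne', one_pow, one_mul]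

end IsConormalPair

set_option maxHeartbeats 2000000 in
/-- A centroaffine immersion of an open set with a Calabi frame that satisfies the volume
condition is locally a Calabi product of hyperbolic affine hyperspheres. -/
theorem IsCalabiFrame.exists_calabiProduct {n m l : ℕ} (hn : 1 + m + l = n) {U : Set (Euc n)}
    {lam l₂ l₃ : ℝ} {f : Euc n → Euc (n + 1)} {Γ : Euc n → Euc n → Euc n → Euc n}
    {H : Euc n → Euc n →L[ℝ] Euc n →L[ℝ] ℝ} {K : Euc n → Euc n →L[ℝ] Euc n →L[ℝ] Euc n}
    {T : Euc n → Euc n} {V : Fin m → Euc n → Euc n} {Z : Fin l → Euc n → Euc n}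
    (S : IsCalabiFrame U lam l₂ l₃ f Γ H K T V Z) (hconv : Convex ℝ U)
    {x₀ : Euc n} (hx₀ : x₀ ∈ U)
    (hV : Module.finrank ℝ (Submodule.span ℝ (Set.range fun i ↦ V i x₀)) = m)
    (hZ : Module.finrank ℝ (Submodule.span ℝ (Set.range fun i ↦ Z i x₀)) = l)
    (hvol : ∀ x ∈ U, ∀ X : Fin n → Euc n,
      (EuclideanSpace.basisFun (Fin (n + 1)) ℝ).toBasis.det
        (Fin.snoc (α := fun _ ↦ Euc (n + 1)) (fun i ↦ fderiv ℝ f x (X i)) (f x)) ^ 2 * lam ^ 2 =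
      |Matrix.det (Matrix.of fun i j ↦ H x (X i) (X j))|) :
    ∃ (ψ₁ : Euc m → Euc (m + 1)) (ψ₂ : Euc l → Euc (l + 1))
      (h₁ : Π x : Euc m, TangentSpace (𝓡 m) x →L[ℝ] TangentSpace (𝓡 m) x →L[ℝ] ℝ)
      (h₂ : Π x : Euc l, TangentSpace (𝓡 l) x →L[ℝ] TangentSpace (𝓡 l) x →L[ℝ] ℝ)
      (c₁ c₂ a b : ℝ) (e : OpenPartialHomeomorph (ℝ × Euc m × Euc l) (Euc n))
      (A : Euc (n + 1) →ₗ[ℝ] Euc (n + 1)),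
      IsHyperbolicAffineHypersphere ψ₁ ψ₁ h₁ (-1) ∧
      IsHyperbolicAffineHypersphere ψ₂ ψ₂ h₂ (-1) ∧ 0 < c₁ ∧ 0 < c₂ ∧
      e.source = Set.Ioo a b ×ˢ Set.univ ∧ e.target ⊆ U ∧ x₀ ∈ e.target ∧
      ContDiffOn ℝ ∞ e e.source ∧ ContDiffOn ℝ ∞ e.symm e.target ∧
      LinearMap.det A = 1 ∧
      ∀ x ∈ e.source, f (e x) = A (calabiProduct hn c₁ c₂ ψ₁ ψ₂ x) := by
  have hl₂ := S.ne_zero.1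
  have hm : 0 < √((m : ℝ) + 1) := Real.sqrt_pos.2 (by positivity)
  have hl : 0 < √((l : ℝ) + 1) := Real.sqrt_pos.2 (by positivity)
  -- With τ = s t, this makes l₂ s the prescribed exponent of the first factor; the exponent of the
  -- second is then dictated by the volume condition.
  set s : ℝ := √((l : ℝ) + 1) / √((m : ℝ) + 1) / l₂ with hs_def
  have hs : s ≠ 0 := by positivity
  obtain ⟨a, b, e, g₂, p₂, g₃, p₃, hsrc, het, hx₀e, he, hes, hg₂, hg₃, h₂₃, h₃₂, hf, hH⟩ :=
    S.exists_product hconv (by simp) (by simp [hn]) hx₀ hV hZ hs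
  have hc : n + 1 = (m + 1) + (l + 1) := by omega
  obtain ⟨A₀, hA₀₂, hA₀₃⟩ := hg₂.exists_linearEquiv hg₃ h₂₃ h₃₂ (by simp [hc])
  obtain ⟨A, hAdet, hA₂, hA₃⟩ := exists_det_eq_one hc A₀
  replace hA₂ := fun u ↦ hA₂ _ (hA₀₂ u)
  replace hA₃ := fun v ↦ hA₃ _ (hA₀₃ v)
  let ψ₂ : Euc m → Euc (m + 1) := fun u ↦ (A.symm (g₂ u)).1
  let ψ₃ : Euc l → Euc (l + 1) := fun v ↦ (A.symm (g₃ v)).2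
  have hgψ₂ : ∀ u, A (ψ₂ u, 0) = g₂ u := fun u ↦ by
    rw [← hA₂ u]
    exact A.apply_symm_apply _
  have hgψ₃ : ∀ v, A (0, ψ₃ v) = g₃ v := fun v ↦ by
    rw [← hA₃ v]
    exact A.apply_symm_apply _
  have hψ₂ : ContDiff ℝ ∞ ψ₂ := (LinearMap.toContinuousLinearMap
    (LinearMap.fst ℝ _ _ ∘ₗ A.symm.toLinearMap)).contDiff.comp hg₂.smooth
  have hψ₃ : ContDiff ℝ ∞ ψ₃ := (LinearMap.toContinuousLinearMap
    (LinearMap.snd ℝ _ _ ∘ₗ A.symm.toLinearMap)).contDiff.comp hg₃.smooth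
  obtain ⟨q₂, hq₂, hmet₂⟩ : ∃ q, IsConormalPair ψ₂ q ∧ ∀ u a b,
      conormalMetric ψ₂ q u a b = conormalMetric g₂ p₂ u a b := ⟨_, hg₂.contDiff_linear (LinearMap.toContinuousLinearMap
    (A.toLinearMap ∘ₗ LinearMap.inl ℝ _ _)) hgψ₂ hψ₂⟩
  obtain ⟨q₃, hq₃, hmet₃⟩ : ∃ q, IsConormalPair ψ₃ q ∧ ∀ u a b,
      conormalMetric ψ₃ q u a b = conormalMetric g₃ p₃ u a b := ⟨_, hg₃.contDiff_linear (LinearMap.toContinuousLinearMap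
    (A.toLinearMap ∘ₗ LinearMap.inr ℝ _ _)) hgψ₃ hψ₃⟩
  have hfA : ∀ y ∈ e.source, f (e y) = A (Real.exp (l₂ * (s * y.1)) • ψ₂ y.2.1,
      Real.exp (l₃ * (s * y.1)) • ψ₃ y.2.2) := by
    intro y hy
    rw [hf y hy, ← hgψ₂, ← hgψ₃, ← map_smul, ← map_smul, ← map_add]
    simp
  have hdf : ∀ y ∈ e.source, ∀ w, fderiv ℝ f (e y) (fderiv ℝ e y w) =
      A ((l₂ * s * w.1 * Real.exp (l₂ * (s * y.1))) • ψ₂ y.2.1 +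
          Real.exp (l₂ * (s * y.1)) • fderiv ℝ ψ₂ y.2.1 w.2.1,
        (l₃ * s * w.1 * Real.exp (l₃ * (s * y.1))) • ψ₃ y.2.2 +
          Real.exp (l₃ * (s * y.1)) • fderiv ℝ ψ₃ y.2.2 w.2.2) := by
    intro y hy w
    rw [← fderiv_comp_chart S.isOpen het he S.smooth hy, e.open_source.fderiv_eq_of_eqOn hy hfA]
    have d₂ := ((hψ₂.differentiable (by simp)) y.2.1).hasFDerivAt.comp y
      (hasFDerivAt_fst.comp y (hasFDerivAt_snd (𝕜 := ℝ) (p := y)))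
    have d₃ := ((hψ₃.differentiable (by simp)) y.2.2).hasFDerivAt.comp y
      (hasFDerivAt_snd.comp y (hasFDerivAt_snd (𝕜 := ℝ) (p := y)))
    have dt := (hasFDerivAt_fst (𝕜 := ℝ) (p := y)).const_mul s
    have h1 := (LinearMap.toContinuousLinearMap A.toLinearMap).hasFDerivAt.comp y
      ((((dt.const_mul l₂).exp).smul d₂).prodMk (((dt.const_mul l₃).exp).smul d₃))
    have h2 := congrArg (fun F ↦ F w) h1.fderiv
    refine h2.trans (congrArg A (Prod.ext ?_ ?_))
    · simp
      module
    · simp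
      module
  obtain ⟨b', hb'⟩ := exists_basis_det_sum hn (E := Euc n)
    (EuclideanSpace.basisFun (Fin (n + 1)) ℝ).toBasis
  set b₂ := (EuclideanSpace.basisFun (Fin (m + 1)) ℝ).toBasis
  set b₃ := (EuclideanSpace.basisFun (Fin (l + 1)) ℝ).toBasis
  set B := (b₂.splitLast.prod b₃.splitLast).map A with hB
  set D := b'.det B with hD
  have hD0 : D ≠ 0 := (b'.isUnit_det B).ne_zero
  have hBdet : ∀ w, b'.det (fun i ↦ A (w i)) = D * (b₂.splitLast.prod b₃.splitLast).det w := by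
    intro w
    rw [b'.det.eq_smul_basis_det B, AlternatingMap.smul_apply, smul_eq_mul, hB,
      Module.Basis.det_map]
    congr 2
    funext i
    simp
  have hκ := S.coeff_pos
  have hκ' := S.swap.coeff_pos
  have hlne : l₂ - l₃ ≠ 0 := left_ne_zero_of_mul hκ.ne'
  set κ₂ := ((l₂ - l₃) * l₂)⁻¹
  set κ₃ := ((l₃ - l₂) * l₃)⁻¹
  have hκ₂ : 0 < κ₂ := inv_pos.2 hκ
  have hκ₃ : 0 < κ₃ := inv_pos.2 hκ'
  have hQ : 0 < κ₂ ^ m * s ^ 2 * κ₃ ^ l := by positivity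
  have hlam := S.neg.ne
  have hab : a < b := by
    have := e.map_target hx₀e
    rw [hsrc] at this
    exact this.1.1.trans this.1.2
  obtain ⟨hk, ⟨r₂, hr₂, hvol₂⟩, ⟨r₃, hr₃, hvol₃⟩⟩ := hq₂.exists_volume_constants hq₃
    (δ₂ := fun u X ↦ b₂.det (Fin.snoc (α := fun _ ↦ Euc (m + 1))
      (fun i ↦ fderiv ℝ ψ₂ u (X i)) (ψ₂ u)))
    (δ₃ := fun u X ↦ b₃.det (Fin.snoc (α := fun _ ↦ Euc (l + 1))
      (fun i ↦ fderiv ℝ ψ₃ u (X i)) (ψ₃ u)))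
    -- `lam` comes from using `f` instead of ξ, `D` from the change of basis, `s * (l₂ - l₃)` from
    -- recombining the t-derivative with the position, and the denominator from the Gram determinant
    -- of the product metric.
    (Q := lam ^ 2 * D ^ 2 * (s * (l₂ - l₃)) ^ 2 / (κ₂ ^ m * s ^ 2 * κ₃ ^ l))
    (k := (m + 1) * (l₂ * s) + (l + 1) * (l₃ * s)) hab (by positivity) (by
      intro t ht u v X₂ X₃
      set y : ℝ × Euc m × Euc l := (t, u, v)
      have hy : y ∈ e.source := by
        rw [hsrc]
        exact ⟨ht, Set.mem_univ _⟩
      let X : (Fin m ⊕ Unit) ⊕ Fin l → ℝ × Euc m × Euc l :=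
        Sum.elim (Sum.elim (fun i ↦ (0, X₂ i, 0)) fun _ ↦ (1, 0, 0)) fun j ↦ (0, 0, X₃ j)
      have h1 := hb' (fderiv ℝ f (e y)) (f (e y)) (fun a b ↦ H (e y) a b) (lam ^ 2)
        (hvol _ (het (e.map_source hy))) (fun i ↦ fderiv ℝ e y (X i))
      rw [det_product_gram (Matrix.of fun i j ↦ conormalMetric ψ₂ q₂ u (X₂ i) (X₂ j))
        (Matrix.of fun i j ↦ conormalMetric ψ₃ q₃ v (X₃ i) (X₃ j)) (s ^ 2) κ₂ κ₃ _ (by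
          ext i j
          rcases i with (i | i) | i <;> rcases j with (j | j) | j <;>
            simp [hH y hy, X, hmet₂, hmet₃, y])] at h1
      have h2 : Sum.elim (fun i ↦ fderiv ℝ f (e y) (fderiv ℝ e y (X (Sum.inl i))))
          (Sum.elim (fun j ↦ fderiv ℝ f (e y) (fderiv ℝ e y (X (Sum.inr j)))) fun _ : Unit ↦ f (e y)) =
          fun i ↦ A (Sum.elim
            (Sum.elim (fun i ↦ (Real.exp (l₂ * (s * t)) • fderiv ℝ ψ₂ u (X₂ i), 0))
              fun _ ↦ ((l₂ * s * Real.exp (l₂ * (s * t))) • ψ₂ u,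
                (l₃ * s * Real.exp (l₃ * (s * t))) • ψ₃ v))
            (Sum.elim (fun j ↦ (0, Real.exp (l₃ * (s * t)) • fderiv ℝ ψ₃ v (X₃ j)))
              fun _ : Unit ↦ (Real.exp (l₂ * (s * t)) • ψ₂ u, Real.exp (l₃ * (s * t)) • ψ₃ v)) i) := by
        funext i
        rcases i with (i | i) | (i | i) <;> simp [hdf y hy, hfA y hy, X, y]
      rw [h2, hBdet, det_product_frame, ← Module.Basis.det_snoc, ← Module.Basis.det_snoc,
        ← Real.exp_nat_mul, ← Real.exp_nat_mul, ← Real.exp_add, abs_mul, abs_of_pos hQ,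
        abs_mul] at h1
      have h3 : ((m + 1 : ℕ) : ℝ) * (l₂ * (s * t)) + ((l + 1 : ℕ) : ℝ) * (l₃ * (s * t)) =
          ((m + 1) * (l₂ * s) + (l + 1) * (l₃ * s)) * t := by
        push_cast
        ring
      rw [h3] at h1
      rw [div_mul_eq_mul_div, div_mul_eq_mul_div, div_eq_iff hQ.ne']
      linear_combination h1)
  obtain ⟨c₂, η₂, hc₂, hyp₂⟩ := hq₂.exists_smul_isHyperbolicAffineHypersphere hr₂ hvol₂
  obtain ⟨c₃, η₃, hc₃, hyp₃⟩ := hq₃.exists_smul_isHyperbolicAffineHypersphere hr₃ hvol₃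
  have hk₂ : l₂ * s = √((l : ℝ) + 1) / √((m : ℝ) + 1) := by
    rw [hs_def]
    field_simp
  have hk₃ : l₃ * s = -(√((m : ℝ) + 1) / √((l : ℝ) + 1)) := by
    have em : √((m : ℝ) + 1) ^ 2 = m + 1 := Real.sq_sqrt (by positivity)
    have el : √((l : ℝ) + 1) ^ 2 = l + 1 := Real.sq_sqrt (by positivity)
    -- Now `hk` is (m+1) l₂s + (l+1) l₃s = 0 with l₂s known, and it is solved for l₃s.
    rw [hk₂] at hk
    have h1 : √((l : ℝ) + 1) ^ 2 * (l₃ * s + √((m : ℝ) + 1) / √((l : ℝ) + 1)) = 0 := by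
      have e₁ : √((m : ℝ) + 1) ^ 2 * (√((l : ℝ) + 1) / √((m : ℝ) + 1)) =
          √((m : ℝ) + 1) * √((l : ℝ) + 1) := by
        field_simp
      have e₂ : √((l : ℝ) + 1) ^ 2 * (√((m : ℝ) + 1) / √((l : ℝ) + 1)) =
          √((m : ℝ) + 1) * √((l : ℝ) + 1) := by
        field_simp
      rw [em] at e₁
      linear_combination hk + e₂ - e₁ + (l₃ * s) * el
    exact eq_neg_of_add_eq_zero_left ((mul_eq_zero.1 h1).resolve_left (by positivity))
  refine ⟨_, _, η₂, η₃, c₂, c₃, a, b, e, ((concatEquiv hc).symm.trans A).toLinearMap, hyp₂, hyp₃,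
    hc₂, hc₃, hsrc, het, hx₀e, he, hes, hAdet, fun y hy ↦ ?_⟩
  rw [hfA y hy]
  have h1 : calabiProduct hn c₂ c₃ (fun u ↦ c₂⁻¹ • ψ₂ u) (fun u ↦ c₃⁻¹ • ψ₃ u) y =
      concatEquiv hc (Real.exp (l₂ * (s * y.1)) • ψ₂ y.2.1,
        Real.exp (l₃ * (s * y.1)) • ψ₃ y.2.2) := by
    rw [calabiProduct, ← mul_assoc l₂, ← mul_assoc l₃, hk₂, hk₃, smul_smul, smul_smul]
    refine congrArg₂ (concat hc) (congrArg (· • _) ?_) (congrArg (· • _) ?_)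
    · rw [mul_right_comm, mul_inv_cancel₀ hc₂.ne', one_mul]
      ring_nf
    · rw [mul_right_comm, mul_inv_cancel₀ hc₃.ne', one_mul]
      ring_nf
  rw [h1]
  simp

end CalabiCoordinates

/-! ### Vector fields and derivatives in a chart of the manifold. -/

section Coordinates

lemma two_le_infty : (2 : WithTop ℕ∞) ≤ ∞ := by
  exact WithTop.coe_le_coe.2 (le_top : (2 : ℕ∞) ≤ ⊤)

lemma mlieBracket_eq_lieBracket' {E : Type*} [NormedAddCommGroup E] [NormedSpace ℝ E]
    (V W : Π x : E, TangentSpace 𝓘(ℝ, E) x) (x : E) :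
    VectorField.mlieBracket 𝓘(ℝ, E) V W x = VectorField.lieBracket ℝ (V : E → E) W x := by
  rw [← VectorField.mlieBracketWithin_univ, VectorField.mlieBracketWithin_eq_lieBracketWithin]
  exact congrFun VectorField.lieBracketWithin_univ x

variable {n : ℕ} {M : Type*} [TopologicalSpace M] [ChartedSpace (Euc n) M]

/-- The tangent vector at `q` with given components in the coordinates around `p₀`. -/
def coordVector (p₀ q : M) : Euc n →L[ℝ] TangentSpace (𝓡 n) q :=
  (mfderiv (𝓡 n) 𝓘(ℝ, Euc n) (extChartAt (𝓡 n) p₀) q).inverse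

/-- The components of a tangent vector at `q` in the coordinates around `p₀`. -/
def coordComponents (p₀ q : M) : TangentSpace (𝓡 n) q →L[ℝ] Euc n :=
  mfderiv (𝓡 n) 𝓘(ℝ, Euc n) (extChartAt (𝓡 n) p₀) q

variable {p₀ q : M} {F : Type*} [NormedAddCommGroup F] [NormedSpace ℝ F]

variable [IsManifold (𝓡 n) ∞ M]

lemma coordComponents_coordVector (hq : q ∈ (extChartAt (𝓡 n) p₀).source) (u : Euc n) :
    coordComponents p₀ q (coordVector p₀ q u) = u :=
  have : IsManifold (𝓡 n) 1 M := .of_le (n := ∞) (by simp)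
  (isInvertible_mfderiv_extChartAt hq).self_apply_inverse u

lemma coordVector_coordComponents (hq : q ∈ (extChartAt (𝓡 n) p₀).source)
    (u : TangentSpace (𝓡 n) q) : coordVector p₀ q (coordComponents p₀ q u) = u :=
  have : IsManifold (𝓡 n) 1 M := .of_le (n := ∞) (by simp)
  (isInvertible_mfderiv_extChartAt hq).inverse_apply_self u

lemma mdifferentiableAt_const_vectorField (u x : Euc n) :
    MDifferentiableAt 𝓘(ℝ, Euc n) 𝓘(ℝ, Euc n).tangent
      (fun y ↦ (⟨y, u⟩ : TangentBundle 𝓘(ℝ, Euc n) (Euc n))) x :=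
  ((contMDiffAt_vectorSpace_iff_contDiffAt (n := 1) (V := fun _ ↦ u)).2
    contDiffAt_const).mdifferentiableAt one_ne_zero

lemma contMDiffAt_extChartAt_infty (hq : q ∈ (extChartAt (𝓡 n) p₀).source) :
    ContMDiffAt (𝓡 n) 𝓘(ℝ, Euc n) ∞ (extChartAt (𝓡 n) p₀) q :=
  contMDiffAt_extChartAt' (by simpa using hq)

lemma mdifferentiableAt_coordVector (hq : q ∈ (extChartAt (𝓡 n) p₀).source) (u : Euc n) :
    MDifferentiableAt (𝓡 n) (𝓡 n).tangent
      (fun q ↦ (⟨q, coordVector p₀ q u⟩ : TangentBundle (𝓡 n) M)) q := by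
  have : IsManifold (𝓡 n) 1 M := .of_le (n := ∞) (by simp)
  exact (mdifferentiableAt_const_vectorField u _).mpullback_vectorField
    (contMDiffAt_extChartAt_infty hq) (isInvertible_mfderiv_extChartAt hq) two_le_infty

/-- Coordinate fields are pullbacks of constant fields, and pullback respects brackets.
Torsion-freeness thereby becomes symmetry of Christoffel symbols. -/
lemma mlieBracket_coordVector (hq : q ∈ (extChartAt (𝓡 n) p₀).source) (u v : Euc n) :
    VectorField.mlieBracket (𝓡 n) (fun q ↦ coordVector p₀ q u) (fun q ↦ coordVector p₀ q v) q
      = 0 := by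
  have : IsManifold (𝓡 n) (minSmoothness ℝ 2) M :=
    .of_le (n := ∞) (minSmoothness_of_isRCLikeNormedField.trans_le two_le_infty)
  have h0 : VectorField.lieBracket ℝ (fun _ : Euc n ↦ u) (fun _ ↦ v) (extChartAt (𝓡 n) p₀ q) = 0 := by
    simp [VectorField.lieBracket]
  have hb := (mlieBracket_eq_lieBracket' (fun _ : Euc n ↦ u) (fun _ ↦ v) _).trans h0
  have h := VectorField.mpullback_mlieBracket (n := ∞) (mdifferentiableAt_const_vectorField u _)
    (mdifferentiableAt_const_vectorField v _) (contMDiffAt_extChartAt_infty hq)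
    (minSmoothness_of_isRCLikeNormedField.trans_le two_le_infty)
  refine h.symm.trans ?_
  rw [VectorField.mpullback_apply]
  exact (congrArg _ hb).trans (map_zero _)

lemma mvfderiv_coordVector (hq : q ∈ (extChartAt (𝓡 n) p₀).source) {G : M → F} {g : Euc n → F}
    (hG : ∀ q ∈ (extChartAt (𝓡 n) p₀).source, G q = g (extChartAt (𝓡 n) p₀ q))
    (hg : DifferentiableAt ℝ g (extChartAt (𝓡 n) p₀ q)) (u : Euc n) :
    mvfderiv (𝓡 n) G q (coordVector p₀ q u) = fderiv ℝ g (extChartAt (𝓡 n) p₀ q) u := by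
  have h1 : G =ᶠ[nhds q] g ∘ extChartAt (𝓡 n) p₀ :=
    Filter.eventuallyEq_of_mem ((isOpen_extChartAt_source p₀).mem_nhds hq) hG
  have h2 : mfderiv (𝓡 n) 𝓘(ℝ, F) G q = (mfderiv 𝓘(ℝ, Euc n) 𝓘(ℝ, F) g
      (extChartAt (𝓡 n) p₀ q)).comp (mfderiv (𝓡 n) 𝓘(ℝ, Euc n) (extChartAt (𝓡 n) p₀) q) := by
    rw [h1.mfderiv_eq]
    exact mfderiv_comp q hg.mdifferentiableAt
      ((contMDiffAt_extChartAt_infty hq).mdifferentiableAt (by simp))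
  have h3 : mvfderiv (𝓡 n) G q (coordVector p₀ q u) =
      fderiv ℝ g (extChartAt (𝓡 n) p₀ q) (coordComponents p₀ q (coordVector p₀ q u)) := by
    rw [← mfderiv_eq_fderiv]
    exact congrArg (fun A ↦ A (coordVector p₀ q u)) h2
  rw [h3, coordComponents_coordVector hq]

lemma ContMDiff.contDiffOn_extChartAt_symm {G : M → F} (hG : ContMDiff (𝓡 n) 𝓘(ℝ, F) ∞ G)
    (p₀ : M) : ContDiffOn ℝ ∞ (G ∘ (extChartAt (𝓡 n) p₀).symm) (extChartAt (𝓡 n) p₀).target :=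
  (hG.comp_contMDiffOn (contMDiffOn_extChartAt_symm p₀)).contDiffOn

lemma ContMDiff.fderiv_extChartAt_symm {G : M → F} (hG : ContMDiff (𝓡 n) 𝓘(ℝ, F) ∞ G)
    (hq : q ∈ (extChartAt (𝓡 n) p₀).source) (u : Euc n) :
    fderiv ℝ (G ∘ (extChartAt (𝓡 n) p₀).symm) (extChartAt (𝓡 n) p₀ q) u =
      mvfderiv (𝓡 n) G q (coordVector p₀ q u) := by
  refine (mvfderiv_coordVector hq (fun q hq ↦ ?_) ?_ u).symm
  · simp only [Function.comp_apply, (extChartAt (𝓡 n) p₀).left_inv hq]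
  · exact (hG.contDiffOn_extChartAt_symm p₀).differentiableAt_infty (isOpen_extChartAt_target p₀)
      ((extChartAt (𝓡 n) p₀).map_source hq)

/-- The components form the pullback of `Y` along the inverse chart, and pullbacks of smooth fields
under smooth maps with invertible derivative are smooth. -/
lemma contDiffOn_coordComponents {Y : Π q : M, TangentSpace (𝓡 n) q} {O : Set M} (hO : IsOpen O)
    (hY : ContMDiffOn (𝓡 n) (𝓡 n).tangent ∞ (fun q ↦ (⟨q, Y q⟩ : TangentBundle (𝓡 n) M)) O)
    (p₀ : M) : ContDiffOn ℝ ∞ ((fun q ↦ coordComponents p₀ q (Y q)) ∘ (extChartAt (𝓡 n) p₀).symm)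
      ((extChartAt (𝓡 n) p₀).target ∩ (extChartAt (𝓡 n) p₀).symm ⁻¹' O) := by
  have : IsManifold (𝓡 n) 1 M := .of_le (n := ∞) (by simp)
  have htar := isOpen_extChartAt_target (I := 𝓡 n) p₀
  have hinv : ∀ x ∈ (extChartAt (𝓡 n) p₀).target,
      (mfderiv 𝓘(ℝ, Euc n) (𝓡 n) (extChartAt (𝓡 n) p₀).symm x).IsInvertible := by
    intro x hx
    have := isInvertible_mfderivWithin_extChartAt_symm hx
    simpa using this
  have hsm : ∀ x ∈ (extChartAt (𝓡 n) p₀).target,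
      ContMDiffAt 𝓘(ℝ, Euc n) (𝓡 n) ∞ (extChartAt (𝓡 n) p₀).symm x := fun x hx ↦
    (contMDiffOn_extChartAt_symm p₀).contMDiffAt (htar.mem_nhds hx)
  have key : ∀ x ∈ (extChartAt (𝓡 n) p₀).target,
      VectorField.mpullback 𝓘(ℝ, Euc n) (𝓡 n) (extChartAt (𝓡 n) p₀).symm Y x =
        coordComponents p₀ ((extChartAt (𝓡 n) p₀).symm x) (Y ((extChartAt (𝓡 n) p₀).symm x)) := by
    intro x hx
    refine (hinv x hx).inverse_apply_eq.2 ?_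
    have h := mfderivWithin_extChartAt_symm_comp_mfderiv_extChartAt (I := 𝓡 n) hx
    rw [modelWithCornersSelf_coe, Set.range_id, mfderivWithin_univ] at h
    exact (congrArg (fun A ↦ A (Y ((extChartAt (𝓡 n) p₀).symm x))) h).symm
  intro x hx
  refine ContDiffAt.contDiffWithinAt ?_
  have h1 := ContMDiffAt.mpullback_vectorField_preimage (m := ∞) (n := ∞)
    (hY.contMDiffAt (hO.mem_nhds hx.2)) (hsm x hx.1) (hinv x hx.1) (by simp)
  have h2 := contMDiffAt_vectorSpace_iff_contDiffAt.1 h1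
  exact h2.congr_of_eventuallyEq (Filter.eventuallyEq_of_mem (htar.mem_nhds hx.1)
    fun y hy ↦ (key y hy).symm)

end Coordinates

/-! ### The hypersphere and its invariants in local coordinates. -/

section LocalRepresentation

variable {n : ℕ} {M : Type*} [TopologicalSpace M] [ChartedSpace (Euc n) M]
  [IsManifold (𝓡 n) ∞ M]

/-- The components of a bilinear form in the coordinates around `p₀`. -/
def coordMetric (h : Π p : M, TangentSpace (𝓡 n) p →L[ℝ] TangentSpace (𝓡 n) p →L[ℝ] ℝ)
    (p₀ q : M) : Euc n →L[ℝ] Euc n →L[ℝ] ℝ :=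
  let B : Euc n →L[ℝ] Euc n →L[ℝ] ℝ := h q
  let X : Euc n →L[ℝ] Euc n := coordVector p₀ q
  B.bilinearComp X X

/-- The Christoffel symbols of a connection in the coordinates around `p₀`. -/
def coordChristoffel (nab : CovariantDerivative (𝓡 n) (Euc n) (TangentSpace (𝓡 n) : M → Type _))
    (p₀ q : M) (u v : Euc n) : Euc n :=
  coordComponents p₀ q (nab (fun q ↦ coordVector p₀ q v) q (coordVector p₀ q u))

/-- The components of the difference tensor in the coordinates around `p₀`. -/
def coordDifference
    (nab nabHat : CovariantDerivative (𝓡 n) (Euc n) (TangentSpace (𝓡 n) : M → Type _))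
    (p₀ q : M) : Euc n →L[ℝ] Euc n →L[ℝ] Euc n :=
  let B : Euc n →L[ℝ] Euc n →L[ℝ] Euc n := nab.difference nabHat q
  let X : Euc n →L[ℝ] Euc n := coordVector p₀ q
  let Y : Euc n →L[ℝ] Euc n := coordComponents p₀ q
  (ContinuousLinearMap.compL ℝ (Euc n) (Euc n) (Euc n) Y).comp (B.flip.bilinearComp X X)

variable {p₀ q : M}

lemma coordDifference_apply
    (nab nabHat : CovariantDerivative (𝓡 n) (Euc n) (TangentSpace (𝓡 n) : M → Type _))
    (u v : Euc n) : coordDifference nab nabHat p₀ q u v = coordComponents p₀ q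
      (differenceTensor nab nabHat q (coordVector p₀ q u) (coordVector p₀ q v)) := rfl

omit [IsManifold (𝓡 n) ∞ M] in
lemma coordMetric_apply
    (h : Π p : M, TangentSpace (𝓡 n) p →L[ℝ] TangentSpace (𝓡 n) p →L[ℝ] ℝ)
    (u v : Euc n) : coordMetric h p₀ q u v = h q (coordVector p₀ q u) (coordVector p₀ q v) := rfl

omit [IsManifold (𝓡 n) ∞ M] in
lemma comp_extChartAt_symm_apply {A : Type*} (Φ : M → A)
    (hq : q ∈ (extChartAt (𝓡 n) p₀).source) :
    (Φ ∘ (extChartAt (𝓡 n) p₀).symm) (extChartAt (𝓡 n) p₀ q) = Φ q :=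
  congrArg Φ ((extChartAt (𝓡 n) p₀).left_inv hq)

lemma differenceTensor_coordVector
    (nab nabHat : CovariantDerivative (𝓡 n) (Euc n) (TangentSpace (𝓡 n) : M → Type _))
    (hq : q ∈ (extChartAt (𝓡 n) p₀).source) (w : TangentSpace (𝓡 n) q) (v : Euc n) :
    differenceTensor nab nabHat q w (coordVector p₀ q v) =
      nab (fun q ↦ coordVector p₀ q v) q w - nabHat (fun q ↦ coordVector p₀ q v) q w := by
  have h := IsCovariantDerivativeOn.difference_apply nab.isCovariantDerivativeOnUniv
    nabHat.isCovariantDerivativeOnUniv (Set.mem_univ q) (mdifferentiableAt_coordVector hq v)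
  exact congrArg (fun A ↦ A w) h

variable {φ ξ : M → Euc (n + 1)}
  {h : Π p : M, TangentSpace (𝓡 n) p →L[ℝ] TangentSpace (𝓡 n) p →L[ℝ] ℝ} {lam : ℝ}
  {nab nabHat : CovariantDerivative (𝓡 n) (Euc n) (TangentSpace (𝓡 n) : M → Type _)}

namespace IsHyperbolicAffineHypersphere

lemma contDiffOn_position (hφ : IsHyperbolicAffineHypersphere φ ξ h lam) (p₀ : M) :
    ContDiffOn ℝ ∞ ((fun q ↦ -(lam⁻¹ • ξ q)) ∘ (extChartAt (𝓡 n) p₀).symm)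
      (extChartAt (𝓡 n) p₀).target :=
  ((hφ.affineNormal.smooth.contDiffOn_extChartAt_symm p₀).const_smul lam⁻¹).neg

/-- The shape operator being `lam` times the identity, -ξ/λ has the same differential as φ. -/
lemma fderiv_position (hφ : IsHyperbolicAffineHypersphere φ ξ h lam)
    (hq : q ∈ (extChartAt (𝓡 n) p₀).source) (u : Euc n) :
    fderiv ℝ ((fun q ↦ -(lam⁻¹ • ξ q)) ∘ (extChartAt (𝓡 n) p₀).symm) (extChartAt (𝓡 n) p₀ q) u =
      mvfderiv (𝓡 n) φ q (coordVector p₀ q u) := by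
  have hd := (hφ.affineNormal.smooth.contDiffOn_extChartAt_symm p₀).differentiableAt_infty
    (isOpen_extChartAt_target p₀) ((extChartAt (𝓡 n) p₀).map_source hq)
  have h1 := (hd.hasFDerivAt.const_smul lam⁻¹).neg
  have h2 := hφ.affineNormal.smooth.fderiv_extChartAt_symm hq u
  rw [hφ.shape] at h2
  have h3 : fderiv ℝ ((fun q ↦ -(lam⁻¹ • ξ q)) ∘ (extChartAt (𝓡 n) p₀).symm)
      (extChartAt (𝓡 n) p₀ q) = _ := h1.fderiv
  rw [h3]
  have h4 := congrArg (fun w ↦ -(lam⁻¹ • w)) h2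
  refine h4.trans ?_
  rw [map_smul, smul_neg, neg_neg, smul_smul, inv_mul_cancel₀ hφ.neg.ne, one_smul]

/-- The local representation of the position vector of an affine hypersphere. -/
lemma isCentroaffine (hφ : IsHyperbolicAffineHypersphere φ ξ h lam)
    (hnab : IsInducedConnection φ ξ h nab) {U : Set (Euc n)} (hU : IsOpen U)
    (hUt : U ⊆ (extChartAt (𝓡 n) p₀).target) :
    IsCentroaffine U lam ((fun q ↦ -(lam⁻¹ • ξ q)) ∘ (extChartAt (𝓡 n) p₀).symm)
      (coordChristoffel nab p₀ ∘ (extChartAt (𝓡 n) p₀).symm)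
      (coordMetric h p₀ ∘ (extChartAt (𝓡 n) p₀).symm) := by
  have hlam := hφ.neg.ne
  refine ⟨hU, (hφ.contDiffOn_position p₀).mono hUt, fun x hx u a hu ↦ ?_, fun x hx u v ↦ ?_⟩
  · obtain ⟨q, hq, rfl⟩ : ∃ q ∈ (extChartAt (𝓡 n) p₀).source, extChartAt (𝓡 n) p₀ q = x :=
      ⟨_, (extChartAt (𝓡 n) p₀).map_target (hUt hx), (extChartAt (𝓡 n) p₀).right_inv (hUt hx)⟩
    rw [hφ.fderiv_position hq, comp_extChartAt_symm_apply (fun q ↦ -(lam⁻¹ • ξ q)) hq] at hu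
    have ha : a = 0 := by
      by_contra ha
      refine hφ.affineNormal.transversal q ⟨(lam * a⁻¹) • coordVector p₀ q u, ?_⟩
      rw [map_smul, eq_neg_of_add_eq_zero_left hu, smul_neg, smul_neg, smul_neg, neg_neg, smul_smul,
        smul_smul, show lam * a⁻¹ * a * lam⁻¹ = 1 by field_simp, one_smul]
    rw [ha, zero_smul, add_zero] at hu
    have h1 : coordVector p₀ q u = 0 :=
      (injective_iff_map_eq_zero _).1 (hφ.immersion.injective q) _ hu
    rw [← coordComponents_coordVector hq u, h1, map_zero]
    exact ⟨rfl, ha⟩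
  · obtain ⟨q, hq, rfl⟩ : ∃ q ∈ (extChartAt (𝓡 n) p₀).source, extChartAt (𝓡 n) p₀ q = x :=
      ⟨_, (extChartAt (𝓡 n) p₀).map_target (hUt hx), (extChartAt (𝓡 n) p₀).right_inv (hUt hx)⟩
    have dd := ((hφ.contDiffOn_position p₀).fderiv_infty
      (isOpen_extChartAt_target p₀)).differentiableAt_infty
      (isOpen_extChartAt_target p₀) (hUt hx)
    have h1 := mvfderiv_coordVector hq (G := fun q ↦ mvfderiv (𝓡 n) φ q (coordVector p₀ q v))
      (fun q hq ↦ (hφ.fderiv_position hq v).symm) (dd.clm_apply (differentiableAt_const v)) u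
    rw [fderiv_clm_apply_apply dd (differentiableAt_const v)] at h1
    have h2 := hnab q (fun q ↦ coordVector p₀ q v) (coordVector p₀ q u)
      (mdifferentiableAt_coordVector hq v)
    have h3 := h1.symm.trans h2
    rw [hφ.fderiv_position hq, comp_extChartAt_symm_apply (fun q ↦ -(lam⁻¹ • ξ q)) hq,
      comp_extChartAt_symm_apply (coordMetric h p₀) hq,
      comp_extChartAt_symm_apply (coordChristoffel nab p₀) hq, coordChristoffel,
      coordVector_coordComponents hq, coordMetric_apply, smul_neg, sub_neg_eq_add, smul_smul,
      show ∀ r : ℝ, lam * r * lam⁻¹ = r from fun r ↦ by field_simp]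
    simpa using h3

/-- Both connections have symmetric Christoffel symbols: the induced one because D²f is symmetric,
the Levi-Civita one by vanishing torsion. -/
lemma coordDifference_symm (hφ : IsHyperbolicAffineHypersphere φ ξ h lam)
    (hnab : IsInducedConnection φ ξ h nab) (hnabHat : IsLeviCivita h nabHat)
    (hq : q ∈ (extChartAt (𝓡 n) p₀).source) (u v : Euc n) :
    coordDifference nab nabHat p₀ q u v = coordDifference nab nabHat p₀ q v u := by
  have S := hφ.isCentroaffine hnab (isOpen_extChartAt_target p₀) subset_rfl
  have h1 := (S.symm hφ.neg.ne ((extChartAt (𝓡 n) p₀).map_source hq) u v).1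
  have h2 := (CovariantDerivative.torsion_eq_zero_iff _).1 hnabHat.torsion_free
    (mdifferentiableAt_coordVector hq u) (mdifferentiableAt_coordVector hq v)
  rw [mlieBracket_coordVector hq, sub_eq_zero] at h2
  rw [comp_extChartAt_symm_apply (coordChristoffel nab p₀) hq, coordChristoffel,
    coordChristoffel] at h1
  rw [coordDifference_apply, coordDifference_apply, differenceTensor_coordVector _ _ hq,
    differenceTensor_coordVector _ _ hq, map_sub, map_sub, h1, h2]

lemma fderiv_coordMetric (hφ : IsHyperbolicAffineHypersphere φ ξ h lam)
    (hnab : IsInducedConnection φ ξ h nab) (hnabHat : IsLeviCivita h nabHat)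
    (hq : q ∈ (extChartAt (𝓡 n) p₀).source) (w u v : Euc n) :
    fderiv ℝ (coordMetric h p₀ ∘ (extChartAt (𝓡 n) p₀).symm) (extChartAt (𝓡 n) p₀ q) w u v =
      coordMetric h p₀ q (coordChristoffel nab p₀ q w u - coordDifference nab nabHat p₀ q w u) v +
      coordMetric h p₀ q u
        (coordChristoffel nab p₀ q w v - coordDifference nab nabHat p₀ q w v) := by
  have S := hφ.isCentroaffine hnab (isOpen_extChartAt_target p₀) subset_rfl
  have hx := (extChartAt (𝓡 n) p₀).map_source hq
  have dH := (S.contDiffOn_metric hφ.neg.ne (by simp)).differentiableAt_infty S.isOpen hx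
  have h1 := mvfderiv_coordVector hq (G := fun q ↦ h q (coordVector p₀ q u) (coordVector p₀ q v))
    (g := fun x ↦ (coordMetric h p₀ ∘ (extChartAt (𝓡 n) p₀).symm) x u v)
    (fun q hq ↦ by
      rw [comp_extChartAt_symm_apply (coordMetric h p₀) hq, coordMetric_apply])
    ((dH.clm_apply (differentiableAt_const u)).clm_apply (differentiableAt_const v)) w
  rw [fderiv_clm_apply_apply (dH.clm_apply (differentiableAt_const u)) (differentiableAt_const v),
    fderiv_clm_apply_apply dH (differentiableAt_const u)] at h1
  have h2 := hnabHat.metric q (fun q ↦ coordVector p₀ q u) (fun q ↦ coordVector p₀ q v)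
    (coordVector p₀ q w) (mdifferentiableAt_coordVector hq u) (mdifferentiableAt_coordVector hq v)
  have h3 := h1.symm.trans h2
  have h4 : ∀ u, coordVector p₀ q
      (coordChristoffel nab p₀ q w u - coordDifference nab nabHat p₀ q w u) =
      nabHat (fun q ↦ coordVector p₀ q u) q (coordVector p₀ q w) := by
    intro u
    rw [coordDifference_apply, differenceTensor_coordVector _ _ hq, coordChristoffel, ← map_sub,
      coordVector_coordComponents hq, sub_sub_cancel]
  rw [coordMetric_apply, coordMetric_apply, h4, h4]
  simpa using h3

end IsHyperbolicAffineHypersphere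

end LocalRepresentation

/-! ### Assembling the adapted frame and passing back to the manifold. -/

section Main

lemma span_eq_top_of_orthogonal {E ι κ : Type*} [AddCommGroup E] [Module ℝ E]
    [TopologicalSpace E] [FiniteDimensional ℝ E] (B : E →L[ℝ] E →L[ℝ] ℝ)
    (hpos : ∀ v, v ≠ 0 → 0 < B v v) {t : E} {v : ι → E} {z : κ → E} (ht : B t t = 1)
    (htv : ∀ w ∈ Submodule.span ℝ (Set.range v), B t w = 0)
    (htz : ∀ w ∈ Submodule.span ℝ (Set.range z), B t w = 0)
    (hvz : ∀ w ∈ Submodule.span ℝ (Set.range v), ∀ w' ∈ Submodule.span ℝ (Set.range z),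
      B w w' = 0)
    (hfin : Module.finrank ℝ E = 1 + Module.finrank ℝ (Submodule.span ℝ (Set.range v)) +
      Module.finrank ℝ (Submodule.span ℝ (Set.range z))) :
    Submodule.span ℝ ({t} ∪ Set.range v ∪ Set.range z) = ⊤ := by
  have h0 : ∀ w, B w w = 0 → w = 0 := fun w hw ↦ by
    by_contra hne
    exact (hpos w hne).ne' hw
  rw [Submodule.span_union, Submodule.span_union]
  refine Submodule.eq_top_of_finrank_eq ?_
  have ht0 : t ≠ 0 := by
    rintro rfl
    simp at ht
  have d1 : Submodule.span ℝ {t} ⊓ Submodule.span ℝ (Set.range v) = ⊥ := by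
    rw [Submodule.eq_bot_iff]
    rintro w ⟨hw, hw'⟩
    obtain ⟨a, rfl⟩ := Submodule.mem_span_singleton.1 hw
    have := htv _ hw'
    rw [map_smul, ht, smul_eq_mul, mul_one] at this
    rw [this, zero_smul]
  have d2 : (Submodule.span ℝ {t} ⊔ Submodule.span ℝ (Set.range v)) ⊓
      Submodule.span ℝ (Set.range z) = ⊥ := by
    rw [Submodule.eq_bot_iff]
    rintro w ⟨hw, hw'⟩
    obtain ⟨x, hx, y, hy, rfl⟩ := Submodule.mem_sup.1 hw
    obtain ⟨a, rfl⟩ := Submodule.mem_span_singleton.1 hx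
    refine h0 _ ?_
    rw [B.map_add, add_apply, B.map_smul, smul_apply, htz _ hw', hvz _ hy _ hw', smul_zero, add_zero]
  have f1 := Submodule.finrank_sup_add_finrank_inf_eq (Submodule.span ℝ {t})
    (Submodule.span ℝ (Set.range v))
  have f2 := Submodule.finrank_sup_add_finrank_inf_eq
    (Submodule.span ℝ {t} ⊔ Submodule.span ℝ (Set.range v)) (Submodule.span ℝ (Set.range z))
  rw [d1, finrank_bot, finrank_span_singleton ht0] at f1
  rw [d2, finrank_bot] at f2
  omega

variable {n : ℕ} {M : Type*} [TopologicalSpace M] [ChartedSpace (Euc n) M]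
  [IsManifold (𝓡 n) ∞ M] {p₀ q : M}

/-- The coordinates on a tangent space as a linear equivalence. -/
def coordEquiv (hq : q ∈ (extChartAt (𝓡 n) p₀).source) : TangentSpace (𝓡 n) q ≃ₗ[ℝ] Euc n where
  toLinearMap := (coordComponents p₀ q).toLinearMap
  invFun := coordVector p₀ q
  left_inv := coordVector_coordComponents hq
  right_inv := coordComponents_coordVector hq

/-- Replacing ξ by -ξ/λ in one slot divides the squared determinant by λ². -/
lemma IsHyperbolicAffineHypersphere.volume_position {φ ξ : M → Euc (n + 1)}
    {h : Π p : M, TangentSpace (𝓡 n) p →L[ℝ] TangentSpace (𝓡 n) p →L[ℝ] ℝ} {lam : ℝ}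
    (hφ : IsHyperbolicAffineHypersphere φ ξ h lam) (hq : q ∈ (extChartAt (𝓡 n) p₀).source)
    (X : Fin n → Euc n) :
    (EuclideanSpace.basisFun (Fin (n + 1)) ℝ).toBasis.det
        (Fin.snoc (α := fun _ ↦ Euc (n + 1)) (fun i ↦ fderiv ℝ
          ((fun q ↦ -(lam⁻¹ • ξ q)) ∘ (extChartAt (𝓡 n) p₀).symm) (extChartAt (𝓡 n) p₀ q) (X i))
          (-(lam⁻¹ • ξ q))) ^ 2 * lam ^ 2 =
      |Matrix.det (Matrix.of fun i j ↦ coordMetric h p₀ q (X i) (X j))| := by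
  have h1 := hφ.affineNormal.volume q fun i ↦ coordVector p₀ q (X i)
  simp only [hφ.fderiv_position hq, coordMetric_apply]
  rw [← h1]
  set b := (EuclideanSpace.basisFun (Fin (n + 1)) ℝ).toBasis
  set a : Fin n → Euc (n + 1) := fun i ↦ mvfderiv (𝓡 n) φ q (coordVector p₀ q (X i))
  have h2 : b.det (Fin.snoc (α := fun _ ↦ Euc (n + 1)) a (-(lam⁻¹ • ξ q))) =
      -lam⁻¹ * b.det (Fin.snoc (α := fun _ ↦ Euc (n + 1)) a (ξ q)) := by
    rw [← Fin.update_snoc_last (α := fun _ ↦ Euc (n + 1)) (x := ξ q), ← neg_smul,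
      b.det.map_update_smul, Fin.update_snoc_last, smul_eq_mul]
  rw [h2]
  have := hφ.neg.ne
  field_simp

end Main

end

theorem theorem2 {n n₂ n₃ : ℕ} (hn₂ : 0 < n₂) (hn₃ : 0 < n₃) (hn : 1 + n₂ + n₃ = n)
    {M : Type*} [TopologicalSpace M] [ChartedSpace (Euc n) M] [IsManifold (𝓡 n) ∞ M]
    -- the hypersphere, with its affine normal, affine metric and mean curvature
    (φ ξ : M → Euc (n + 1))
    (h : Π p : M, TangentSpace (𝓡 n) p →L[ℝ] TangentSpace (𝓡 n) p →L[ℝ] ℝ)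
    (lam : ℝ) (hφ : IsHyperbolicAffineHypersphere φ ξ h lam)
    -- the induced connection and the Levi-Civita connection of the affine metric
    (nab nabHat : CovariantDerivative (𝓡 n) (Euc n) (TangentSpace (𝓡 n) : M → Type _))
    (hnab : IsInducedConnection φ ξ h nab) (hnabHat : IsLeviCivita h nabHat)
    -- the three distributions, the first one being spanned by `T`
    (T : Π p : M, TangentSpace (𝓡 n) p)
    (hT : ContMDiff (𝓡 n) (𝓡 n).tangent ∞ (fun q ↦ (⟨q, T q⟩ : TangentBundle (𝓡 n) M)))
    (D₂ D₃ : Π p : M, Submodule ℝ (TangentSpace (𝓡 n) p))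
    (hD₂ : IsSmoothDistribution n₂ D₂) (hD₃ : IsSmoothDistribution n₃ D₃)
    (hTT : ∀ p, h p (T p) (T p) = 1)
    (hTD₂ : ∀ p, ∀ V ∈ D₂ p, h p (T p) V = 0)
    (hTD₃ : ∀ p, ∀ W ∈ D₃ p, h p (T p) W = 0)
    (hD₂D₃ : ∀ p, ∀ V ∈ D₂ p, ∀ W ∈ D₃ p, h p V W = 0)
    -- the conditions on the difference tensor
    (lam₁ lam₂ lam₃ : ℝ) (hsum : lam₁ = lam₂ + lam₃) (hprod : lam₂ * lam₃ = lam)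
    (hKTT : ∀ p, differenceTensor nab nabHat p (T p) (T p) = lam₁ • T p)
    (hKTV : ∀ p, ∀ V ∈ D₂ p, differenceTensor nab nabHat p (T p) V = lam₂ • V)
    (hKTW : ∀ p, ∀ W ∈ D₃ p, differenceTensor nab nabHat p (T p) W = lam₃ • W)
    (hKVW : ∀ p, ∀ V ∈ D₂ p, ∀ W ∈ D₃ p, differenceTensor nab nabHat p V W = 0) :
    ∀ p : M, IsLocallyCalabiProductAt (n₂ := n₂) (n₃ := n₃) hn φ p := by
  intro p₀
  obtain ⟨O₂, hO₂, hp₂, V, hV, hVspan⟩ := hD₂.locally_spanned p₀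
  obtain ⟨O₃, hO₃, hp₃, Z, hZ, hZspan⟩ := hD₃.locally_spanned p₀
  have htar := isOpen_extChartAt_target (I := 𝓡 n) p₀
  have hp₀ : p₀ ∈ (extChartAt (𝓡 n) p₀).source := mem_extChartAt_source p₀
  have hopen : IsOpen ((extChartAt (𝓡 n) p₀).target ∩
      (extChartAt (𝓡 n) p₀).symm ⁻¹' (O₂ ∩ O₃)) :=
    (continuousOn_extChartAt_symm p₀).isOpen_inter_preimage htar (hO₂.inter hO₃)
  obtain ⟨r, hr, hball⟩ := Metric.isOpen_iff.1 hopen (extChartAt (𝓡 n) p₀ p₀)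
    ⟨(extChartAt (𝓡 n) p₀).map_source hp₀, by
      simpa only [Set.mem_preimage, (extChartAt (𝓡 n) p₀).left_inv hp₀] using ⟨hp₂, hp₃⟩⟩
  -- A ball is convex, as needed for the potential of h(T,·), and connected, as needed to compare φ
  -- with -ξ/λ.
  set U := Metric.ball (extChartAt (𝓡 n) p₀ p₀) r
  have hx₀ : extChartAt (𝓡 n) p₀ p₀ ∈ U := Metric.mem_ball_self hr
  have hU : IsOpen U := Metric.isOpen_ball
  have hUt : U ⊆ (extChartAt (𝓡 n) p₀).target := fun x hx ↦ (hball hx).1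
  have hUq : ∀ x ∈ U, ∃ q, q ∈ (extChartAt (𝓡 n) p₀).source ∧ q ∈ O₂ ∧ q ∈ O₃ ∧
      extChartAt (𝓡 n) p₀ q = x := fun x hx ↦
    ⟨_, (extChartAt (𝓡 n) p₀).map_target (hUt hx), (hball hx).2.1, (hball hx).2.2,
      (extChartAt (𝓡 n) p₀).right_inv (hUt hx)⟩
  have hVmem : ∀ q ∈ O₂, ∀ i, V i q ∈ D₂ q := fun q hq i ↦ by
    rw [hVspan q hq]
    exact Submodule.subset_span ⟨i, rfl⟩
  have hZmem : ∀ q ∈ O₃, ∀ i, Z i q ∈ D₃ q := fun q hq i ↦ by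
    rw [hZspan q hq]
    exact Submodule.subset_span ⟨i, rfl⟩
  have hcomp : ∀ {Y : Π q : M, TangentSpace (𝓡 n) q} {O : Set M}, IsOpen O → O₂ ∩ O₃ ⊆ O →
      ContMDiffOn (𝓡 n) (𝓡 n).tangent ∞ (fun q ↦ (⟨q, Y q⟩ : TangentBundle (𝓡 n) M)) O →
      ContDiffOn ℝ ∞ ((fun q ↦ coordComponents p₀ q (Y q)) ∘ (extChartAt (𝓡 n) p₀).symm) U := by
    intro Y O hO hle hY
    exact (contDiffOn_coordComponents hO hY p₀).mono fun x hx ↦ ⟨hUt hx, hle (hball hx).2⟩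
  have hrank : ∀ {k : ℕ} {D : Submodule ℝ (TangentSpace (𝓡 n) p₀)}
      {Y : Fin k → Π q : M, TangentSpace (𝓡 n) q}, Module.finrank ℝ D = k →
      D = Submodule.span ℝ (Set.range fun i ↦ Y i p₀) →
      Module.finrank ℝ (Submodule.span ℝ (Set.range fun i ↦
        ((fun q ↦ coordComponents p₀ q (Y i q)) ∘ (extChartAt (𝓡 n) p₀).symm)
          (extChartAt (𝓡 n) p₀ p₀))) = k := by
    intro k D Y hD hDY
    have h1 : (Set.range fun i ↦ ((fun q ↦ coordComponents p₀ q (Y i q)) ∘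
        (extChartAt (𝓡 n) p₀).symm) (extChartAt (𝓡 n) p₀ p₀)) =
        coordEquiv hp₀ '' Set.range fun i ↦ Y i p₀ := by
      rw [← Set.range_comp]
      congr 1
      funext i
      exact comp_extChartAt_symm_apply (fun q ↦ coordComponents p₀ q (Y i q)) hp₀
    rw [h1, ← LinearEquiv.coe_coe, ← Submodule.map_span, ← hDY, ← hD]
    exact LinearEquiv.finrank_map_eq (coordEquiv hp₀) D
  have S : IsCalabiFrame U lam lam₂ lam₃
      ((fun q ↦ -(lam⁻¹ • ξ q)) ∘ (extChartAt (𝓡 n) p₀).symm)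
      (coordChristoffel nab p₀ ∘ (extChartAt (𝓡 n) p₀).symm)
      (coordMetric h p₀ ∘ (extChartAt (𝓡 n) p₀).symm)
      (coordDifference nab nabHat p₀ ∘ (extChartAt (𝓡 n) p₀).symm)
      ((fun q ↦ coordComponents p₀ q (T q)) ∘ (extChartAt (𝓡 n) p₀).symm)
      (fun i ↦ (fun q ↦ coordComponents p₀ q (V i q)) ∘ (extChartAt (𝓡 n) p₀).symm)
      (fun i ↦ (fun q ↦ coordComponents p₀ q (Z i q)) ∘ (extChartAt (𝓡 n) p₀).symm) := by
    refine ⟨hφ.isCentroaffine hnab hU hUt, hφ.neg, hprod, ?_, ?_, ?_,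
      hcomp isOpen_univ (Set.subset_univ _) hT.contMDiffOn,
      fun i ↦ hcomp hO₂ Set.inter_subset_left (hV i),
      fun i ↦ hcomp hO₃ Set.inter_subset_right (hZ i), ?_, ?_, ?_, ?_, ?_, ?_, ?_, ?_, ?_⟩
    all_goals
      intro x hx
      obtain ⟨q, hq, hq₂, hq₃, rfl⟩ := hUq x hx
      simp only [comp_extChartAt_symm_apply (coordMetric h p₀) hq,
        comp_extChartAt_symm_apply (coordChristoffel nab p₀) hq,
        comp_extChartAt_symm_apply (coordDifference nab nabHat p₀) hq,
        comp_extChartAt_symm_apply (fun q ↦ coordComponents p₀ q (T q)) hq,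
        fun i ↦ comp_extChartAt_symm_apply (fun q ↦ coordComponents p₀ q (V i q)) hq,
        fun i ↦ comp_extChartAt_symm_apply (fun q ↦ coordComponents p₀ q (Z i q)) hq,
        coordMetric_apply, coordDifference_apply, coordVector_coordComponents hq]
    · intro u hu
      refine hφ.posDef q _ fun h0 ↦ hu ?_
      rw [← coordComponents_coordVector hq u, h0, map_zero]
    · intro u v
      have := hφ.coordDifference_symm hnab hnabHat hq u v
      rwa [coordDifference_apply, coordDifference_apply] at this
    · intro w u v
      have := hφ.fderiv_coordMetric hnab hnabHat hq w u v
      rwa [coordMetric_apply, coordMetric_apply, coordDifference_apply,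
        coordDifference_apply] at this
    · exact hTT q
    · exact fun i ↦ hTD₂ q _ (hVmem q hq₂ i)
    · exact fun i ↦ hTD₃ q _ (hZmem q hq₃ i)
    · exact fun i j ↦ hD₂D₃ q _ (hVmem q hq₂ i) _ (hZmem q hq₃ j)
    · rw [hKTT, map_smul, hsum]
    · exact fun i ↦ by rw [hKTV q _ (hVmem q hq₂ i), map_smul]
    · exact fun i ↦ by rw [hKTW q _ (hZmem q hq₃ i), map_smul]
    · exact fun i j ↦ by rw [hKVW q _ (hVmem q hq₂ i) _ (hZmem q hq₃ j), map_zero]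
    · have hfin : FiniteDimensional ℝ (TangentSpace (𝓡 n) q) :=
        inferInstanceAs (FiniteDimensional ℝ (Euc n))
      have hn' : Module.finrank ℝ (TangentSpace (𝓡 n) q) = n :=
        (finrank_euclideanSpace_fin (𝕜 := ℝ) (n := n))
      have h1 := span_eq_top_of_orthogonal (h q) (hφ.posDef q) (t := T q) (v := fun i ↦ V i q)
        (z := fun i ↦ Z i q) (hTT q) (by rw [← hVspan q hq₂]; exact hTD₂ q)
        (by rw [← hZspan q hq₃]; exact hTD₃ q)
        (by rw [← hVspan q hq₂, ← hZspan q hq₃]; exact hD₂D₃ q)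
        (by rw [← hVspan q hq₂, ← hZspan q hq₃, hD₂.finrank_eq, hD₃.finrank_eq, hn', hn])
      have h2 : ({coordComponents p₀ q (T q)} ∪ Set.range (fun i ↦ coordComponents p₀ q (V i q)) ∪
          Set.range (fun j ↦ coordComponents p₀ q (Z j q)) : Set (Euc n)) =
          coordEquiv hq '' ({T q} ∪ Set.range (fun i ↦ V i q) ∪ Set.range fun i ↦ Z i q) := by
        rw [Set.image_union, Set.image_union, Set.image_singleton, ← Set.range_comp,
          ← Set.range_comp]
        rfl
      rw [h2, ← LinearEquiv.coe_coe, ← Submodule.map_span, h1, Submodule.map_top,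
        LinearEquiv.range]
  obtain ⟨ψ₁, ψ₂, h₁, h₂, c₁, c₂, a, b, e, A, hψ₁, hψ₂, hc₁, hc₂, hsrc, het, hx₀e, he, hes, hA,
    hfe⟩ := S.exists_calabiProduct hn (convex_ball _ _) hx₀
      (hrank (hD₂.finrank_eq p₀) (hVspan p₀ hp₂)) (hrank (hD₃.finrank_eq p₀) (hZspan p₀ hp₃))
      (fun x hx X ↦ by
        obtain ⟨q, hq, -, -, rfl⟩ := hUq x hx
        rw [comp_extChartAt_symm_apply (coordMetric h p₀) hq,
          comp_extChartAt_symm_apply (fun q ↦ -(lam⁻¹ • ξ q)) hq]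
        exact hφ.volume_position hq X)
  -- The two maps have equal differentials on a connected set; the translation `o` is the centre of
  -- the hypersphere.
  obtain ⟨o, ho⟩ := hU.exists_eq_add_of_fderiv_eq (convex_ball _ _).isPreconnected
    (((hφ.immersion.smooth.contDiffOn_extChartAt_symm p₀).mono hUt).differentiableOn (by simp))
    (((hφ.contDiffOn_position p₀).mono hUt).differentiableOn (by simp)) (fun x hx ↦ by
      obtain ⟨q, hq, -, -, rfl⟩ := hUq x hx
      ext1 u
      rw [hφ.fderiv_position hq, hφ.immersion.smooth.fderiv_extChartAt_symm hq])
  have hmap : ∀ y ∈ e.source, e y ∈ U := fun y hy ↦ het (e.map_source hy)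
  have htarget : (extChartAt (𝓡 n) p₀).target = (chartAt (Euc n) p₀).target := by
    simp
  have hsrc' : (e.trans (chartAt (Euc n) p₀).symm).source = e.source := by
    rw [OpenPartialHomeomorph.trans_source]
    refine Set.inter_eq_left.2 fun y hy ↦ ?_
    have := hUt (hmap y hy)
    rwa [htarget] at this
  refine ⟨ψ₁, ψ₂, h₁, h₂, c₁, c₂, a, b, e.trans (chartAt (Euc n) p₀).symm, A, o, hψ₁, hψ₂,
    hc₁, hc₂, hsrc'.trans hsrc, ?_, ?_, ?_, hA, ?_⟩
  · rw [OpenPartialHomeomorph.trans_target]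
    exact ⟨mem_chart_source (Euc n) p₀, hx₀e⟩
  · rw [hsrc']
    exact (contMDiffOn_extChartAt_symm p₀).comp he.contMDiffOn fun y hy ↦ hUt (hmap y hy)
  · rw [OpenPartialHomeomorph.trans_target]
    exact hes.contMDiffOn.comp ((contMDiffOn_extChartAt (x := p₀)).mono fun q hq ↦ hq.1)
      fun q hq ↦ hq.2
  · intro y hy
    rw [hsrc'] at hy
    rw [← hfe y hy]
    exact ho (hmap y hy)
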